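/- Model. All algorithms are programs for the deterministic ARBITRARY CRCW PRAM with words of $O(\log(n+P))$ bits, where $P$ is the number of processors; a program solves a problem "in time $t$ using $p$ processors" if, with any number $P\ge p$ of processors, every one of its runs halts correctly within $t$ steps. Graphs are finite and simple, are given by adjacency lists, and have at least one edge; isolated vertices are removed. For a graph $G$, $n,m,\Delta$ denote the numbers of (non-isolated) vertices and of edges and the maximum degree; $\log=\log_2$. A proper $k$-edge-coloring of $G$ maps the edges of $G$ to $\{1,\dots,\lfloor k\rfloor\}$ so that distinct edges with a common endpoint get different colors. Procedure Approx-Edge-Coloring$(G,h)$, for an integer $h\ge 0$ and a base algorithm $\mathcal A$ that computes proper $(\Delta+1)$-edge-colorings: if $h=0$, return a proper $(\Delta+1)$-edge-coloring of $G$ (with palette $\{1,\dots,\Delta+1\}$) computed by $\mathcal A$ (if $G$ has no edges, return the empty coloring with palette $\{1\}$). If $h>0$, partition the edges of $G$ into $G_1,G_2$ (on the same vertices) such that $|\deg_{G_1}(v)-\deg_{G_2}(v)|\le 2$ for all $v$; compute recursively, in parallel, colorings $\varphi_i$ of $G_i$ with palette $\{1,\dots,k_i\}$ by Approx-Edge-Coloring$(G_i,h-1)$;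 return, with palette $\{1,\dots,k_1+k_2\}$, the coloring that is $\varphi_1$ on $G_1$ and $k_1+\varphi_2$ on $G_2$. Assumptions. The PRAM program $\mathcal A$ computes a proper $(\Delta+1)$-edge-coloring of every graph in time $ECT(n,\Delta)$ using $m\cdot ECP(n,\Delta)$ processors. For integers $n\ge2$ and reals $x\ge1$, the functions $ECT(n,x)$ and $ECP(n,x)$ are non-decreasing in both arguments, $ECT(O(n),O(x))=O(ECT(n,x))$, $ECP(O(n),O(x))=O(ECP(n,x))$, $ECP(n,x)=\Omega(1)$, and $ECT(n,x)=\Omega(\log x\cdot\log n)$ for $1\le x\le n$. Theorem. (i) Let $2^h\le\Delta$. Every coloring that Procedure Approx-Edge-Coloring can return on $(G,h)$ is a proper $(\Delta+3\cdot2^h)$-edge-coloring of $G$. If $\frac1\Delta\le\varepsilon<1$ and $h=\max\{\lfloor\log(\varepsilon\Delta/3)\rfloor,0\}$, it is a proper $(1+\varepsilon)\Delta$-edge-coloring. (ii) There is a single PRAM program implementing the procedure (its input is $G$ and $h$, and its output is always a coloring that the procedure can return) such that, with constants that do not depend on $G$, $h$ and $\varepsilon$: (a) for $2^h\le\Delta$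 it runs in $O\left(ECT(n,\Delta/2^h)+h\log n\right)$ time using $O\left(m\cdot ECP(n,\Delta/2^h)\right)$ processors, and for $\frac1\Delta\le\varepsilon<1$ and $h=\max\{\lfloor\log(\varepsilon\Delta/3)\rfloor,0\}$ it runs in $O\left(ECT(n,\varepsilon^{-1})+h\log n\right)$ time using $O\left(m\cdot ECP(n,\varepsilon^{-1})\right)$ processors; (b) if moreover $ECT(n,x)=\Omega(\log^2 n)$ for all $n\ge 2$ and $x\ge1$, then for $2^h\le\Delta$ it runs in $O\left(ECT(n,\Delta/2^h)\right)$ time using $O\left(m\cdot ECP(n,\Delta/2^h)\right)$ processors, and for $\frac1\Delta\le\varepsilon<1$ and $h=\max\{\lfloor\log(\varepsilon\Delta/3)\rfloor,0\}$ it runs in $O\left(ECT(n,\varepsilon^{-1})\right)$ time using $O\left(m\cdot ECP(n,\varepsilon^{-1})\right)$ processors. -/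

import Mathlib

namespace PRAM

/-! ### The ARBITRARY CRCW PRAM

A program is a finite list of instructions. Each of `P` synchronous processors runs the same
program with its own program counter and its own registers, all of them sharing one memory.
The shared memory is organised in arrays: cell `(a, i)` is entry `i` of array `a`, and the array
named by an instruction is fixed in the program. -/

/-- Word operations. -/
inductive Op
  | add | sub | mul | div | mod | land | lor | xor | lt | eq

def Op.eval : Op → ℕ → ℕ → ℕ
  | .add, x, y => x + y
  | .sub, x, y => x - y
  | .mul, x, y => x * y
  | .div, x, y => x / y
  | .mod, x, y => x % y
  | .land, x, y => Nat.land x y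
  | .lor, x, y => Nat.lor x y
  | .xor, x, y => Nat.xor x y
  | .lt, x, y => if x < y then 1 else 0
  | .eq, x, y => if x = y then 1 else 0

/-- Expressions over the registers of a processor; a program contains finitely many of them, each
of fixed size, so that evaluating one costs a constant number of word operations. -/
inductive Expr
  | const (c : ℕ)
  | reg (r : ℕ)
  | op (o : Op) (e₁ e₂ : Expr)

def Expr.eval (ρ : ℕ → ℕ) : Expr → ℕ
  | .const c => c
  | .reg r => ρ r
  | .op o e₁ e₂ => o.eval (e₁.eval ρ) (e₂.eval ρ)

inductive Instr
  /-- register `r` := `e` -/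
  | set (r : ℕ) (e : Expr)
  /-- register `r` := entry `idx` of the shared array `arr` -/
  | load (r : ℕ) (arr : ℕ) (idx : Expr)
  /-- entry `idx` of the shared array `arr` := `val` -/
  | store (arr : ℕ) (idx val : Expr)
  /-- go to instruction number `target` if `cond` is nonzero -/
  | jump (cond : Expr) (target : ℕ)

abbrev Program := List Instr

abbrev Memory := ℕ → ℕ → ℕ

/-- The local state of a processor. -/
structure Proc where
  pc : ℕ
  reg : ℕ → ℕ

/-- A processor has halted when its program counter has left the program. -/
def Proc.Halted (A : Program) (p : Proc) : Prop := A.length ≤ p.pc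

/-- One step of a processor that sees the shared memory `M`; a halted processor does nothing. -/
def Proc.next (A : Program) (M : Memory) (p : Proc) : Proc :=
  match A[p.pc]? with
  | none => p
  | some (.set r e) => ⟨p.pc + 1, Function.update p.reg r (e.eval p.reg)⟩
  | some (.load r arr idx) => ⟨p.pc + 1, Function.update p.reg r (M arr (idx.eval p.reg))⟩
  | some (.store _ _ _) => ⟨p.pc + 1, p.reg⟩
  | some (.jump cond target) =>
      ⟨if cond.eval p.reg = 0 then p.pc + 1 else target, p.reg⟩

/-- `p.Writes A a i x`: in its next step, the processor attempts to write `x` to cell `(a, i)`. -/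
def Proc.Writes (A : Program) (p : Proc) (a i x : ℕ) : Prop :=
  ∃ idx val, A[p.pc]? = some (.store a idx val) ∧ i = idx.eval p.reg ∧ x = val.eval p.reg

structure Config (P : ℕ) where
  mem : Memory
  proc : Fin P → Proc

/-- One synchronous step. All reads precede all writes. If several processors write to the same
cell, an arbitrary one of them succeeds. -/
def Step (A : Program) {P : ℕ} (c c' : Config P) : Prop :=
  (∀ p, c'.proc p = (c.proc p).next A c.mem) ∧
  ∀ a i, (∃ p, (c.proc p).Writes A a i (c'.mem a i)) ∨
    ((∀ p x, ¬ (c.proc p).Writes A a i x) ∧ c'.mem a i = c.mem a i)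

/-- `Reaches A t c c'`: some run of `A` leads from `c` to `c'` in exactly `t` steps. -/
inductive Reaches (A : Program) {P : ℕ} : ℕ → Config P → Config P → Prop
  | refl (c : Config P) : Reaches A 0 c c
  | tail {t : ℕ} {c c' c'' : Config P} :
      Reaches A t c c' → Step A c' c'' → Reaches A (t + 1) c c''

/-- The initial configuration on memory `M`: each processor finds its index in register `0` and
the number of processors in register `1`. -/
def initial (P : ℕ) (M : Memory) : Config P where
  mem := M
  proc p := ⟨0, fun r => if r = 0 then p else if r = 1 then P else 0⟩

def Config.Halted (A : Program) {P : ℕ} (c : Config P) : Prop := ∀ p, (c.proc p).Halted A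

/-- All registers and all shared cells hold numbers smaller than `W`. -/
def Config.WordsBelow {P : ℕ} (c : Config P) (W : ℕ) : Prop :=
  (∀ a i, c.mem a i < W) ∧ ∀ p r, (c.proc p).reg r < W

/-- Every run of `A` with `P` processors on memory `M` uses only words smaller than `W`, and
within time `T` it halts with a memory that satisfies `post`. -/
def RunsWithin (A : Program) (P W : ℕ) (M : Memory) (T : ℝ) (post : Memory → Prop) : Prop :=
  ∀ (t : ℕ) (c : Config P), Reaches A t (initial P M) c →
    c.WordsBelow W ∧ (⌊T⌋₊ ≤ t → c.Halted A ∧ post c.mem)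

end PRAM

namespace EdgeColoring

open PRAM

/-! ### Graphs and their representation in memory -/

section Graphs

variable {V : Type}

/-- The number of vertices, isolated ones (which are removed from every graph) not counted. -/
noncomputable def numVertices (G : SimpleGraph V) : ℕ := G.support.ncard

noncomputable def numEdges (G : SimpleGraph V) : ℕ := G.edgeSet.ncard

noncomputable def deg (G : SimpleGraph V) (v : V) : ℕ := (G.neighborSet v).ncard

noncomputable def maxDeg [Fintype V] (G : SimpleGraph V) : ℕ := Finset.univ.sup (deg G)

/-- `φ` (of which only the values on the edges of `G` matter) maps the edges of `G` to
`{1, …, k}`, and distinct edges with a common endpoint to distinct colors. -/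
def IsProperEdgeColoring (G : SimpleGraph V) (k : ℕ) (φ : Sym2 V → ℕ) : Prop :=
  (∀ e ∈ G.edgeSet, 1 ≤ φ e ∧ φ e ≤ k) ∧
  ∀ e ∈ G.edgeSet, ∀ e' ∈ G.edgeSet, e ≠ e' → (∃ v, v ∈ e ∧ v ∈ e') → φ e ≠ φ e'

/-- `(G₁, G₂)` is a degree-splitting of `G` with discrepancy at most 2. -/
def IsDegreeSplitting (G G₁ G₂ : SimpleGraph V) : Prop :=
  G₁ ⊔ G₂ = G ∧ G₁ ⊓ G₂ = ⊥ ∧ ∀ v, |(deg G₁ v : ℤ) - (deg G₂ v : ℤ)| ≤ 2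

/-- Adjacency lists of `G` without its isolated vertices: a numbering of the vertices, and a
numbering of the arcs (each edge gives two opposite arcs) in which the arcs that leave the same
vertex are consecutive, and the vertices come in their order. -/
structure AdjacencyLists (G : SimpleGraph V) where
  vert : Fin (numVertices G) ≃ G.support
  arc : Fin (2 * numEdges G) ≃ G.Dart
  sorted : Monotone fun a => vert.symm ⟨(arc a).fst, G.mem_support.2 ⟨_, (arc a).adj⟩⟩

namespace AdjacencyLists

variable {G : SimpleGraph V} (R : AdjacencyLists G)

/-- The number of the vertex that the arc `a` leaves. -/
def tail (a : Fin (2 * numEdges G)) : Fin (numVertices G) :=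
  R.vert.symm ⟨(R.arc a).fst, G.mem_support.2 ⟨_, (R.arc a).adj⟩⟩

/-- The number of the vertex that the arc `a` enters. -/
def head (a : Fin (2 * numEdges G)) : Fin (numVertices G) :=
  R.vert.symm ⟨(R.arc a).snd, G.mem_support.2 ⟨_, (R.arc a).adj.symm⟩⟩

/-- The number of the opposite arc. -/
def twin (a : Fin (2 * numEdges G)) : Fin (2 * numEdges G) :=
  R.arc.symm (R.arc a).symm

/-- The number of the first arc that leaves the vertex `i` (and `2m` for `i = n`). -/
noncomputable def offset (i : ℕ) : ℕ :=
  (Finset.univ.filter fun a => (R.tail a : ℕ) < i).card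

/-- The input memory. Array `0` holds `n`, `2m` and the parameter `h`; arrays `1` to `4` hold the
offsets, tails, heads and twins; all other cells are `0`. -/
noncomputable def input (h : ℕ) : Memory
  | 0, 0 => numVertices G
  | 0, 1 => 2 * numEdges G
  | 0, 2 => h
  | 1, i => if i ≤ numVertices G then R.offset i else 0
  | 2, a => if ha : a < 2 * numEdges G then R.tail ⟨a, ha⟩ else 0
  | 3, a => if ha : a < 2 * numEdges G then R.head ⟨a, ha⟩ else 0
  | 4, a => if ha : a < 2 * numEdges G then R.twin ⟨a, ha⟩ else 0
  | _, _ => 0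

/-- The memory `M` stores the coloring `φ` of the edges of `G`: entry `a` of array `5` is the
color of the edge of the arc `a`. -/
def Stores (M : Memory) (φ : Sym2 V → ℕ) : Prop :=
  ∀ a : Fin (2 * numEdges G), M 5 a = φ (R.arc a).edge

end AdjacencyLists

/-- The word bound `(n + P + 2) ^ w`: words of `O(log (n + P))` bits. -/
noncomputable def wordBound (G : SimpleGraph V) (P w : ℕ) : ℕ := (numVertices G + P + 2) ^ w

/-- The program `A` can output `φ` on `G` (given by some adjacency lists). -/
def CanOutput (A : Program) (G : SimpleGraph V) (φ : Sym2 V → ℕ) : Prop :=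
  ∃ (R : AdjacencyLists G) (P t : ℕ) (c : Config P),
    Reaches A t (initial P (R.input 0)) c ∧ c.Halted A ∧ R.Stores c.mem φ

/-- Procedure Approx-Edge-Coloring with the base algorithm `A`: invoked on `G` with parameter `h`,
it can return the coloring `φ` with the palette `{1, …, k}`.

If `h = 0`, then `φ` is a proper `(Δ + 1)`-edge-coloring that `A` computes on `G` (there is nothing
to compute if `G` has no edges). Otherwise, `G` is split into `G₁` and `G₂`, the procedure is
invoked on both with parameter `h - 1`, and the two colorings are merged with disjoint palettes. -/
inductive ApproxEdgeColoring [Fintype V] (A : Program) :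
    ℕ → SimpleGraph V → ℕ → (Sym2 V → ℕ) → Prop
  | base {G : SimpleGraph V} {φ : Sym2 V → ℕ} :
      IsProperEdgeColoring G (maxDeg G + 1) φ → (G ≠ ⊥ → CanOutput A G φ) →
      ApproxEdgeColoring A 0 G (maxDeg G + 1) φ
  | split {h : ℕ} {G G₁ G₂ : SimpleGraph V} {k₁ k₂ : ℕ} {φ₁ φ₂ φ : Sym2 V → ℕ} :
      IsDegreeSplitting G G₁ G₂ →
      ApproxEdgeColoring A h G₁ k₁ φ₁ → ApproxEdgeColoring A h G₂ k₂ φ₂ →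
      (∀ e ∈ G₁.edgeSet, φ e = φ₁ e) → (∀ e ∈ G₂.edgeSet, φ e = k₁ + φ₂ e) →
      ApproxEdgeColoring A (h + 1) G (k₁ + k₂) φ

end Graphs

/-! ### The complexity of algorithms -/

/-- The program `A` computes a proper `(Δ + 1)`-edge-coloring of every graph with at least one
edge, in time `ECT(n, Δ)`, whenever at least `m · ECP(n, Δ)` processors are available. -/
def SolvesVizing (A : Program) (w : ℕ) (ECT ECP : ℕ → ℝ → ℝ) : Prop :=
  ∀ (V : Type) [Fintype V] (G : SimpleGraph V) (R : AdjacencyLists G) (P : ℕ),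
    0 < numEdges G →
    numEdges G * ECP (numVertices G) (maxDeg G) ≤ (P : ℝ) →
    RunsWithin A P (wordBound G P w) (R.input 0) (ECT (numVertices G) (maxDeg G)) fun M =>
      ∃ φ, R.Stores M φ ∧ IsProperEdgeColoring G (maxDeg G + 1) φ

/-- `f` is monotonically increasing, and `f (O(n), O(x)) = O(f (n, x))`. -/
structure IsCostFunction (f : ℕ → ℝ → ℝ) : Prop where
  mono : ∀ (n n' : ℕ) (x x' : ℝ), 2 ≤ n → n ≤ n' → 1 ≤ x → x ≤ x' → f n x ≤ f n' x'
  scale : ∀ (a : ℕ) (b : ℝ), 1 ≤ a → 1 ≤ b →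
    ∃ C : ℝ, 0 < C ∧ ∀ (n : ℕ) (x : ℝ), 2 ≤ n → 1 ≤ x → f (a * n) (b * x) ≤ C * f n x

/-- On `G`, given by the adjacency lists `R`, and the parameter `h`, every run of the program `B`
with `P` processors halts within time `T` with a proper `K`-edge-coloring of `G` that is a result
of Procedure Approx-Edge-Coloring, with base algorithm `A`, for `G` and `h`. -/
def Achieves {V : Type} [Fintype V] (A B : Program) (w : ℕ) {G : SimpleGraph V}
    (R : AdjacencyLists G) (h P : ℕ) (T : ℝ) (K : ℕ) : Prop :=
  RunsWithin B P (wordBound G P w) (R.input h) T fun M =>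
    ∃ (φ : Sym2 V → ℕ) (k : ℕ), R.Stores M φ ∧ ApproxEdgeColoring A h G k φ ∧
      IsProperEdgeColoring G K φ

/-- The recursion depth `max {⌊log (ε Δ / 3)⌋, 0}`. -/
noncomputable def depth (ε : ℝ) (Δ : ℕ) : ℕ := (max ⌊Real.logb 2 (ε * Δ / 3)⌋ 0).toNat

end EdgeColoring

open PRAM EdgeColoring

/-!
The theorem combines a bound on the number of colors, a program, and a bound on its resources.

*The number of colors.* A splitting of discrepancy at most `2` yields `2 * Δ(Gᵢ) ≤ Δ(G) + 2`. By
induction on `h`, the colorings of the parts use `k ≤ Δ + 3 * 2 ^ h - 2` colors together, and the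
disjoint palettes make the union proper (`ApproxEdgeColoring.isProperEdgeColoring`). The choice of
`h` from `ε` bounds `2 ^ h` between `ε * Δ / 6` and `ε * Δ / 3`, unless `h = 0` (`depth_spec`).

*The program.* The processors are distributed cyclically among the arcs. A degree-splitting is
obtained by pairing the arcs at every vertex. Twins (the two arcs of an edge) and partners (two arcs
paired at a vertex) form two matchings, once the arcs without a partner have been matched with a
second copy of themselves. The union of two matchings has only even cycles, and the orbits of the
composition of the matchings are the two color classes on every cycle, so that comparing the
smallest elements of two orbits, found by pointer doubling in `O(log n)` steps, two-colors the arcs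
(`minLabel_matching`, `arcColor_spec`). A first round uses this to orient the edges. Each of the
following `h` rounds pairs arcs with equal orientation at every vertex, and splits the edges by the
color of the arc at the tail. In- and outdegrees are then halved up to `1`, hence the degrees up to
`2`, in all graphs of a level of the recursion at once (`LevelInv.step`, `levelStep_ens`).
The rounds take `O(h * log n)` steps, and for `h = 0` they are skipped.

The `2 ^ h` parts are then renumbered by prefix sums (`numberParts_ens`), which also yields the
palette offsets, as the maximum degree of a part is the number of different ranks in its adjacency
lists. The adjacency lists of the parts are written into interleaved arrays (`writeInputs_ens`), and
each part receives at least half of the processors of its share of the arcs. Finally, the base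
algorithm runs on all parts at once, with four instructions for one of its own. The parts proceed in
lockstep of single instructions, but nothing waits for the base algorithm to finish on another part.
Each color that it writes is read back, because concurrent writes are resolved arbitrarily, and
copied with the offset to the output (`Simulates.leads`, `approxProgram_leads`). So every run of the
program contains runs of the base algorithm on the parts, and its output is a result of the
procedure (`approxEdgeColoring_of_parts`, `leads_approxEdgeColoring`).

*The complexity.* The maximum degree of a part is at most `3 * Δ / 2 ^ h` (`maxDeg_partGraph_le`),
so monotonicity and scaling of `ECT` and `ECP` bound the time and the number of processors that the
base algorithm needs on each part. Additive constants are absorbed, because the base algorithm takes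
at least one step (`one_le_time`), and because `ECP` is bounded away from `0`; see
`exists_runsWithin`.
-/

/-! ### Runs of PRAM programs -/

namespace PRAM

/-- Every run of `A` from `c` meets `Q` within `T` steps, and up to then all words are smaller
than `W`. -/
inductive Leads (A : Program) (W : ℕ) {P : ℕ} (Q : Config P → Prop) : ℕ → Config P → Prop
  | done {T : ℕ} {c : Config P} : c.WordsBelow W → Q c → Leads A W Q T c
  | step {T : ℕ} {c : Config P} : c.WordsBelow W → (∀ c', Step A c c' → Leads A W Q T c') →
      Leads A W Q (T + 1) c

section Leads

variable {A : Program} {W P : ℕ} {Q Q' : Config P → Prop}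

theorem Leads.bind {T : ℕ} {c : Config P} (h : Leads A W Q T c) {T' : ℕ}
    (h' : ∀ c, c.WordsBelow W → Q c → Leads A W Q' T' c) : Leads A W Q' (T + T') c := by
  have lift : ∀ {T c}, Leads A W Q' T c → ∀ k, Leads A W Q' (T + k) c := by
    intro T c h
    induction h with
    | done h1 h2 => intro k; exact .done h1 h2
    | step h1 _ ih =>
      intro k
      rw [Nat.add_right_comm]
      exact .step h1 fun c' hc => ih c' hc k
  induction h with
  | done h1 h2 => rw [Nat.add_comm]; exact lift (h' _ h1 h2) _
  | step h1 _ ih =>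
    rw [Nat.add_right_comm]
    exact .step h1 ih

theorem Leads.weaken {T T' : ℕ} {c : Config P} (h : Leads A W Q T c) (hT : T ≤ T')
    (hQ : ∀ c, c.WordsBelow W → Q c → Q' c) : Leads A W Q' T' c := by
  obtain ⟨k, rfl⟩ := Nat.exists_eq_add_of_le hT
  exact h.bind fun c h1 h2 => .done h1 (hQ c h1 h2)

theorem Step.eq_of_halted {c c' : Config P} (hc : c.Halted A) (h : Step A c c') : c' = c := by
  have hn : ∀ p, A[(c.proc p).pc]? = none := fun p => List.getElem?_eq_none (hc p)
  obtain ⟨m, pr⟩ := c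
  obtain ⟨m', pr'⟩ := c'
  obtain ⟨h1, h2⟩ := h
  simp only at h1 h2 hn
  have : pr' = pr := by
    funext p
    rw [h1 p]
    simp [Proc.next, hn p]
  subst this
  congr 1
  funext a i
  rcases h2 a i with ⟨p, idx, val, h3, _⟩ | h3
  · simp [hn p] at h3
  · exact h3.2

theorem Leads.runs {T : ℕ} {c : Config P} {post : Memory → Prop}
    (h : Leads A W (fun c => c.Halted A ∧ post c.mem) T c) :
    ∀ t c', Reaches A t c c' → c'.WordsBelow W ∧ (T ≤ t → c'.Halted A ∧ post c'.mem) := by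
  have head : ∀ {t} {c c'' : Config P}, Reaches A t c c'' →
      (t = 0 ∧ c'' = c) ∨ ∃ t' c', t = t' + 1 ∧ Step A c c' ∧ Reaches A t' c' c'' := by
    intro t c c'' h
    induction h with
    | refl => left; simp
    | tail h1 h2 ih =>
      right
      rcases ih with ⟨rfl, rfl⟩ | ⟨t', c1, rfl, h3, h4⟩
      · exact ⟨0, _, rfl, h2, .refl _⟩
      · exact ⟨t' + 1, c1, rfl, h3, .tail h4 h2⟩
  induction h with
  | @done T c h1 h2 =>
    intro t c' hr
    have : c' = c := by
      induction hr with
      | refl => rfl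
      | tail _ h4 ih => have := ih h1 h2; subst this; exact h4.eq_of_halted h2.1
    subst this
    exact ⟨h1, fun _ => h2⟩
  | step h1 _ ih =>
    intro t c' hr
    rcases head hr with ⟨rfl, rfl⟩ | ⟨t', c1, rfl, h3, h4⟩
    · exact ⟨h1, fun h => by omega⟩
    · obtain ⟨h5, h6⟩ := ih c1 h3 t' c' h4
      exact ⟨h5, fun h => h6 (by omega)⟩

end Leads

/-! ### Programs executed in lockstep -/

instance : Add Expr := ⟨.op .add⟩
instance : Sub Expr := ⟨.op .sub⟩
instance : Mul Expr := ⟨.op .mul⟩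
instance : Div Expr := ⟨.op .div⟩
instance : Mod Expr := ⟨.op .mod⟩
instance (n : ℕ) : OfNat Expr n := ⟨.const n⟩

/-- The expression with value `1` if the first argument is smaller, and `0` otherwise. -/
abbrev Expr.lt : Expr → Expr → Expr := .op .lt
/-- The expression with value `1` if the arguments are equal, and `0` otherwise. -/
abbrev Expr.eq : Expr → Expr → Expr := .op .eq

section eval
variable (ρ : ℕ → ℕ) (e f : Expr)
@[simp] theorem Expr.eval_reg (r : ℕ) : (Expr.reg r).eval ρ = ρ r := rfl
@[simp] theorem Expr.eval_const (r : ℕ) : (Expr.const r).eval ρ = r := rfl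
@[simp] theorem Expr.eval_add : (e + f).eval ρ = e.eval ρ + f.eval ρ := rfl
@[simp] theorem Expr.eval_sub : (e - f).eval ρ = e.eval ρ - f.eval ρ := rfl
@[simp] theorem Expr.eval_mul : (e * f).eval ρ = e.eval ρ * f.eval ρ := rfl
@[simp] theorem Expr.eval_div : (e / f).eval ρ = e.eval ρ / f.eval ρ := rfl
@[simp] theorem Expr.eval_mod : (e % f).eval ρ = e.eval ρ % f.eval ρ := rfl
@[simp] theorem Expr.eval_two : (2 : Expr).eval ρ = 2 := rfl
@[simp] theorem Expr.eval_zero : (0 : Expr).eval ρ = 0 := rfl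
@[simp] theorem Expr.eval_one : (1 : Expr).eval ρ = 1 := rfl
@[simp] theorem Expr.eval_lt :
    (Expr.lt e f).eval ρ = if e.eval ρ < f.eval ρ then 1 else 0 := rfl
@[simp] theorem Expr.eval_eq :
    (Expr.eq e f).eval ρ = if e.eval ρ = f.eval ρ then 1 else 0 := rfl
end eval

/-- Structured programs. All processors execute them with the same program counter, so that the
condition of a loop has to be zero for all processors or for none. -/
inductive Stmt
  | set (r : ℕ) (e : Expr)
  | load (r arr : ℕ) (idx : Expr)
  | store (arr : ℕ) (idx val : Expr)
  | seq (s t : Stmt)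
  | while (c : Expr) (s : Stmt)

infixr:60 " ;; " => Stmt.seq

def Stmt.size : Stmt → ℕ
  | set _ _ => 1
  | load _ _ _ => 1
  | store _ _ _ => 1
  | seq s t => s.size + t.size
  | .while _ s => s.size + 2

/-- The code of a statement that starts at instruction number `b`. -/
def Stmt.code : ℕ → Stmt → List Instr
  | _, set r e => [.set r e]
  | _, load r arr idx => [.load r arr idx]
  | _, store arr idx val => [.store arr idx val]
  | b, seq s t => s.code b ++ t.code (b + s.size)
  | b, .while c s =>
      .jump (.eq c 0) (b + s.size + 2) :: (s.code (b + 1) ++ [.jump 1 b])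

theorem Stmt.length_code (s : Stmt) : ∀ b, (s.code b).length = s.size := by
  induction s <;> intro b <;> simp_all [Stmt.code, Stmt.size]

/-- The configuration in which all processors are at instruction number `k`. -/
def lock {P : ℕ} (k : ℕ) (M : Memory) (ρ : Fin P → ℕ → ℕ) : Config P := ⟨M, fun p => ⟨k, ρ p⟩⟩

/-- `M'` can result from `M` if processor `p` writes `val p` to entry `idx p` of array `arr`. -/
def Written {P : ℕ} (arr : ℕ) (idx val : Fin P → ℕ) (M M' : Memory) : Prop :=
  (∀ a, a ≠ arr → M' a = M a) ∧
  ∀ i, (∃ p, i = idx p ∧ M' arr i = val p) ∨ ((∀ p, i ≠ idx p) ∧ M' arr i = M arr i)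

/-- `A` contains the code `l` from instruction number `b` on. -/
def CodeAt (A : Program) (b : ℕ) (l : List Instr) : Prop :=
  ∀ j, j < l.length → A[b + j]? = l[j]?

theorem CodeAt.append {A : Program} {b : ℕ} {l l' : List Instr} (h : CodeAt A b (l ++ l')) :
    CodeAt A b l ∧ CodeAt A (b + l.length) l' := by
  constructor
  · intro j hj
    rw [h j (by simp; omega), List.getElem?_append_left hj]
  · intro j hj
    rw [add_assoc, h _ (by simp; omega), List.getElem?_append_right (by omega)]
    simp

/-- If all processors start the statement `s` on memory `M` with registers `ρ`, then every run
completes `s` within `T` steps, with all processors in lockstep at the end, in a state that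
satisfies `Q`; and all words stay smaller than `W`, if they are so at the start. -/
def Ens {P : ℕ} (W : ℕ) (s : Stmt) (T : ℕ) (M : Memory) (ρ : Fin P → ℕ → ℕ)
    (Q : Memory → (Fin P → ℕ → ℕ) → Prop) : Prop :=
  ∀ (A : Program) (b : ℕ), CodeAt A b (s.code b) → (lock b M ρ).WordsBelow W →
    Leads A W (fun c => ∃ M' ρ', c = lock (b + s.size) M' ρ' ∧ Q M' ρ') T (lock b M ρ)

section Rules

variable {P W T T' : ℕ} {M : Memory} {ρ : Fin P → ℕ → ℕ} {s t : Stmt}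
  {Q Q' : Memory → (Fin P → ℕ → ℕ) → Prop}

theorem Ens.weaken (h : Ens W s T M ρ Q) (hT : T ≤ T')
    (hQ : ∀ M' ρ', (lock 0 M' ρ').WordsBelow W → Q M' ρ' → Q' M' ρ') : Ens W s T' M ρ Q' :=
  fun A b hA hW => (h A b hA hW).weaken hT fun c hc ⟨M', ρ', h1, h2⟩ =>
    ⟨M', ρ', h1, hQ _ _ (by subst h1; exact hc) h2⟩

theorem Ens.seq (h : Ens W s T M ρ fun M' ρ' => Ens W t T' M' ρ' Q) :
    Ens W (s ;; t) (T + T') M ρ Q := by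
  intro A b hA hW
  have hA := CodeAt.append hA
  rw [Stmt.length_code] at hA
  refine (h A b hA.1 hW).bind ?_
  rintro c hc ⟨M', ρ', rfl, h2⟩
  refine (h2 A _ hA.2 hc).weaken le_rfl ?_
  rintro c hc ⟨M'', ρ'', rfl, h3⟩
  exact ⟨M'', ρ'', by rw [Stmt.size, add_assoc], h3⟩

/-- A step in which all processors execute an instruction that does not write to the memory. -/
theorem Leads.lock_step {A : Program} {b b' : ℕ} {Q : Config P → Prop} {ρ' : Fin P → ℕ → ℕ}
    (hW : (lock b M ρ).WordsBelow W)
    (hn : ∀ p, Proc.next A M ⟨b, ρ p⟩ = ⟨b', ρ' p⟩)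
    (hw : ∀ a i v, A[b]? ≠ some (.store a i v))
    (h : Leads A W Q T (lock b' M ρ')) : Leads A W Q (T + 1) (lock b M ρ) := by
  refine .step hW fun c' hc => ?_
  have : c' = lock b' M ρ' := by
    obtain ⟨m, pr⟩ := c'
    obtain ⟨h1, h2⟩ := hc
    simp only [lock, Proc.Writes] at h1 h2
    unfold lock
    congr 1
    · funext a i
      rcases h2 a i with ⟨p, idx, val, h3, _⟩ | h3
      · exact absurd h3 (hw _ _ _)
      · exact h3.2
    · funext p
      rw [h1 p, hn p]
  rwa [this]

theorem CodeAt.head {A : Program} {b : ℕ} {i : Instr} {l : List Instr} (h : CodeAt A b (i :: l)) :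
    A[b]? = some i := by
  simpa using h 0 (by simp)

theorem Ens.set {r : ℕ} {e : Expr} (hv : ∀ p, e.eval (ρ p) < W)
    (hQ : Q M fun p => Function.update (ρ p) r (e.eval (ρ p))) : Ens W (.set r e) 1 M ρ Q := by
  intro A b hA hW
  have hA := hA.head
  refine Leads.lock_step (T := 0) hW (b' := b + 1)
    (ρ' := fun p => Function.update (ρ p) r (e.eval (ρ p)))
    (fun p => by simp [Proc.next, hA]) (by simp [hA]) (.done ⟨hW.1, fun p r' => ?_⟩ ⟨_, _, rfl, hQ⟩)
  simp only [lock, Function.update_apply]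
  split
  · exact hv p
  · exact hW.2 p r'

theorem Ens.load {r arr : ℕ} {e : Expr}
    (hQ : Q M fun p => Function.update (ρ p) r (M arr (e.eval (ρ p)))) :
    Ens W (.load r arr e) 1 M ρ Q := by
  intro A b hA hW
  have hA := hA.head
  refine Leads.lock_step (T := 0) hW (b' := b + 1)
    (ρ' := fun p => Function.update (ρ p) r (M arr (e.eval (ρ p))))
    (fun p => by simp [Proc.next, hA]) (by simp [hA]) (.done ⟨hW.1, fun p r' => ?_⟩ ⟨_, _, rfl, hQ⟩)
  simp only [lock, Function.update_apply]
  split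
  · exact hW.1 _ _
  · exact hW.2 p r'

theorem Ens.store {arr : ℕ} {e v : Expr} (hv : ∀ p, v.eval (ρ p) < W)
    (hQ : ∀ M', Written arr (fun p => e.eval (ρ p)) (fun p => v.eval (ρ p)) M M' → Q M' ρ) :
    Ens W (.store arr e v) 1 M ρ Q := by
  intro A b hA hW
  have hA := hA.head
  refine .step (T := 0) hW fun c' ⟨h1, h2⟩ => ?_
  have hc : c' = lock (b + 1) c'.mem ρ := by
    obtain ⟨m, pr⟩ := c'
    simp only [lock] at h1 ⊢
    congr 1
    funext p
    rw [h1 p]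
    simp [Proc.next, hA]
  have hwr : Written arr (fun p => e.eval (ρ p)) (fun p => v.eval (ρ p)) M c'.mem := by
    constructor
    · intro a ha
      funext i
      rcases h2 a i with ⟨p, idx, val, h3, _⟩ | h3
      · simp only [lock, hA, Option.some.injEq, Instr.store.injEq] at h3
        exact absurd h3.1.symm ha
      · exact h3.2
    · intro i
      rcases h2 arr i with ⟨p, idx, val, h3, h4, h5⟩ | ⟨h3, h4⟩
      · simp only [lock, hA, Option.some.injEq, Instr.store.injEq] at h3 h4 h5
        obtain ⟨-, rfl, rfl⟩ := h3
        exact .inl ⟨p, h4, h5⟩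
      · refine .inr ⟨fun p hp => h3 p _ ⟨e, v, hA, hp, rfl⟩, h4⟩
  refine .done ⟨fun a i => ?_, fun p r => ?_⟩ ⟨_, _, hc, hQ _ hwr⟩
  · by_cases ha : a = arr
    · subst ha
      rcases hwr.2 i with ⟨p, _, h4⟩ | ⟨_, h4⟩
      · rw [h4]; exact hv p
      · rw [h4]; exact hW.1 _ _
    · rw [hwr.1 a ha]; exact hW.1 _ _
  · rw [hc]; exact hW.2 p r

theorem Ens.set_seq {r : ℕ} {e : Expr} (hv : ∀ p, e.eval (ρ p) < W)
    (h : Ens W t T M (fun p => Function.update (ρ p) r (e.eval (ρ p))) Q) :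
    Ens W (.set r e ;; t) (T + 1) M ρ Q := by
  rw [Nat.add_comm]; exact .seq (.set hv h)

theorem Ens.load_seq {r arr : ℕ} {e : Expr}
    (h : Ens W t T M (fun p => Function.update (ρ p) r (M arr (e.eval (ρ p)))) Q) :
    Ens W (.load r arr e ;; t) (T + 1) M ρ Q := by
  rw [Nat.add_comm]; exact .seq (.load h)

theorem Ens.store_seq {arr : ℕ} {e v : Expr} (hv : ∀ p, v.eval (ρ p) < W)
    (h : ∀ M', Written arr (fun p => e.eval (ρ p)) (fun p => v.eval (ρ p)) M M' →
      Ens W t T M' ρ Q) :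
    Ens W (.store arr e v ;; t) (T + 1) M ρ Q := by
  rw [Nat.add_comm]; exact .seq (.store hv h)

/-- A loop that is executed exactly `K` times; `I k` holds when `k` rounds are completed. -/
theorem Ens.while {c : Expr} (K : ℕ) (I : ℕ → Memory → (Fin P → ℕ → ℕ) → Prop)
    (h0 : I 0 M ρ)
    (hI : ∀ k, k < K → ∀ M ρ, I k M ρ → (∀ p, c.eval (ρ p) ≠ 0) ∧ Ens W s T M ρ (I (k + 1)))
    (hK : ∀ M ρ, I K M ρ → (∀ p, c.eval (ρ p) = 0) ∧ Q M ρ) :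
    Ens W (.while c s) (K * (T + 2) + 1) M ρ Q := by
  intro A b hA hW
  have hj := hA.head
  have hb : CodeAt A (b + 1) (s.code (b + 1) ++ [.jump 1 b]) := fun j hj => by
    have := hA (j + 1) (by simp only [Stmt.code, List.length_cons]; omega)
    rw [Nat.add_assoc, Nat.add_comm 1 j, this]
    simp [Stmt.code]
  obtain ⟨hs, he⟩ := hb.append
  rw [Stmt.length_code] at he
  have he := he.head
  suffices ∀ n k, k + n = K → ∀ M ρ, I k M ρ → (lock b M ρ).WordsBelow W →
      Leads A W (fun c' => ∃ M' ρ', c' = lock (b + (Stmt.while c s).size) M' ρ' ∧ Q M' ρ')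
        (n * (T + 2) + 1) (lock b M ρ) from this K 0 (by omega) M ρ h0 hW
  intro n
  induction n with
  | zero =>
    intro k hk M ρ h hW
    obtain ⟨hz, hQ⟩ := hK M ρ (by simpa [← hk] using h)
    refine Leads.lock_step (T := 0 * (T + 2)) hW (b' := b + s.size + 2) (ρ' := ρ) (fun p => ?_)
      (by simp [hj]) (.done hW ⟨M, ρ, rfl, hQ⟩)
    simp [Proc.next, hj, hz p]
  | succ n ih =>
    intro k hk M ρ h hW
    obtain ⟨hz, hB⟩ := hI k (by omega) M ρ h
    rw [show (n + 1) * (T + 2) + 1 = (T + (n * (T + 2) + 1 + 1)) + 1 by ring]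
    refine Leads.lock_step hW (b' := b + 1) (ρ' := ρ) (fun p => ?_) (by simp [hj]) ?_
    · simp [Proc.next, hj, hz p]
    · refine (hB A _ hs hW).bind ?_
      rintro c' hc ⟨M', ρ', rfl, h'⟩
      refine Leads.lock_step hc (b' := b) (ρ' := ρ') (fun p => ?_) (by simp [he])
        (ih (k + 1) (by omega) M' ρ' h' hc)
      simp [Proc.next, he]

/-- If all processors that write to the same entry agree on the value, then this value is
written. -/
theorem Written.eq {arr : ℕ} {idx val : Fin P → ℕ} {M M' : Memory} (h : Written arr idx val M M')
    (p : Fin P) (hp : ∀ p', idx p' = idx p → val p' = val p) : M' arr (idx p) = val p := by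
  rcases h.2 (idx p) with ⟨q, h1, h2⟩ | h1
  · rw [h2, hp q h1.symm]
  · exact absurd rfl (h1.1 p)

theorem Written.eq_of_ne {arr : ℕ} {idx val : Fin P → ℕ} {M M' : Memory}
    (h : Written arr idx val M M') {i : ℕ} (hi : ∀ p, i ≠ idx p) : M' arr i = M arr i := by
  rcases h.2 i with ⟨q, h1, _⟩ | h1
  · exact absurd h1 (hi q)
  · exact h1.2

end Rules

end PRAM

/-! ### Prefix sums for many keys at once -/

namespace PRAM

open Finset

theorem mul_add_inj {B x y u v : ℕ} (hu : u < B) (hv : v < B) (h : x * B + u = y * B + v) :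
    x = y ∧ u = v := by
  have h1 := congrArg (· / B) h
  have h2 := congrArg (· % B) h
  simp only [Nat.mul_add_mod', Nat.mod_eq_of_lt hu, Nat.mod_eq_of_lt hv] at h2
  simp only [mul_comm _ B, Nat.mul_add_div (by omega : 0 < B), Nat.div_eq_of_lt hu,
    Nat.div_eq_of_lt hv, add_zero] at h1
  exact ⟨h1, h2⟩

/-- The address of the sum over the elements of block number `blk`, among the blocks of length
`pw`, that have the key `key`. -/
def cell (N key blk pw : ℕ) : ℕ := (key * (2 * N + 2) + blk) * (2 * N + 2) + pw

theorem cell_inj {N k₁ b₁ p₁ k₂ b₂ p₂ : ℕ} (hb₁ : b₁ < 2 * N + 2) (hp₁ : p₁ < 2 * N + 2)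
    (hb₂ : b₂ < 2 * N + 2) (hp₂ : p₂ < 2 * N + 2) (h : cell N k₁ b₁ p₁ = cell N k₂ b₂ p₂) :
    k₁ = k₂ ∧ b₁ = b₂ ∧ p₁ = p₂ := by
  obtain ⟨h1, h2⟩ := mul_add_inj hp₁ hp₂ h
  obtain ⟨h3, h4⟩ := mul_add_inj hb₁ hb₂ h1
  exact ⟨h3, h4, h2⟩

/-- The expression for `cell N key blk pw`, where `N` is in register `3`, `key` in register
`32` and `pw` in register `14`. -/
def cellExpr (blk : Expr) : Expr :=
  (.reg 32 * (2 * .reg 3 + 2) + blk) * (2 * .reg 3 + 2) + .reg 14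

/-- Element `a` (in register `5`) has a key in register `32` and a weight in register `34`. The
weights of the elements with the same key are summed up, over blocks whose length `pw` is doubled
in each round: register `34` accumulates the sum over the block of `a`, and register `33` the
sum over the elements of the block that precede `a`. -/
def prefixSums (arr : ℕ) : Stmt :=
  .set 14 1 ;;
  .set 33 0 ;;
  .store arr (cellExpr (.reg 5 / .reg 14)) (.reg 34) ;;
  .while (.lt (.reg 14) (.reg 3)) (
    .load 18 arr (cellExpr (.reg 5 / .reg 14 + 1 - 2 * (.reg 5 / .reg 14 % 2))) ;;
    .set 33 (.reg 33 + (.reg 5 / .reg 14 % 2) * .reg 18) ;;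
    .set 34 (.reg 34 + .reg 18) ;;
    .set 14 (2 * .reg 14) ;;
    .store arr (cellExpr (.reg 5 / .reg 14)) (.reg 34))

/-- The sum over the elements of a block that have a given key. -/
def blockSum (N : ℕ) (key w : ℕ → ℕ) (k κ blk : ℕ) : ℕ :=
  ∑ b ∈ range N with b / 2 ^ k = blk ∧ key b = κ, w b

/-- The sum over the elements that precede `a` in its block and have the same key. -/
def blockRank (key w : ℕ → ℕ) (k a : ℕ) : ℕ :=
  ∑ b ∈ range a with b / 2 ^ k = a / 2 ^ k ∧ key b = key a, w b

section

variable {N : ℕ} {key w : ℕ → ℕ}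

theorem blockSum_le (k κ blk : ℕ) : blockSum N key w k κ blk ≤ ∑ b ∈ range N, w b :=
  sum_le_sum_of_subset (filter_subset _ _)

theorem blockRank_le (k a : ℕ) (ha : a < N) : blockRank key w k a ≤ ∑ b ∈ range N, w b :=
  sum_le_sum_of_subset ((filter_subset _ _).trans (range_subset_range.2 ha.le))

theorem sib_eq (x : ℕ) : (x % 2 = 0 ∧ x + 1 - 2 * (x % 2) = x + 1 ∧ x / 2 * 2 = x) ∨
    (x % 2 = 1 ∧ x + 1 - 2 * (x % 2) = x - 1 ∧ x / 2 * 2 + 1 = x) := by omega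

theorem blockSum_succ (k κ x : ℕ) :
    blockSum N key w (k + 1) κ (x / 2) =
      blockSum N key w k κ x + blockSum N key w k κ (x + 1 - 2 * (x % 2)) := by
  unfold blockSum
  rw [← sum_union]
  · congr 1
    ext b
    simp only [mem_filter, mem_range, mem_union, pow_succ, ← Nat.div_div_eq_div_mul]
    generalize b / 2 ^ k = y
    have : y / 2 = x / 2 ↔ y = x ∨ y = x + 1 - 2 * (x % 2) := by omega
    rw [this]
    tauto
  · rw [disjoint_filter]
    rintro b - ⟨h1, -⟩ ⟨h2, -⟩
    omega

theorem blockRank_succ (k a : ℕ) (ha : a < N) :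
    blockRank key w (k + 1) a = blockRank key w k a +
      (a / 2 ^ k % 2) * blockSum N key w k (key a) (a / 2 ^ k + 1 - 2 * (a / 2 ^ k % 2)) := by
  unfold blockRank blockSum
  rcases sib_eq (a / 2 ^ k) with ⟨h1, h2, h3⟩ | ⟨h1, h2, h3⟩
  · rw [h1, zero_mul, add_zero]
    congr 1
    ext b
    simp only [mem_filter, mem_range, pow_succ, ← Nat.div_div_eq_div_mul]
    refine and_congr_right fun hb => and_congr_left fun _ => ?_
    have : b / 2 ^ k ≤ a / 2 ^ k := Nat.div_le_div_right hb.le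
    omega
  · rw [h2, h1, one_mul, ← sum_union]
    · congr 1
      ext b
      simp only [mem_filter, mem_range, mem_union, pow_succ, ← Nat.div_div_eq_div_mul]
      have h4 : b / 2 ^ k < a / 2 ^ k → b < a := fun h => by
        by_contra h'
        exact absurd (Nat.div_le_div_right (c := 2 ^ k) (not_lt.1 h')) (by omega)
      constructor
      · rintro ⟨h5, h6, h7⟩
        by_cases h8 : b / 2 ^ k = a / 2 ^ k
        · exact .inl ⟨h5, h8, h7⟩
        · exact .inr ⟨by omega, by omega, h7⟩
      · rintro (⟨h5, h6, h7⟩ | ⟨h5, h6, h7⟩)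
        · exact ⟨h5, by rw [h6], h7⟩
        · exact ⟨h4 (by omega), by omega, h7⟩
    · rw [disjoint_left]
      intro b hb hb'
      simp only [mem_filter] at hb hb'
      omega

theorem blockSum_zero (κ : ℕ) {x : ℕ} (hx : x < N) (hκ : κ = key x) :
    blockSum N key w 0 κ x = w x := by
  unfold blockSum
  rw [sum_eq_single_of_mem x (by simp [hx, hκ])]
  intro b hb hbx
  simp at hb
  omega

theorem blockSum_of_forall_ne {k κ x : ℕ} (h : ∀ b < N, b / 2 ^ k = x → key b ≠ κ) :
    blockSum N key w k κ x = 0 := by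
  unfold blockSum
  rw [filter_false_of_mem, sum_empty]
  rintro b hb ⟨h1, h2⟩
  exact h b (mem_range.1 hb) h1 h2

theorem blockRank_zero (a : ℕ) : blockRank key w 0 a = 0 := by
  unfold blockRank
  rw [filter_false_of_mem, sum_empty]
  rintro b hb ⟨h1, h2⟩
  simp at hb h1
  omega

/-- The cells of the array `arr` after `k` rounds: the sums over the blocks of length `2 ^ k` are
stored, and the cells for longer blocks are empty. -/
def CellsAt (N : ℕ) (key w : ℕ → ℕ) (k : ℕ) (m : ℕ → ℕ) : Prop :=
  (∀ blk < 2 * N + 2, ∀ κ, m (cell N κ blk (2 ^ k)) = blockSum N key w k κ blk) ∧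
  ∀ j, k < j → 2 ^ j < 2 * N + 2 → ∀ blk < 2 * N + 2, ∀ κ, m (cell N κ blk (2 ^ j)) = 0

variable {P : ℕ}

theorem CellsAt.of_written {arr k : ℕ} {M M' : Memory} (hNP : N ≤ P) (hN : 0 < N)
    (hk : 2 ^ k < 2 * N + 2)
    (hz : ∀ j, k ≤ j → 2 ^ j < 2 * N + 2 → ∀ blk < 2 * N + 2, ∀ κ,
      M arr (cell N κ blk (2 ^ j)) = 0)
    (h : Written (P := P) arr (fun p => cell N (key (p % N)) (p % N / 2 ^ k) (2 ^ k))
      (fun p => blockSum N key w k (key (p % N)) (p % N / 2 ^ k)) M M') :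
    CellsAt N key w k (M' arr) := by
  have hb : ∀ p : Fin P, (p : ℕ) % N / 2 ^ k < 2 * N + 2 := fun p => by
    have h1 := Nat.mod_lt p hN
    have h2 := Nat.div_le_self (p % N : ℕ) (2 ^ k)
    omega
  constructor
  · intro blk hblk κ
    by_cases hc : ∃ a < N, a / 2 ^ k = blk ∧ key a = κ
    · obtain ⟨a, ha, rfl, rfl⟩ := hc
      have := h.eq ⟨a, by omega⟩ fun p hp => by
        obtain ⟨h1, h2, -⟩ := cell_inj (hb p) hk (hb _) hk hp
        rw [h1, h2]
      simpa [Nat.mod_eq_of_lt ha] using this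
    · rw [h.eq_of_ne, hz k le_rfl hk _ hblk, blockSum_of_forall_ne]
      · intro b hb h1 h2
        exact hc ⟨b, hb, h1, h2⟩
      · intro p hp
        obtain ⟨h1, h2, -⟩ := cell_inj hblk hk (hb _) hk hp
        exact hc ⟨_, Nat.mod_lt p hN, h2.symm, h1.symm⟩
  · intro j hj hj' blk hblk κ
    rw [h.eq_of_ne, hz j hj.le hj' _ hblk]
    intro p hp
    obtain ⟨-, -, h3⟩ := cell_inj hblk hj' (hb _) hk hp
    exact absurd (Nat.pow_right_injective le_rfl h3) (by omega)

theorem prefixSums_ens {W arr : ℕ} {M : Memory} {ρ : Fin P → ℕ → ℕ}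
    (h3 : ∀ p, ρ p 3 = N) (h5 : ∀ p, ρ p 5 = p % N) (hkey : ∀ p, ρ p 32 = key (p % N))
    (hw : ∀ p, ρ p 34 = w (p % N)) (hM : ∀ i, M arr i = 0) (hN : 0 < N) (hNP : N ≤ P)
    (hW : ∑ b ∈ range N, w b < W) (hNW : 2 * N < W) :
    Ens W (prefixSums arr) (7 * Nat.clog 2 N + 4) M ρ fun M' ρ' =>
      (∀ p, ρ' p 33 = ∑ b ∈ range (p % N) with key b = key (p % N), w b) ∧
      (∀ p, ρ' p 34 = ∑ b ∈ range N with key b = key (p % N), w b) ∧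
      (∀ p r, r ≠ 14 → r ≠ 18 → r ≠ 33 → r ≠ 34 → ρ' p r = ρ p r) ∧
      ∀ a, a ≠ arr → M' a = M a := by
  have hmod : ∀ p : Fin P, (p : ℕ) % N < N := fun p => Nat.mod_lt _ hN
  have hw' : ∀ a < N, w a < W := fun a ha =>
    (single_le_sum (f := w) (fun _ _ => Nat.zero_le _) (mem_range.2 ha)).trans_lt hW
  rw [show 7 * Nat.clog 2 N + 4 = (Nat.clog 2 N * (5 + 2) + 1) + 1 + 1 + 1 by ring]
  refine Ens.set_seq (fun p => by simp; omega) ?_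
  refine Ens.set_seq (fun p => by simp; omega) ?_
  refine Ens.store_seq (fun p => by simpa [hw] using hw' _ (hmod p)) fun M₁ hM₁ => ?_
  refine Ens.while (Nat.clog 2 N) (fun k M' ρ' =>
    CellsAt N key w k (M' arr) ∧
    (∀ p, ρ' p 14 = 2 ^ k) ∧
    (∀ p, ρ' p 33 = blockRank key w k (p % N)) ∧
    (∀ p, ρ' p 34 = blockSum N key w k (key (p % N)) (p % N / 2 ^ k)) ∧
    (∀ p r, r ≠ 14 → r ≠ 18 → r ≠ 33 → r ≠ 34 → ρ' p r = ρ p r) ∧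
    ∀ a, a ≠ arr → M' a = M a) ?_ ?_ ?_
  · refine ⟨?_, ?_, ?_, ?_, ?_, fun a ha => hM₁.1 a ha⟩
    · refine CellsAt.of_written hNP hN (by omega) (fun _ _ _ _ _ _ => hM _) ?_
      convert hM₁ using 2 with p p
      · simp [cellExpr, cell, h3, h5, hkey]
      · simp [hw, blockSum_zero _ (hmod p) rfl]
    · simp
    · simp [blockRank_zero]
    · intro p
      simp [hw, blockSum_zero _ (hmod p) rfl]
    · intro p r h1 h2 h3 h4
      simp [h1, h3]
  · rintro k hk M' ρ' ⟨hc, h14, h33, h34, hr, ha⟩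
    have hkN : 2 ^ k < N := (Nat.lt_clog_iff_pow_lt (by norm_num)).1 hk
    have hk2 : 2 ^ (k + 1) = 2 * 2 ^ k := by ring
    refine ⟨fun p => by simp [h14, hr, h3, hkN], ?_⟩
    have hld : ∀ p : Fin P, M' arr ((cellExpr (.reg 5 / .reg 14 + 1 -
        2 * (.reg 5 / .reg 14 % 2))).eval (ρ' p)) = blockSum N key w k (key (p % N))
          (p % N / 2 ^ k + 1 - 2 * (p % N / 2 ^ k % 2)) := fun p => by
      have h1 := hmod p
      have h2 := Nat.div_le_self (p % N : ℕ) (2 ^ k)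
      rw [← hc.1 _ (by omega)]
      simp [cellExpr, cell, h14, hr, h3, h5, hkey]
    have hrk : ∀ p : Fin P, _ := fun p => blockRank_succ (w := w) (key := key) k _ (hmod p)
    have hsm : ∀ p : Fin P, _ := fun p =>
      blockSum_succ (w := w) (key := key) (N := N) k (key (p % N)) (p % N / 2 ^ k)
    simp only [Nat.div_div_eq_div_mul, ← pow_succ] at hsm
    refine Ens.load_seq ?_
    simp only [hld]
    refine Ens.set_seq (fun p => ?_) ?_
    · simp [h14, hr, h5, h33]
      rw [← hrk]
      exact (blockRank_le _ _ (hmod p)).trans_lt hW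
    refine Ens.set_seq (fun p => ?_) ?_
    · simp [h34]
      rw [← hsm]
      exact (blockSum_le _ _ _).trans_lt hW
    refine Ens.set_seq (fun p => ?_) ?_
    · simp [h14]
      omega
    refine Ens.store (fun p => ?_) fun M₂ hM₂ => ?_
    · simp [h34]
      rw [← hsm]
      exact (blockSum_le _ _ _).trans_lt hW
    refine ⟨?_, ?_, ?_, ?_, ?_, fun a h => (hM₂.1 a h).trans (ha a h)⟩
    · refine CellsAt.of_written hNP hN (by omega) (fun j hj => hc.2 j (by omega)) ?_
      convert hM₂ using 2 with p p
      · simp [cellExpr, cell, h3, h5, hkey, hr, h14, hk2]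
      · simp [h34, hsm]
    · simp [h14, hk2]
    · intro p
      simp [h33, hrk, hr, h5, h14]
    · intro p
      simp [h34, hsm]
    · intro p r h1 h2 h3 h4
      simp [h1, h2, h3, h4, hr]
  · rintro M' ρ' ⟨-, h14, h33, h34, hr, ha⟩
    have hkN : N ≤ 2 ^ Nat.clog 2 N := Nat.le_pow_clog (by norm_num) N
    refine ⟨fun p => by simp [h14, hr, h3, hkN], ?_, ?_, hr, ha⟩
    · intro p
      rw [h33, blockRank]
      congr 1
      ext b
      have h1 := hmod p
      simp only [mem_filter, mem_range]
      refine and_congr_right fun h2 => ?_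
      rw [Nat.div_eq_of_lt (by omega), Nat.div_eq_of_lt (by omega)]
      simp
    · intro p
      rw [h34, blockSum]
      congr 1
      ext b
      have h1 := hmod p
      simp only [mem_filter, mem_range]
      refine and_congr_right fun h2 => ?_
      rw [Nat.div_eq_of_lt (by omega), Nat.div_eq_of_lt (by omega)]
      simp

end

end PRAM

/-! ### Two-coloring the union of two perfect matchings -/

namespace PRAM

open Finset

/-- The smallest of `y, f y, …, f^[2 ^ k - 1] y`, computed by pointer doubling. -/
def minLabel (f : ℕ → ℕ) : ℕ → ℕ → ℕ
  | 0, y => y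
  | k + 1, y => min (minLabel f k y) (minLabel f k (f^[2 ^ k] y))

section minLabel

variable {f : ℕ → ℕ} {n k : ℕ}

theorem minLabel_le {j : ℕ} (y : ℕ) (hj : j < 2 ^ k) : minLabel f k y ≤ f^[j] y := by
  induction k generalizing j y with
  | zero =>
    obtain rfl : j = 0 := by simpa using hj
    exact le_rfl
  | succ k ih =>
    rcases lt_or_ge j (2 ^ k) with h | h
    · exact (min_le_left _ _).trans (ih y h)
    · obtain ⟨i, rfl⟩ := Nat.exists_eq_add_of_le h
      rw [Nat.add_comm (2 ^ k) i, Function.iterate_add_apply]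
      exact (min_le_right _ _).trans (ih _ (by rw [pow_succ] at hj; omega))

theorem exists_minLabel_eq (f : ℕ → ℕ) (k y : ℕ) : ∃ j, minLabel f k y = f^[j] y := by
  induction k generalizing y with
  | zero => exact ⟨0, rfl⟩
  | succ k ih =>
    rcases min_choice (minLabel f k y) (minLabel f k (f^[2 ^ k] y)) with h | h
    · obtain ⟨j, hj⟩ := ih y
      exact ⟨j, by rw [minLabel, h, hj]⟩
    · obtain ⟨j, hj⟩ := ih (f^[2 ^ k] y)
      exact ⟨j + 2 ^ k, by rw [minLabel, h, hj, Function.iterate_add_apply]⟩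

theorem iterate_lt (hf : ∀ y < n, f y < n) (j : ℕ) {y : ℕ} (hy : y < n) : f^[j] y < n := by
  induction j with
  | zero => exact hy
  | succ j ih => rw [Function.iterate_succ_apply']; exact hf _ ih

theorem exists_period (hf : ∀ y < n, f y < n) (hi : ∀ y < n, ∀ z < n, f y = f z → y = z)
    {y : ℕ} (hy : y < n) : ∃ d, 0 < d ∧ d ≤ n ∧ f^[d] y = y := by
  obtain ⟨i, hi', j, hj', hij, h⟩ := exists_ne_map_eq_of_card_lt_of_maps_to (s := range (n + 1))
    (t := range n) (by simp) (f := fun j => f^[j] y)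
    (fun j _ => by simpa using iterate_lt hf j hy)
  have key : ∀ i d, i + d ≤ n → 0 < d → f^[i] y = f^[i + d] y →
      ∃ d, 0 < d ∧ d ≤ n ∧ f^[d] y = y := by
    intro i d hle hd h
    refine ⟨d, hd, by omega, ?_⟩
    clear hle
    induction i with
    | zero => simpa using h.symm
    | succ i ih =>
      rw [show i + 1 + d = (i + d) + 1 by ring, Function.iterate_succ_apply',
        Function.iterate_succ_apply'] at h
      exact ih (hi _ (iterate_lt hf _ hy) _ (iterate_lt hf _ hy) h)
  simp only [mem_range] at hi' hj'
  rcases lt_or_gt_of_ne hij with h' | h'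
  · exact key i (j - i) (by omega) (by omega) (by rw [h]; congr 1; omega)
  · exact key j (i - j) (by omega) (by omega) (by rw [← h]; congr 1; omega)

theorem minLabel_le_iterate (hf : ∀ y < n, f y < n)
    (hi : ∀ y < n, ∀ z < n, f y = f z → y = z) (hk : n ≤ 2 ^ k) {y : ℕ} (hy : y < n) (j : ℕ) :
    minLabel f k y ≤ f^[j] y := by
  obtain ⟨d, hd, hdn, hp⟩ := exists_period hf hi hy
  have : Function.IsPeriodicPt f d y := hp
  rw [← this.iterate_mod_apply j]
  exact minLabel_le y ((Nat.mod_lt _ hd).trans_le (hdn.trans hk))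

theorem minLabel_apply (hf : ∀ y < n, f y < n)
    (hi : ∀ y < n, ∀ z < n, f y = f z → y = z) (hk : n ≤ 2 ^ k) {y : ℕ} (hy : y < n) :
    minLabel f k (f y) = minLabel f k y := by
  obtain ⟨d, hd, hdn, hp⟩ := exists_period hf hi hy
  apply le_antisymm
  · obtain ⟨j, hj⟩ := exists_minLabel_eq f k y
    have : f^[j] y = f^[j + (d - 1)] (f y) := by
      rw [← Function.iterate_succ_apply, show (j + (d - 1)).succ = j + d by omega,
        Function.iterate_add_apply, hp]
    rw [hj, this]
    exact minLabel_le_iterate hf hi hk (hf y hy) _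
  · obtain ⟨j, hj⟩ := exists_minLabel_eq f k (f y)
    rw [hj, ← Function.iterate_succ_apply]
    exact minLabel_le_iterate hf hi hk hy _

end minLabel

/-- `t` is an involution without fixed points on `{0, …, n - 1}`, that is, a perfect matching. -/
structure IsMatching (n : ℕ) (t : ℕ → ℕ) : Prop where
  lt : ∀ y < n, t y < n
  invol : ∀ y < n, t (t y) = y
  ne : ∀ y < n, t y ≠ y

section Matchings

variable {n k : ℕ} {t m : ℕ → ℕ} (ht : IsMatching n t) (hm : IsMatching n m)

include ht hm

/-- An alternating walk that starts with the edge of `t` at `y` never arrives at `t y` by an edge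
of `m`: folding the walk in the middle would produce a fixed point of `t` or of `m`. -/
theorem iterate_ne (l : ℕ) : ∀ y < n, (m ∘ t)^[l] y ≠ t y := by
  induction l using Nat.strong_induction_on with
  | _ l ih =>
    match l with
    | 0 => exact fun y hy h => ht.ne y hy h.symm
    | 1 => exact fun y hy h => hm.ne _ (ht.lt y hy) h
    | l + 2 =>
      intro y hy h
      rw [Function.iterate_succ_apply', Function.iterate_succ_apply] at h
      have hfy : (m ∘ t) y < n := hm.lt _ (ht.lt y hy)
      refine ih l (by omega) ((m ∘ t) y) hfy ?_
      have hz := iterate_lt (f := m ∘ t) (fun y hy => hm.lt _ (ht.lt y hy)) l hfy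
      generalize (m ∘ t)^[l] ((m ∘ t) y) = z at h hz
      have h1 : t z = m (t y) := by
        rw [← h]; simp [hm.invol _ (ht.lt z hz)]
      rw [← ht.invol z hz, h1]
      rfl

/-- The components of the union of two perfect matchings `t` and `m` are even cycles, and the
orbits of `m ∘ t` are the two color classes on each of them. Hence comparing the smallest elements
of the orbits of `y` and `t y` gives a proper two-coloring. -/
theorem minLabel_matching (hk : n ≤ 2 ^ k) {y : ℕ} (hy : y < n) :
    minLabel (m ∘ t) k (t y) ≠ minLabel (m ∘ t) k y ∧
      minLabel (m ∘ t) k (m y) = minLabel (m ∘ t) k (t y) ∧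
      minLabel (m ∘ t) k (t (m y)) = minLabel (m ∘ t) k y := by
  have hf : ∀ y < n, (m ∘ t) y < n := fun y hy => hm.lt _ (ht.lt y hy)
  have hi : ∀ y < n, ∀ z < n, (m ∘ t) y = (m ∘ t) z → y = z := by
    intro y hy z hz h
    have := congrArg m h
    simp only [Function.comp, hm.invol _ (ht.lt y hy), hm.invol _ (ht.lt z hz)] at this
    rw [← ht.invol y hy, this, ht.invol z hz]
  refine ⟨fun h => ?_, ?_, ?_⟩
  · obtain ⟨i, hi'⟩ := exists_minLabel_eq (m ∘ t) k y
    obtain ⟨j, hj⟩ := exists_minLabel_eq (m ∘ t) k (t y)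
    obtain ⟨d, hd, -, hp⟩ := exists_period hf hi (ht.lt y hy)
    refine iterate_ne ht hm (j * d - j + i) y hy ?_
    rw [Function.iterate_add_apply, ← hi', ← h, hj, ← Function.iterate_add_apply,
      Nat.sub_add_cancel (Nat.le_mul_of_pos_right j hd)]
    have : Function.IsPeriodicPt (m ∘ t) (j * d) (t y) := Function.IsPeriodicPt.const_mul hp j
    exact this
  · have := minLabel_apply hf hi hk (ht.lt y hy)
    rwa [Function.comp_apply, ht.invol y hy] at this
  · have := minLabel_apply hf hi hk (ht.lt _ (hm.lt y hy))
    rw [Function.comp_apply, ht.invol _ (hm.lt y hy), hm.invol y hy] at this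
    exact this.symm

end Matchings

section Processors

variable {P W N : ℕ}

/-- Processor `p` acts for element number `p % n`: what the memory holds after a write. -/
theorem Written.mod {n arr : ℕ} {idx val : ℕ → ℕ} {M M' : Memory}
    (h : Written (P := P) arr (fun p => idx (p % n)) (fun p => val (p % n)) M M')
    (hn : 0 < n) (hP : n ≤ P)
    (hv : ∀ a < n, ∀ b < n, idx a = idx b → val a = val b) :
    (∀ a < n, M' arr (idx a) = val a) ∧
    ∀ i, (∀ a < n, i ≠ idx a) → M' arr i = M arr i := by
  constructor
  · intro a ha
    have := h.eq ⟨a, by omega⟩ fun p hp => by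
      simp only [Nat.mod_eq_of_lt ha] at hp ⊢
      exact hv _ (Nat.mod_lt _ hn) _ ha hp
    simpa [Nat.mod_eq_of_lt ha] using this
  · intro i hi
    exact h.eq_of_ne fun p => hi _ (Nat.mod_lt _ hn)

/-- Pointer doubling: element `y` keeps its pointer in register `16` and in array `9`, and its
label in register `17` and in array `8`. -/
def labelLoop : Stmt :=
  .set 14 1 ;;
  .while (.lt (.reg 14) (2 * .reg 3)) (
    .load 18 8 (.reg 16) ;;
    .load 19 9 (.reg 16) ;;
    .set 17 (.reg 17 - (.reg 17 - .reg 18)) ;;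
    .store 8 (.reg 5 + .reg 3 * .reg 6) (.reg 17) ;;
    .set 16 (.reg 19) ;;
    .store 9 (.reg 5 + .reg 3 * .reg 6) (.reg 16) ;;
    .set 14 (2 * .reg 14))

theorem labelLoop_ens {f : ℕ → ℕ} {M : Memory} {ρ : Fin P → ℕ → ℕ}
    (h3 : ∀ p, ρ p 3 = N) (hy : ∀ p, ρ p 5 + N * ρ p 6 = p % (2 * N))
    (h16 : ∀ p, ρ p 16 = f (p % (2 * N))) (h17 : ∀ p, ρ p 17 = p % (2 * N))
    (h8 : ∀ y < 2 * N, M 8 y = y) (h9 : ∀ y < 2 * N, M 9 y = f y)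
    (hf : ∀ y < 2 * N, f y < 2 * N)
    (hN : 0 < N) (hNP : 2 * N ≤ P) (hNW : 4 * N < W) :
    Ens W labelLoop (9 * Nat.clog 2 (2 * N) + 2) M ρ fun M' ρ' =>
      (∀ y < 2 * N, M' 8 y = minLabel f (Nat.clog 2 (2 * N)) y) ∧
      (∀ p r, r ∉ [14, 16, 17, 18, 19] → ρ' p r = ρ p r) ∧
      ∀ a, a ≠ 8 → a ≠ 9 → M' a = M a := by
  have hmod : ∀ p : Fin P, (p : ℕ) % (2 * N) < 2 * N := fun p => Nat.mod_lt _ (by omega)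
  rw [show 9 * Nat.clog 2 (2 * N) + 2 = (Nat.clog 2 (2 * N) * (7 + 2) + 1) + 1 by ring]
  refine Ens.set_seq (fun p => by simp; omega) ?_
  refine Ens.while (Nat.clog 2 (2 * N)) (fun k M' ρ' =>
    (∀ p, ρ' p 14 = 2 ^ k) ∧
    (∀ p, ρ' p 16 = f^[2 ^ k] (p % (2 * N))) ∧
    (∀ p, ρ' p 17 = minLabel f k (p % (2 * N))) ∧
    (∀ y < 2 * N, M' 8 y = minLabel f k y) ∧
    (∀ y < 2 * N, M' 9 y = f^[2 ^ k] y) ∧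
    (∀ p r, r ∉ [14, 16, 17, 18, 19] → ρ' p r = ρ p r) ∧
    ∀ a, a ≠ 8 → a ≠ 9 → M' a = M a) ?_ ?_ ?_
  · refine ⟨by simp, by simp [h16], by simp [h17, minLabel], by simpa [minLabel] using h8,
      by simpa using h9, ?_, fun a _ _ => rfl⟩
    intro p r hr
    simp at hr
    simp [hr]
  · rintro k hk M' ρ' ⟨h14, h16, h17, h8, h9, hr, ha⟩
    have hkN : 2 ^ k < 2 * N := (Nat.lt_clog_iff_pow_lt (by norm_num)).1 hk
    have hlt : ∀ k' y, y < 2 * N → minLabel f k' y < W := fun k' y hy =>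
      ((minLabel_le (j := 0) y (by positivity)).trans_lt hy).trans (by omega)
    have hit : ∀ p : Fin P, f^[2 ^ k] (p % (2 * N)) < 2 * N := fun p =>
      iterate_lt hf _ (hmod p)
    have hit' : ∀ p : Fin P, f^[2 ^ k] (f^[2 ^ k] (p % (2 * N))) =
        f^[2 ^ (k + 1)] (p % (2 * N)) := fun p => by
      rw [← Function.iterate_add_apply]; congr 1; ring
    have hmin : ∀ p : Fin P, minLabel f k (p % (2 * N)) - (minLabel f k (p % (2 * N)) -
        minLabel f k (f^[2 ^ k] (p % (2 * N)))) = minLabel f (k + 1) (p % (2 * N)) := fun p => by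
      rw [minLabel]; omega
    refine ⟨fun p => by simp [h14, hr, h3, hkN], ?_⟩
    have hl8 : ∀ p : Fin P, M' 8 (f^[2 ^ k] (p % (2 * N))) = _ := fun p => h8 _ (hit p)
    have hl9 : ∀ p : Fin P, M' 9 (f^[2 ^ k] (p % (2 * N))) = _ := fun p => h9 _ (hit p)
    refine Ens.load_seq (Ens.load_seq ?_)
    simp only [Expr.eval_reg, h16, hl8, ne_eq, Nat.reduceEqDiff,
      not_false_eq_true, Function.update_of_ne, hl9, hit']
    refine Ens.set_seq (fun p => by simpa [h17, hmin] using hlt _ _ (hmod p)) ?_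
    refine Ens.store_seq (fun p => by simpa [h17, hmin] using hlt _ _ (hmod p)) fun M₁ hM₁ => ?_
    refine Ens.set_seq (fun p => by
      simpa [← hit'] using (iterate_lt hf _ (hit p)).trans (by omega)) ?_
    refine Ens.store_seq (fun p => by
      simpa [← hit'] using (iterate_lt hf _ (hit p)).trans (by omega)) fun M₂ hM₂ => ?_
    refine Ens.set (fun p => by simp [h14]; omega) ?_
    have e1 := Written.mod (n := 2 * N) (idx := fun y => y) (val := minLabel f (k + 1))
      (by convert hM₁ using 2 with p p <;> simp [hr, h3, hy, h17, hmin]) (by omega) hNP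
      (by simp +contextual)
    have e2 := Written.mod (n := 2 * N) (idx := fun y => y) (val := f^[2 ^ (k + 1)])
      (by convert hM₂ using 2 with p p <;> simp [hr, h3, hy]) (by omega) hNP
      (by simp +contextual)
    refine ⟨by simp [h14, pow_succ, mul_comm], by simp, by simp [h17, hmin], ?_, e2.1, ?_, ?_⟩
    · intro y hy
      rw [hM₂.1 8 (by norm_num)]
      exact e1.1 y hy
    · intro p r h
      rw [← hr p r h]
      simp at h
      simp [h]
    · intro a h1 h2
      rw [hM₂.1 a h2, hM₁.1 a h1, ha a h1 h2]
  · rintro M' ρ' ⟨h14, h16, h17, h8, h9, hr, ha⟩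
    have hkN : 2 * N ≤ 2 ^ Nat.clog 2 (2 * N) := Nat.le_pow_clog (by norm_num) _
    exact ⟨fun p => by simp [h14, hr, h3, hkN], h8, hr, ha⟩

end Processors

end PRAM

/-! ### Repeated halving of the classes of arcs -/

namespace PRAM

open Finset

/-- The arcs with the same tail `tl` and the same label `lf < 2 ^ k` form a class, and `rk` numbers
the arcs of every class consecutively from `0` on. -/
structure Ranked (N : ℕ) (tl : ℕ → ℕ) (k : ℕ) (rk lf : ℕ → ℕ) : Prop where
  rk_lt : ∀ a < N, rk a < N
  lf_lt : ∀ a < N, lf a < 2 ^ k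
  inj : ∀ a < N, ∀ b < N, tl a = tl b → lf a = lf b → rk a = rk b → a = b
  closed : ∀ a < N, ∀ r < rk a, ∃ b < N, tl b = tl a ∧ lf b = lf a ∧ rk b = r

/-- The arcs at every vertex are halved, up to a discrepancy of `2`, when the part number `s` is
split into the parts `2 * s` and `2 * s + 1`; this happens `j` times, and `leaf` tells for every
arc the part that it finally belongs to. -/
def Halves (N : ℕ) (tl : ℕ → ℕ) (j : ℕ) (leaf : ℕ → ℕ) : Prop :=
  ∀ i < j, ∀ v s,
    #{a ∈ range N | tl a = v ∧ leaf a / 2 ^ i = 2 * s} ≤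
      #{a ∈ range N | tl a = v ∧ leaf a / 2 ^ i = 2 * s + 1} + 2 ∧
    #{a ∈ range N | tl a = v ∧ leaf a / 2 ^ i = 2 * s + 1} ≤
      #{a ∈ range N | tl a = v ∧ leaf a / 2 ^ i = 2 * s} + 2

/-- The state after `k` halvings of the classes. The first one orients the edges: `sd` tells
whether the tail of an arc is the tail or the head of its edge. The others split the edges, so that
the remaining bits of `lf` are the same for an arc and its twin. -/
structure LevelInv (N : ℕ) (tl tw : ℕ → ℕ) (k : ℕ) (rk lf sd : ℕ → ℕ) : Prop where
  ranked : Ranked N tl k rk lf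
  sd_zero : k = 0 → ∀ a < N, sd a = 0
  sides : ∀ j, k = j + 1 → ∀ a < N, sd a = lf a / 2 ^ j ∧ sd (tw a) ≠ sd a ∧ sd a < 2 ∧
    lf (tw a) % 2 ^ j = lf a % 2 ^ j
  halves : ∀ j, k = j + 1 → Halves N tl j fun a => lf a % 2 ^ j

theorem eq_range_of_closed {I : Finset ℕ} (h : ∀ x ∈ I, ∀ y < x, y ∈ I) : I = range #I := by
  refine eq_of_subset_of_card_le (fun x hx => ?_) (by simp)
  have : range (x + 1) ⊆ I := fun y hy => by
    rcases Nat.lt_succ_iff_lt_or_eq.1 (mem_range.1 hy) with h' | rfl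
    · exact h x hx y h'
    · exact hx
  simpa using card_le_card this

theorem Ranked.image_rk {N k : ℕ} {tl rk lf : ℕ → ℕ} (h : Ranked N tl k rk lf) (v f : ℕ) :
    {a ∈ range N | tl a = v ∧ lf a = f}.image rk =
      range #{a ∈ range N | tl a = v ∧ lf a = f} := by
  rw [eq_range_of_closed (I := image _ _), card_image_of_injOn]
  · intro a ha b hb hab
    simp only [coe_filter, mem_range, Set.mem_ofPred_eq] at ha hb
    exact h.inj a ha.1 b hb.1 (by rw [ha.2.1, hb.2.1]) (by rw [ha.2.2, hb.2.2]) hab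
  · intro x hx y hy
    simp only [mem_image, mem_filter, mem_range] at hx ⊢
    obtain ⟨a, ⟨h1, h2, h3⟩, rfl⟩ := hx
    obtain ⟨b, h4, h5, h6, h7⟩ := h.closed a h1 y hy
    exact ⟨b, ⟨h4, by rw [h5, h2], by rw [h6, h3]⟩, h7⟩

section

variable {N k : ℕ} {tl tw rk lf sd c : ℕ → ℕ}

theorem Ranked.halve (h : Ranked N tl k rk lf) {bit : ℕ → ℕ} (h2 : ∀ a < N, bit a < 2)
    (hp : ∀ a < N, ∀ b < N, tl a = tl b → lf a = lf b → rk a / 2 = rk b / 2 → a ≠ b →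
      bit a ≠ bit b) :
    Ranked N tl (k + 1) (fun a => rk a / 2) (fun a => 2 * lf a + bit a) where
  rk_lt a ha := (Nat.div_le_self _ _).trans_lt (h.rk_lt a ha)
  lf_lt a ha := by
    have := h.lf_lt a ha
    have := h2 a ha
    rw [pow_succ]
    omega
  inj a ha b hb h1 h3 h4 := by
    have := h2 a ha
    have := h2 b hb
    by_contra hab
    exact hp a ha b hb h1 (by omega) h4 hab (by omega)
  closed a ha r hr := by
    obtain ⟨b, hb, hb1, hb2, hb3⟩ := h.closed a ha (2 * r) (by omega)
    obtain ⟨d, hd, hd1, hd2, hd3⟩ := h.closed a ha (2 * r + 1) (by omega)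
    have hne := hp b hb d hd (by rw [hb1, hd1]) (by rw [hb2, hd2]) (by omega) (by
      rintro rfl; omega)
    have := h2 a ha
    have := h2 b hb
    have := h2 d hd
    by_cases hba : bit b = bit a
    · exact ⟨b, hb, hb1, by rw [hb2, hba], by omega⟩
    · exact ⟨d, hd, hd1, by rw [hd2, show bit d = bit a by omega], by omega⟩

/-- The two halves of a class differ by at most one arc. -/
theorem Ranked.card_halves (h : Ranked N tl k rk lf) {bit : ℕ → ℕ} (h2 : ∀ a < N, bit a < 2)
    (h' : Ranked N tl (k + 1) (fun a => rk a / 2) (fun a => 2 * lf a + bit a)) (v f d d' : ℕ)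
    (hdd : d + d' = 1) :
    #{a ∈ range N | tl a = v ∧ 2 * lf a + bit a = 2 * f + d} ≤
      #{a ∈ range N | tl a = v ∧ 2 * lf a + bit a = 2 * f + d'} + 1 := by
  have hS : #{a ∈ range N | tl a = v ∧ lf a = f} =
      #{a ∈ range N | tl a = v ∧ 2 * lf a + bit a = 2 * f + d} +
        #{a ∈ range N | tl a = v ∧ 2 * lf a + bit a = 2 * f + d'} := by
    rw [← card_union_of_disjoint]
    · congr 1
      ext a
      simp only [mem_filter, mem_range, mem_union]
      constructor
      · rintro ⟨h3, h4, h5⟩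
        have := h2 a h3
        by_cases h6 : bit a = d
        · exact .inl ⟨h3, h4, by omega⟩
        · exact .inr ⟨h3, h4, by omega⟩
      · rintro (⟨h3, h4, h5⟩ | ⟨h3, h4, h5⟩) <;>
        · have := h2 a h3
          exact ⟨h3, h4, by omega⟩
    · rw [disjoint_filter]
      rintro a - ⟨-, h3⟩ ⟨-, h4⟩
      omega
  by_contra! hlt
  have h1 := h'.image_rk v (2 * f + d)
  have h3 : #{a ∈ range N | tl a = v ∧ 2 * lf a + bit a = 2 * f + d} - 1 ∈
      range #{a ∈ range N | tl a = v ∧ 2 * lf a + bit a = 2 * f + d} := by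
    rw [mem_range]; omega
  rw [← h1, mem_image] at h3
  obtain ⟨a, ha, ha2⟩ := h3
  simp only [mem_filter, mem_range] at ha
  have h4 : rk a ∈ {a ∈ range N | tl a = v ∧ lf a = f}.image rk :=
    mem_image_of_mem _ (by
      have := h2 a ha.1
      simp only [mem_filter, mem_range]
      exact ⟨ha.1, ha.2.1, by omega⟩)
  rw [h.image_rk, mem_range] at h4
  omega

theorem mod_two_pow_succ (x b j : ℕ) (hb : b < 2) :
    (2 * x + b) % 2 ^ (j + 1) = 2 * (x % 2 ^ j) + b := by
  have hp : 0 < 2 ^ j := by positivity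
  have h1 := Nat.mod_lt x hp
  have h2 := Nat.div_add_mod x (2 ^ j)
  rw [show 2 * x + b = (2 * (x % 2 ^ j) + b) + 2 ^ (j + 1) * (x / 2 ^ j) by
    rw [pow_succ]; nlinarith, Nat.add_mul_mod_self_left, Nat.mod_eq_of_lt]
  rw [pow_succ]
  omega

/-- Splitting by the bits of a coloring `c` that separates twins and partners leads from one state
to the next one. In the first round the bit is `c`, so that twins get different bits, which is an
orientation. In the later ones it is `c + sd`, so that twins stay together. Then the outgoing and
the incoming edges of a vertex are each halved up to one, which is two per vertex. -/
theorem LevelInv.step (hI : LevelInv N tl tw k rk lf sd) (htw : ∀ a < N, tw a < N)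
    (hc2 : ∀ a, c a < 2) (hct : ∀ a < N, c (tw a) ≠ c a)
    (hcp : ∀ a < N, ∀ b < N, tl a = tl b → lf a = lf b → rk a / 2 = rk b / 2 → a ≠ b →
      c a ≠ c b) :
    LevelInv N tl tw (k + 1) (fun a => rk a / 2) (fun a => 2 * lf a + (c a + sd a) % 2)
      (fun a => sd a + (if 2 ^ k = 1 then 1 else 0) * ((c a + sd a) % 2)) := by
  have hb2 : ∀ a < N, (c a + sd a) % 2 < 2 := fun a _ => Nat.mod_lt _ (by norm_num)
  have hsd2 : ∀ a < N, sd a < 2 := by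
    intro a ha
    rcases k with _ | j
    · rw [hI.sd_zero rfl a ha]; norm_num
    · exact (hI.sides j rfl a ha).2.2.1
  have hcls : ∀ a < N, ∀ b < N, lf a = lf b → sd a = sd b := by
    intro a ha b hb h
    rcases k with _ | j
    · rw [hI.sd_zero rfl a ha, hI.sd_zero rfl b hb]
    · rw [(hI.sides j rfl a ha).1, (hI.sides j rfl b hb).1, h]
  have hR : Ranked N tl (k + 1) (fun a => rk a / 2) (fun a => 2 * lf a + (c a + sd a) % 2) := by
    refine hI.ranked.halve hb2 fun a ha b hb h1 h2 h3 hab => ?_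
    have h4 := hcp a ha b hb h1 h2 h3 hab
    have := hcls a ha b hb h2
    have := hc2 a
    have := hc2 b
    omega
  refine ⟨hR, by simp, ?_, ?_⟩
  · intro j hj a ha
    obtain rfl : k = j := by omega
    have h1 := hc2 a
    have h2 := hc2 (tw a)
    have h3 := hct a ha
    rcases k with _ | j
    · have h4 := hI.sd_zero rfl a ha
      have h5 := hI.sd_zero rfl _ (htw a ha)
      have h6 := hI.ranked.lf_lt a ha
      have h7 := hI.ranked.lf_lt _ (htw a ha)
      simp [h4, h5, Nat.mod_one]
      simp at h6
      omega
    · obtain ⟨h4, h5, h6, h7⟩ := hI.sides j rfl a ha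
      have h8 := hsd2 _ (htw a ha)
      have h9 : (2 : ℕ) ^ (j + 1) ≠ 1 := by
        rw [pow_succ]; omega
      simp only [h9, if_false, zero_mul, add_zero]
      refine ⟨?_, h5, h6, ?_⟩
      · rw [h4, pow_succ', ← Nat.div_div_eq_div_mul]
        congr 1
        omega
      · rw [mod_two_pow_succ _ _ _ (hb2 a ha), mod_two_pow_succ _ _ _ (hb2 _ (htw a ha)), h7]
        omega
  · intro j hj
    obtain rfl : k = j := by omega
    rcases k with _ | j
    · intro i hi; omega
    intro i hi v s
    rcases i with _ | i
    · simp only [pow_zero, Nat.div_one]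
      -- the two classes at a vertex: the arcs at the tails and at the heads of their edges
      have key : ∀ d, d < 2 →
          #{a ∈ range N | tl a = v ∧ (2 * lf a + (c a + sd a) % 2) % 2 ^ (j + 1) = 2 * s + d} =
          if s < 2 ^ j then
            #{a ∈ range N | tl a = v ∧ 2 * lf a + (c a + sd a) % 2 = 2 * s + d} +
            #{a ∈ range N | tl a = v ∧ 2 * lf a + (c a + sd a) % 2 = 2 * (2 ^ j + s) + d}
          else 0 := by
        intro d hd
        split_ifs with hs
        · rw [← card_union_of_disjoint]
          · congr 1
            ext a
            simp only [mem_filter, mem_range, mem_union, ← and_or_left]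
            refine and_congr_right fun ha => and_congr_right fun _ => ?_
            rw [mod_two_pow_succ _ _ _ (hb2 a ha)]
            have h1 := hI.ranked.lf_lt a ha
            have h2 := hb2 a ha
            rw [pow_succ] at h1
            rcases lt_or_ge (lf a) (2 ^ j) with h3 | h3
            · rw [Nat.mod_eq_of_lt h3]; omega
            · rw [Nat.mod_eq_sub_mod h3, Nat.mod_eq_of_lt (by omega)]; omega
          · rw [disjoint_filter]
            rintro a - ⟨-, h3⟩ ⟨-, h4⟩
            have : 0 < 2 ^ j := by positivity
            omega
        · rw [card_eq_zero, filter_eq_empty_iff]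
          rintro a ha ⟨-, h⟩
          rw [mod_two_pow_succ _ _ _ (hb2 a (mem_range.1 ha))] at h
          have := Nat.mod_lt (lf a) (show 0 < 2 ^ j by positivity)
          have := hb2 a (mem_range.1 ha)
          omega
      have k0 := key 0 (by norm_num)
      simp only [add_zero] at k0
      rw [k0, key 1 (by norm_num)]
      have e1 := hI.ranked.card_halves hb2 hR v s 0 1 rfl
      have e2 := hI.ranked.card_halves hb2 hR v s 1 0 rfl
      have e3 := hI.ranked.card_halves hb2 hR v (2 ^ j + s) 0 1 rfl
      have e4 := hI.ranked.card_halves hb2 hR v (2 ^ j + s) 1 0 rfl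
      simp only [add_zero] at e1 e2 e3 e4
      split_ifs <;> omega
    · have h := hI.halves j rfl i (by omega) v s
      have e : ∀ a ∈ range N, (2 * lf a + (c a + sd a) % 2) % 2 ^ (j + 1) / 2 ^ (i + 1) =
          lf a % 2 ^ j / 2 ^ i := by
        intro a ha
        rw [mod_two_pow_succ _ _ _ (hb2 a (mem_range.1 ha)), pow_succ', ← Nat.div_div_eq_div_mul]
        congr 1
        have := hb2 a (mem_range.1 ha)
        omega
      have e' : ∀ x, {a ∈ range N | tl a = v ∧
          (2 * lf a + (c a + sd a) % 2) % 2 ^ (j + 1) / 2 ^ (i + 1) = x} =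
          {a ∈ range N | tl a = v ∧ lf a % 2 ^ j / 2 ^ i = x} := fun x =>
        filter_congr fun a ha => by rw [e a ha]
      simp only [e']
      exact h

end

end PRAM

/-! ### The program that halves all classes -/

namespace PRAM

open Finset

/-- `N` arcs at `n` vertices, with tails and twins; the arcs are sorted by their tails, and no
vertex is isolated. -/
structure IsArcs (N n : ℕ) (tl tw : ℕ → ℕ) : Prop where
  tl_lt : ∀ a < N, tl a < n
  twin : IsMatching N tw
  mono : ∀ a b, a ≤ b → b < N → tl a ≤ tl b
  surj : ∀ v < n, ∃ a < N, tl a = v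

/-- What every processor knows permanently: its index, the number of processors, `n`, `N` and `h`,
and the number of the arc for which it acts, with its tail and twin. There are two processors for
every arc, which differ in register `6`. -/
structure Knows {P : ℕ} (N n h : ℕ) (tl tw : ℕ → ℕ) (ρ : Fin P → ℕ → ℕ) : Prop where
  r0 : ∀ p, ρ p 0 = p
  r1 : ∀ p, ρ p 1 = P
  r2 : ∀ p, ρ p 2 = n
  r3 : ∀ p, ρ p 3 = N
  r4 : ∀ p, ρ p 4 = h
  r5 : ∀ p, ρ p 5 = p % N
  r6 : ∀ p, ρ p 6 = p / N % 2
  r7 : ∀ p, ρ p 7 = tl (p % N)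
  r8 : ∀ p, ρ p 8 = tw (p % N)

theorem Knows.congr {P N n h : ℕ} {tl tw : ℕ → ℕ} {ρ ρ' : Fin P → ℕ → ℕ}
    (hK : Knows N n h tl tw ρ) (hr : ∀ p r, r ≤ 8 → ρ' p r = ρ p r) : Knows N n h tl tw ρ' where
  r0 p := (hr p 0 (by norm_num)).trans (hK.r0 p)
  r1 p := (hr p 1 (by norm_num)).trans (hK.r1 p)
  r2 p := (hr p 2 (by norm_num)).trans (hK.r2 p)
  r3 p := (hr p 3 (by norm_num)).trans (hK.r3 p)
  r4 p := (hr p 4 (by norm_num)).trans (hK.r4 p)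
  r5 p := (hr p 5 (by norm_num)).trans (hK.r5 p)
  r6 p := (hr p 6 (by norm_num)).trans (hK.r6 p)
  r7 p := (hr p 7 (by norm_num)).trans (hK.r7 p)
  r8 p := (hr p 8 (by norm_num)).trans (hK.r8 p)

theorem mod_two_mul_eq (p N : ℕ) : p % N + N * (p / N % 2) = p % (2 * N) := by
  rw [mul_comm 2 N, Nat.mod_mul]

theorem mod_two_mul_mod (p N : ℕ) : p % (2 * N) % N = p % N :=
  Nat.mod_mul_left_mod p 2 N

theorem mod_two_mul_div (p N : ℕ) : p % (2 * N) / N = p / N % 2 := by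
  rw [mul_comm 2 N, Nat.mod_mul_right_div_self]

/-- Element `y = a + N * i` of `{0, …, 2 * N - 1}` is copy `i` of the arc `a`. -/
theorem copy_eq {N a i : ℕ} (ha : a < N) : (a + N * i) % N = a ∧ (a + N * i) / N = i := by
  constructor
  · rw [Nat.add_mul_mod_self_left, Nat.mod_eq_of_lt ha]
  · rw [Nat.add_mul_div_left _ _ (by omega), Nat.div_eq_of_lt ha, zero_add]

theorem copy_lt {N a i : ℕ} (ha : a < N) (hi : i < 2) : a + N * i < 2 * N := by
  interval_cases i <;> omega

theorem exists_copy {N y : ℕ} (hy : y < 2 * N) : ∃ a i, a < N ∧ i < 2 ∧ y = a + N * i :=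
  ⟨y % N, y / N, Nat.mod_lt _ (by omega), Nat.div_lt_of_lt_mul (by omega),
    (Nat.mod_add_div y N).symm⟩

/-- The matching of the copies by twins. -/
def twinCopy (N : ℕ) (tw : ℕ → ℕ) (y : ℕ) : ℕ := tw (y % N) + N * (y / N)

/-- The matching of the copies by partners: `pr a` is one more than the partner of `a`, and `0` if
there is none, in which case the two copies of `a` are matched. -/
def partnerCopy (N : ℕ) (pr : ℕ → ℕ) (y : ℕ) : ℕ :=
  if pr (y % N) = 0 then y % N + N * (1 - y / N) else pr (y % N) - 1 + N * (y / N)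

/-- The number that differs from `x` exactly in the last bit. -/
def sib (x : ℕ) : ℕ := x + 1 - 2 * (x % 2)

theorem sib_sib (x : ℕ) : sib (sib x) = x := by unfold sib; omega
theorem sib_ne (x : ℕ) : sib x ≠ x := by unfold sib; omega
theorem eq_sib {x y : ℕ} (h : x / 2 = y / 2) (hne : x ≠ y) : y = sib x := by unfold sib; omega

/-- Two arcs of the same class are partners if their ranks differ exactly in the last bit. -/
def Partner (tl lf rk : ℕ → ℕ) (a b : ℕ) : Prop := tl b = tl a ∧ lf b = lf a ∧ rk b = sib (rk a)

/-- The function `pr` finds the partners: `pr a` is one more than the partner of `a`, or `0`. -/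
def FindsPartners (N : ℕ) (tl lf rk pr : ℕ → ℕ) : Prop :=
  ∀ a < N, (pr a = 0 ∧ ∀ b < N, ¬ Partner tl lf rk a b) ∨
    ∃ b < N, pr a = b + 1 ∧ Partner tl lf rk a b

section

variable {N n k h : ℕ} {tl tw rk lf sd pr : ℕ → ℕ}

theorem twinCopy_isMatching (htw : IsMatching N tw) : IsMatching (2 * N) (twinCopy N tw) := by
  constructor <;> intro y hy <;> obtain ⟨a, i, ha, hi, rfl⟩ := exists_copy hy
  · simp only [twinCopy, copy_eq ha]
    exact copy_lt (htw.lt a ha) hi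
  · simp only [twinCopy, copy_eq ha, copy_eq (htw.lt a ha), htw.invol a ha]
  · simp only [twinCopy, copy_eq ha]
    have := htw.ne a ha
    omega

theorem partnerCopy_isMatching (hR : Ranked N tl k rk lf)
    (hp : FindsPartners N tl lf rk pr) : IsMatching (2 * N) (partnerCopy N pr) := by
  constructor <;> intro y hy <;> obtain ⟨a, i, ha, hi, rfl⟩ := exists_copy hy <;>
    obtain ⟨h0, hb⟩ | ⟨b, hb, h0, h1, h2, h3⟩ := hp a ha
  · simp only [partnerCopy, copy_eq ha, h0, if_true]
    exact copy_lt ha (by omega)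
  · simp only [partnerCopy, copy_eq ha, h0]
    simpa using copy_lt hb hi
  · simp only [partnerCopy, copy_eq ha, h0, if_true]
    congr 2
    omega
  · simp only [partnerCopy, copy_eq ha, h0, Nat.add_one_ne_zero, if_false, Nat.add_sub_cancel,
      copy_eq hb]
    obtain ⟨-, h4⟩ | ⟨d, hd, h4, h5, h6, h7⟩ := hp b hb
    · exact absurd ⟨h1.symm, h2.symm, by rw [h3, sib_sib]⟩ (h4 a ha)
    · have := hR.inj d hd a ha (by rw [h5, h1]) (by rw [h6, h2]) (by rw [h7, h3, sib_sib])
      simp [h4, this]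
  · simp only [partnerCopy, copy_eq ha, h0, if_true]
    interval_cases i <;> simp <;> omega
  · simp only [partnerCopy, copy_eq ha, h0]
    have : b ≠ a := by
      rintro rfl
      exact sib_ne _ h3.symm
    simp
    omega

/-- The color of an arc: the comparison of the orbit labels of its first copy and of the twin. -/
def arcColor (f tw : ℕ → ℕ) (K a : ℕ) : ℕ :=
  if minLabel f K a < minLabel f K (tw a) then 1 else 0

/-- An arc and its twin get different colors, and so do partners. -/
theorem arcColor_spec (htw : IsMatching N tw) (hR : Ranked N tl k rk lf)
    (hp : FindsPartners N tl lf rk pr) {K : ℕ} (hK : 2 * N ≤ 2 ^ K) :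
    (∀ a < N, arcColor (partnerCopy N pr ∘ twinCopy N tw) tw K (tw a) ≠
      arcColor (partnerCopy N pr ∘ twinCopy N tw) tw K a) ∧
    ∀ a < N, ∀ b < N, tl a = tl b → lf a = lf b → rk a / 2 = rk b / 2 → a ≠ b →
      arcColor (partnerCopy N pr ∘ twinCopy N tw) tw K a ≠
      arcColor (partnerCopy N pr ∘ twinCopy N tw) tw K b := by
  have ht := twinCopy_isMatching htw
  have hm := partnerCopy_isMatching hR hp
  have e : ∀ a < N, twinCopy N tw a = tw a := fun a ha => by
    simp [twinCopy, Nat.mod_eq_of_lt ha, Nat.div_eq_of_lt ha]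
  constructor
  · intro a ha
    obtain ⟨h1, -⟩ := minLabel_matching ht hm hK (y := a) (by omega)
    rw [e a ha] at h1
    unfold arcColor
    rw [htw.invol a ha]
    split_ifs <;> omega
  · intro a ha b hb h1 h2 h3 hab
    have hne : rk a ≠ rk b := fun h => hab (hR.inj a ha b hb h1 h2 h)
    have hpart : Partner tl lf rk a b := ⟨h1.symm, h2.symm, eq_sib h3 hne⟩
    have hpc : partnerCopy N pr a = b := by
      obtain ⟨-, h4⟩ | ⟨d, hd, h4, h5, h6, h7⟩ := hp a ha
      · exact absurd hpart (h4 b hb)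
      · have := hR.inj d hd b hb (by rw [h5, h1]) (by rw [h6, h2]) (by rw [h7, hpart.2.2])
        simp [partnerCopy, Nat.mod_eq_of_lt ha, Nat.div_eq_of_lt ha, h4, this]
    obtain ⟨h4, h5, h6⟩ := minLabel_matching ht hm hK (y := a) (by omega)
    rw [hpc, e a ha] at h5
    rw [hpc, e b hb] at h6
    rw [e a ha] at h4
    unfold arcColor
    rw [h5, h6]
    split_ifs <;> omega

/-- The position of an arc in the table of all arcs. -/
def slot (n pl rk lf tl : ℕ) : ℕ := (rk * pl + lf) * n + tl

theorem slot_inj {n pl r₁ l₁ t₁ r₂ l₂ t₂ : ℕ} (h₁ : l₁ < pl) (h₂ : l₂ < pl) (h₃ : t₁ < n)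
    (h₄ : t₂ < n) (h : slot n pl r₁ l₁ t₁ = slot n pl r₂ l₂ t₂) :
    r₁ = r₂ ∧ l₁ = l₂ ∧ t₁ = t₂ := by
  obtain ⟨h5, h6⟩ := mul_add_inj h₃ h₄ h
  obtain ⟨h7, h8⟩ := mul_add_inj h₁ h₂ h5
  exact ⟨h7, h8, h6⟩

/-- The expression for the slot of an arc whose class is that of the own arc, and whose rank is
given. -/
def slotExpr (rk : Expr) : Expr := (rk * .reg 12 + .reg 10) * .reg 2 + .reg 7

/-- One halving of all classes. Registers `9`, `10`, `11` hold `rk`, `lf` and `sd`, register `12`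
holds `2 ^ k`, and register `13` the number of remaining rounds. -/
def levelStep : Stmt :=
  -- array `6` is a table of all arcs by class and rank, used to find the partner, and then cleared
  .store 6 (slotExpr (.reg 9)) (.reg 5 + 1) ;;
  .load 15 6 (slotExpr (.reg 9 + 1 - 2 * (.reg 9 % 2))) ;;
  .store 6 (slotExpr (.reg 9)) 0 ;;
  -- array `7` holds the matching of the copies by partners, register `16` the partner of the twin
  .set 15 (.eq (.reg 15) 0 * (.reg 5 + .reg 3 * (1 - .reg 6)) +
    (1 - .eq (.reg 15) 0) * (.reg 15 - 1 + .reg 3 * .reg 6)) ;;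
  .store 7 (.reg 5 + .reg 3 * .reg 6) (.reg 15) ;;
  .load 16 7 (.reg 8 + .reg 3 * .reg 6) ;;
  -- the initial labels and pointers of the pointer doubling
  .set 17 (.reg 5 + .reg 3 * .reg 6) ;;
  .store 8 (.reg 5 + .reg 3 * .reg 6) (.reg 17) ;;
  .store 9 (.reg 5 + .reg 3 * .reg 6) (.reg 16) ;;
  labelLoop ;;
  -- the color of the arc, and the half that it belongs to; only the first round determines `sd`
  .load 18 8 (.reg 5) ;;
  .load 19 8 (.reg 8) ;;
  .set 18 ((.lt (.reg 18) (.reg 19) + .reg 11) % 2) ;;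
  .set 11 (.reg 11 + .eq (.reg 12) 1 * .reg 18) ;;
  .set 9 (.reg 9 / 2) ;;
  .set 10 (2 * .reg 10 + .reg 18) ;;
  .set 12 (2 * .reg 12) ;;
  .set 13 (.reg 13 - 1)

/-- The state before a round of the halving loop. -/
structure LevelState {P : ℕ} (N n : ℕ) (tl tw : ℕ → ℕ) (k : ℕ) (rk lf sd : ℕ → ℕ) (M : Memory)
    (ρ : Fin P → ℕ → ℕ) : Prop where
  inv : LevelInv N tl tw k rk lf sd
  r9 : ∀ p, ρ p 9 = rk (p % N)
  r10 : ∀ p, ρ p 10 = lf (p % N)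
  r11 : ∀ p, ρ p 11 = sd (p % N)
  r12 : ∀ p, ρ p 12 = 2 ^ k
  table : ∀ i, M 6 i = 0

variable {P W : ℕ} {M : Memory} {ρ : Fin P → ℕ → ℕ}

theorem LevelInv.sd_lt (hI : LevelInv N tl tw k rk lf sd) : ∀ a < N, sd a < 2 := by
  intro a ha
  rcases k with _ | j
  · rw [hI.sd_zero rfl a ha]; norm_num
  · exact (hI.sides j rfl a ha).2.2.1

/-- A round restores the invariant in `O(log N)` steps, by `LevelInv.step` with the colors of
`arcColor_spec`. -/
theorem levelStep_ens (hG : IsArcs N n tl tw) (hK : Knows N n h tl tw ρ)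
    (hS : LevelState N n tl tw k rk lf sd M ρ) (hN : 0 < N) (hNP : 2 * N ≤ P) (hNW : 4 * N < W)
    (hkW : 2 ^ (k + 1) < W) (h13 : ∀ p, ρ p 13 < W) :
    Ens W levelStep (9 * Nat.clog 2 (2 * N) + 19) M ρ fun M' ρ' =>
      (∃ rk' lf' sd', LevelState N n tl tw (k + 1) rk' lf' sd' M' ρ') ∧
      (∀ p, ρ' p 13 = ρ p 13 - 1) ∧
      (∀ p r, r ∉ [9, 10, 11, 12, 13, 14, 15, 16, 17, 18, 19] → ρ' p r = ρ p r) ∧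
      ∀ a, a ∉ [6, 7, 8, 9] → M' a = M a := by
  obtain ⟨hI, h9, h10, h11, h12, hT⟩ := hS
  have hmod : ∀ p : Fin P, (p : ℕ) % N < N := fun p => Nat.mod_lt _ hN
  have hmod2 : ∀ p : Fin P, (p : ℕ) / N % 2 < 2 := fun p => Nat.mod_lt _ (by norm_num)
  have hlf := hI.ranked.lf_lt
  have hy : ∀ p : Fin P, ρ p 5 + N * ρ p 6 = p % (2 * N) := fun p => by
    rw [hK.r5, hK.r6, mod_two_mul_eq]
  have hylt : ∀ p : Fin P, (p : ℕ) % (2 * N) < 2 * N := fun p => Nat.mod_lt _ (by omega)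
  rw [show 9 * Nat.clog 2 (2 * N) + 19 = (9 * Nat.clog 2 (2 * N) + 2) + 8 + 1 + 1 + 1 + 1 + 1 + 1
    + 1 + 1 + 1 by ring]
  refine Ens.store_seq (fun p => by have := hmod p; simp [hK.r5]; omega) fun M₁ hM₁ => ?_
  replace hM₁ : Written (P := P) 6
      (fun p => (fun a => slot n (2 ^ k) (rk a) (lf a) (tl a)) (p % N))
      (fun p => (fun a => a + 1) (p % N)) M M₁ := by
    convert hM₁ using 2 with p p
    · simp [slotExpr, slot, h9, h10, h12, hK.r2, hK.r7]
    · simp [hK.r5]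
  have hinj : ∀ a < N, ∀ b < N,
      slot n (2 ^ k) (rk a) (lf a) (tl a) = slot n (2 ^ k) (rk b) (lf b) (tl b) → a = b := by
    intro a ha b hb hab
    obtain ⟨e1, e2, e3⟩ := slot_inj (hlf a ha) (hlf b hb) (hG.tl_lt a ha) (hG.tl_lt b hb) hab
    exact hI.ranked.inj a ha b hb e3 e2 e1
  obtain ⟨w1, w1'⟩ := Written.mod (n := N) (val := fun a => a + 1)
    (idx := fun a => slot n (2 ^ k) (rk a) (lf a) (tl a)) hM₁ hN (by omega) fun a ha b hb hab => by
    rw [hinj a ha b hb hab]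
  -- the table shows the partners
  obtain ⟨pr, hpr⟩ : ∃ pr : ℕ → ℕ,
      pr = fun a => M₁ 6 (slot n (2 ^ k) (sib (rk a)) (lf a) (tl a)) := ⟨_, rfl⟩
  have hfind : FindsPartners N tl lf rk pr := by
    intro a ha
    by_cases hb : ∃ b < N, Partner tl lf rk a b
    · obtain ⟨b, hb, h1, h2, h3⟩ := hb
      refine .inr ⟨b, hb, ?_, h1, h2, h3⟩
      rw [hpr, ← w1 b hb, h1, h2, h3]
    · refine .inl ⟨?_, fun b hb' hp => hb ⟨b, hb', hp⟩⟩
      rw [hpr]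
      simp only
      rw [w1' _ fun b hb' hab => ?_, hT]
      obtain ⟨e1, e2, e3⟩ := slot_inj (hlf a ha) (hlf b hb') (hG.tl_lt a ha) (hG.tl_lt b hb') hab
      exact hb ⟨b, hb', e3.symm, e2.symm, e1.symm⟩
  have ht := twinCopy_isMatching hG.twin
  have hm := partnerCopy_isMatching hI.ranked hfind
  refine Ens.load_seq ?_
  have hld : ∀ p : Fin P, M₁ 6 ((slotExpr (.reg 9 + 1 - 2 * (.reg 9 % 2))).eval (ρ p)) =
      pr (p % N) := fun p => by
    simp [hpr, slotExpr, slot, sib, h9, h10, h12, hK.r2, hK.r7]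
  simp only [hld]
  refine Ens.store_seq (fun p => by simp; omega) fun M₂ hM₂ => ?_
  replace hM₂ : Written (P := P) 6
      (fun p => (fun a => slot n (2 ^ k) (rk a) (lf a) (tl a)) (p % N))
      (fun p => (fun _ => 0) (p % N)) M₁ M₂ := by
    convert hM₂ using 2 with p p
    · simp [slotExpr, slot, h9, h10, h12, hK.r2, hK.r7]
    · simp
  obtain ⟨w2, w2'⟩ := Written.mod (n := N) (val := fun _ => 0)
    (idx := fun a => slot n (2 ^ k) (rk a) (lf a) (tl a)) hM₂ hN (by omega) fun a ha b hb hab => rfl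
  have hT2 : ∀ i, M₂ 6 i = 0 := by
    intro i
    by_cases hi : ∃ a < N, i = slot n (2 ^ k) (rk a) (lf a) (tl a)
    · obtain ⟨a, ha, rfl⟩ := hi
      exact w2 a ha
    · push Not at hi
      rw [w2' i hi, w1' i hi, hT]
  have hmu : ∀ p : Fin P, (if pr (p % N) = 0 then 1 else 0) * ((p : ℕ) % N + N * (1 - p / N % 2)) +
      (1 - if pr (p % N) = 0 then 1 else 0) * (pr (p % N) - 1 + N * (p / N % 2)) =
      partnerCopy N pr (p % (2 * N)) := fun p => by
    unfold partnerCopy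
    rw [mod_two_mul_mod, mod_two_mul_div]
    split_ifs <;> simp
  refine Ens.set_seq (fun p => ?_) ?_
  · have := hm.lt _ (hylt p)
    simp only [Expr.eval_add, Expr.eval_mul, Expr.eval_eq, Expr.eval_reg, Expr.eval_sub,
      Expr.eval_one, Expr.eval_zero, Function.update_self, ne_eq, Nat.reduceEqDiff,
      not_false_eq_true, Function.update_of_ne, hK.r3, hK.r5, hK.r6, hmu]
    omega
  simp only [Expr.eval_add, Expr.eval_mul, Expr.eval_eq, Expr.eval_reg, Expr.eval_sub,
    Expr.eval_one, Expr.eval_zero, Function.update_self, ne_eq, Nat.reduceEqDiff,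
    not_false_eq_true, Function.update_of_ne, hK.r3, hK.r5, hK.r6, hmu, Function.update_idem]
  refine Ens.store_seq (fun p => ?_) fun M₃ hM₃ => ?_
  · have := hm.lt _ (hylt p)
    simp
    omega
  obtain ⟨w3, -⟩ := Written.mod (n := 2 * N) (idx := fun y => y) (val := partnerCopy N pr)
    (by convert hM₃ using 2 with p p <;> simp [hK.r3, hy]) (by omega) hNP (by simp +contextual)
  refine Ens.load_seq ?_
  have hld2 : ∀ p : Fin P, M₃ 7 (tw (p % N) + N * (p / N % 2)) =
      (partnerCopy N pr ∘ twinCopy N tw) (p % (2 * N)) := fun p => by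
    have e : tw (p % N) + N * (p / N % 2) = twinCopy N tw (p % (2 * N)) := by
      rw [twinCopy, mod_two_mul_mod, mod_two_mul_div]
    rw [e, w3 _ (ht.lt _ (hylt p))]
    rfl
  simp only [Expr.eval_add, Expr.eval_mul, Expr.eval_reg, ne_eq, Nat.reduceEqDiff,
    not_false_eq_true, Function.update_of_ne, hK.r3, hK.r6, hK.r8, hld2]
  have hf : ∀ y < 2 * N, (partnerCopy N pr ∘ twinCopy N tw) y < 2 * N := fun y hy =>
    hm.lt _ (ht.lt _ hy)
  generalize hfe : partnerCopy N pr ∘ twinCopy N tw = f at hf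
  refine Ens.set_seq (fun p => ?_) ?_
  · have := hylt p
    simp [hK.r3, hy]
    omega
  refine Ens.store_seq (fun p => ?_) fun M₄ hM₄ => ?_
  · have := hylt p
    simp [hK.r3, hy]
    omega
  obtain ⟨w4, -⟩ := Written.mod (n := 2 * N) (idx := fun y => y) (val := fun y => y)
    (by convert hM₄ using 2 with p p <;> simp [hK.r3, hy]) (by omega) hNP (by simp +contextual)
  refine Ens.store_seq (fun p => ?_) fun M₅ hM₅ => ?_
  · have := hf _ (hylt p)
    simp
    omega
  obtain ⟨w5, -⟩ := Written.mod (n := 2 * N) (idx := fun y => y) (val := f)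
    (by convert hM₅ using 2 with p p <;> simp [hK.r3, hy]) (by omega) hNP (by simp +contextual)
  refine Ens.seq (T := 9 * Nat.clog 2 (2 * N) + 2) (T' := 8)
    (Ens.weaken (labelLoop_ens (f := f) (N := N) ?_ ?_ ?_ ?_ ?_ w5 hf hN hNP hNW) le_rfl ?_)
  · simp [hK.r3]
  · simp [hy]
  · simp
  · simp [hK.r3, hy]
  · intro y hy
    rw [hM₅.1 8 (by norm_num)]
    exact w4 y hy
  rintro M₆ ρ₆ - ⟨hL, hr6, ha6⟩
  have hr6' : ∀ p r, r ∉ [14, 15, 16, 17, 18, 19] → ρ₆ p r = ρ p r := fun p r hr => by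
    simp only [List.mem_cons, List.not_mem_nil, or_false, not_or] at hr
    rw [hr6 p r (by simp [hr])]
    simp [hr]
  have hK2 : 2 * N ≤ 2 ^ Nat.clog 2 (2 * N) := Nat.le_pow_clog (by norm_num) _
  obtain ⟨hc1, hc2⟩ := arcColor_spec hG.twin hI.ranked hfind hK2
  rw [hfe] at hc1 hc2
  have hstep := hI.step (c := arcColor f tw (Nat.clog 2 (2 * N))) hG.twin.lt
    (fun a => by unfold arcColor; split_ifs <;> norm_num) hc1 hc2
  have l1 : ∀ p : Fin P, M₆ 8 (p % N) = minLabel f (Nat.clog 2 (2 * N)) (p % N) := fun p =>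
    hL _ (by have := hmod p; omega)
  have l2 : ∀ p : Fin P, M₆ 8 (tw (p % N)) = minLabel f (Nat.clog 2 (2 * N)) (tw (p % N)) :=
    fun p => hL _ (by have := hG.twin.lt _ (hmod p); omega)
  have hbit : ∀ p : Fin P, (if minLabel f (Nat.clog 2 (2 * N)) (p % N) <
      minLabel f (Nat.clog 2 (2 * N)) (tw (p % N)) then 1 else 0) =
      arcColor f tw (Nat.clog 2 (2 * N)) (p % N) := fun p => rfl
  have hrk1 := hI.ranked.rk_lt
  have hlf1 := hstep.ranked.lf_lt
  have hsd1 := hstep.sd_lt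
  generalize arcColor f tw (Nat.clog 2 (2 * N)) = c at *
  refine Ens.load_seq (Ens.load_seq ?_)
  simp only [Expr.eval_reg, ne_eq, Nat.reduceEqDiff,
    not_false_eq_true, Function.update_of_ne]
  have e5 : ∀ p, ρ₆ p 5 = p % N := fun p => (hr6' p 5 (by simp)).trans (hK.r5 p)
  have e8 : ∀ p, ρ₆ p 8 = tw (p % N) := fun p => (hr6' p 8 (by simp)).trans (hK.r8 p)
  have e9 : ∀ p, ρ₆ p 9 = rk (p % N) := fun p => (hr6' p 9 (by simp)).trans (h9 p)
  have e10 : ∀ p, ρ₆ p 10 = lf (p % N) := fun p => (hr6' p 10 (by simp)).trans (h10 p)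
  have e11 : ∀ p, ρ₆ p 11 = sd (p % N) := fun p => (hr6' p 11 (by simp)).trans (h11 p)
  have e12 : ∀ p, ρ₆ p 12 = 2 ^ k := fun p => (hr6' p 12 (by simp)).trans (h12 p)
  have e13 : ∀ p, ρ₆ p 13 = ρ p 13 := fun p => hr6' p 13 (by simp)
  simp only [e5, e8, l1, l2]
  refine Ens.set_seq (fun p => ?_) ?_
  · simp
    omega
  simp only [Expr.eval_mod, Expr.eval_add, Expr.eval_lt, Expr.eval_two, Expr.eval_reg,
    Function.update_self, ne_eq, Nat.reduceEqDiff, not_false_eq_true, Function.update_of_ne, hbit,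
    e11]
  refine Ens.set_seq (fun p => ?_) ?_
  · have := hsd1 _ (hmod p)
    simp only [Expr.eval_add, Expr.eval_mul, Expr.eval_eq, Expr.eval_reg, Expr.eval_one,
      Function.update_self, ne_eq, Nat.reduceEqDiff, not_false_eq_true, Function.update_of_ne,
      e11, e12]
    omega
  refine Ens.set_seq (fun p => ?_) ?_
  · simp [e9]
    exact (Nat.div_le_self _ _).trans_lt ((hrk1 _ (hmod p)).trans (by omega))
  refine Ens.set_seq (fun p => ?_) ?_
  · simp [e10]
    exact (hlf1 _ (hmod p)).trans hkW
  refine Ens.set_seq (fun p => ?_) ?_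
  · simp [e12]
    rwa [← pow_succ']
  refine Ens.set (fun p => ?_) ?_
  · simp [e13]
    exact (Nat.sub_le _ _).trans_lt (h13 p)
  refine ⟨⟨_, _, _, ⟨hstep, ?_, ?_, ?_, ?_, ?_⟩⟩, ?_, ?_, ?_⟩
  · simp [e9]
  · simp [e10]
  · simp [e11, e12]
  · simp [e12, pow_succ']
  · intro i
    rw [ha6 6 (by norm_num) (by norm_num), hM₅.1 6 (by norm_num), hM₄.1 6 (by norm_num),
      hM₃.1 6 (by norm_num), hT2]
  · simp [e13]
  · intro p r hr
    simp only [List.mem_cons, List.not_mem_nil, or_false, not_or] at hr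
    rw [← hr6' p r (by simp [hr])]
    simp [hr]
  · intro a ha
    simp only [List.mem_cons, List.not_mem_nil, or_false, not_or] at ha
    obtain ⟨a1, a2, a3, a4⟩ := ha
    rw [ha6 a a3 a4, hM₅.1 a a4, hM₄.1 a a3, hM₃.1 a a2, hM₂.1 a a1, hM₁.1 a a1]

end

end PRAM

/-! ### Numbering the arcs and vertices of every part -/

namespace PRAM

open Finset

section Counting

variable (N : ℕ) (tl leaf g : ℕ → ℕ)

/-- The arcs of part number `s`. -/
def part (s : ℕ) : Finset ℕ := {b ∈ range N | leaf b = s}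

/-- The number of the preceding arcs of the same part. -/
def posIn (a : ℕ) : ℕ := #{b ∈ range a | leaf b = leaf a}

/-- The number of the preceding arcs of the same part with the same value of `g`. -/
def prior (a : ℕ) : ℕ := #{b ∈ range a | leaf b = leaf a ∧ g b = g a}

/-- The vertices of part number `s`. -/
def verts (s : ℕ) : Finset ℕ := (part N leaf s).image tl

/-- The number of smaller vertices in the same part. -/
def vertNum (a : ℕ) : ℕ := #{v ∈ verts N tl leaf (leaf a) | v < tl a}

/-- The number of arcs of the same part with a smaller tail. -/
def arcsBefore (a : ℕ) : ℕ := #{b ∈ part N leaf (leaf a) | tl b < tl a}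

/-- The maximum degree of part number `s`. -/
def partDeg (s : ℕ) : ℕ := (verts N tl leaf s).sup fun v => #{b ∈ part N leaf s | tl b = v}

/-- The number of colors that are used by the parts with smaller numbers. -/
def colorOffset (s : ℕ) : ℕ := ∑ i ∈ range s, (partDeg N tl leaf i + 1)

end Counting

section

variable {N n : ℕ} {tl leaf g : ℕ → ℕ}

theorem mem_part {s b : ℕ} : b ∈ part N leaf s ↔ b < N ∧ leaf b = s := by simp [part]

theorem posIn_lt {a : ℕ} (ha : a < N) : posIn leaf a < #(part N leaf (leaf a)) := by
  refine card_lt_card ⟨fun b hb => ?_, fun h => ?_⟩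
  · simp only [mem_filter, mem_range] at hb
    exact mem_part.2 ⟨by omega, hb.2⟩
  · have := h (mem_part.2 ⟨ha, rfl⟩)
    simp at this

theorem posIn_lt_posIn {a b : ℕ} (hab : a < b) (h : leaf a = leaf b) :
    posIn leaf a < posIn leaf b := by
  refine card_lt_card ⟨fun c hc => ?_, fun h' => ?_⟩
  · simp only [mem_filter, mem_range] at hc ⊢
    exact ⟨by omega, by rw [hc.2, h]⟩
  · have := h' (mem_filter.2 ⟨mem_range.2 hab, h⟩)
    simp at this

theorem image_posIn (s : ℕ) : (part N leaf s).image (posIn leaf) = range #(part N leaf s) := by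
  apply eq_of_subset_of_card_le
  · intro x hx
    obtain ⟨b, hb, rfl⟩ := mem_image.1 hx
    obtain ⟨hb', rfl⟩ := mem_part.1 hb
    exact mem_range.2 (posIn_lt hb')
  · rw [card_image_of_injOn, card_range]
    intro a ha b hb hab
    obtain ⟨ha, rfl⟩ := mem_part.1 (mem_coe.1 ha)
    obtain ⟨hb, h⟩ := mem_part.1 (mem_coe.1 hb)
    rcases lt_trichotomy a b with h' | h' | h'
    · exact absurd hab (posIn_lt_posIn h' h.symm).ne
    · exact h'
    · exact absurd hab (posIn_lt_posIn h' h).ne'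

theorem posIn_inj {a b : ℕ} (h : leaf a = leaf b) (hab : posIn leaf a = posIn leaf b) :
    a = b := by
  rcases lt_trichotomy a b with h' | h' | h'
  · exact absurd hab (posIn_lt_posIn h' h).ne
  · exact h'
  · exact absurd hab (posIn_lt_posIn h' h.symm).ne'

theorem prior_eq_posIn {key : ℕ → ℕ} {a : ℕ}
    (h : ∀ b < a, key b = key a ↔ leaf b = leaf a ∧ g b = g a) :
    posIn key a = prior leaf g a := by
  unfold posIn prior
  congr 1
  exact filter_congr fun b hb => h b (mem_range.1 hb)

theorem prior_lt_prior {a b : ℕ} (hab : a < b) (h : leaf a = leaf b) (h' : g a = g b) :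
    prior leaf g a < prior leaf g b := by
  refine card_lt_card ⟨fun c hc => ?_, fun h'' => ?_⟩
  · simp only [mem_filter, mem_range] at hc ⊢
    exact ⟨by omega, by rw [hc.2.1, h], by rw [hc.2.2, h']⟩
  · have := h'' (mem_filter.2 ⟨mem_range.2 hab, h, h'⟩)
    simp at this

theorem prior_lt {a : ℕ} (ha : a < N) : prior leaf g a < N :=
  ((card_filter_le _ _).trans (by simp)).trans_lt ha

/-- Up to `a`, the number of first occurrences of values of `g` in a part is the number of
values. -/
theorem card_first (s : ℕ) (t : Finset ℕ) (ht : t ⊆ part N leaf s)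
    (hc : ∀ b ∈ t, ∀ b' < b, leaf b' = s → g b' = g b → b' ∈ t) :
    #{b ∈ t | prior leaf g b = 0} = #(t.image g) := by
  rw [← card_image_of_injOn (f := g) (s := {b ∈ t | prior leaf g b = 0})]
  · congr 1
    ext v
    simp only [mem_image, mem_filter]
    constructor
    · rintro ⟨b, ⟨h1, -⟩, h2⟩
      exact ⟨b, h1, h2⟩
    · rintro ⟨b, h1, rfl⟩
      induction b using Nat.strong_induction_on with
      | _ b ih =>
        by_cases h0 : prior leaf g b = 0
        · exact ⟨b, ⟨h1, h0⟩, rfl⟩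
        · obtain ⟨b', hb'⟩ := card_pos.1 (Nat.pos_of_ne_zero h0)
          simp only [mem_filter, mem_range] at hb'
          obtain ⟨h3, h4, h5⟩ := hb'
          rw [← h5]
          exact ih b' h3 (hc b h1 b' h3 (by rw [h4, (mem_part.1 (ht h1)).2]) h5)
  · intro a ha b hb hab
    simp only [coe_filter, Set.mem_ofPred_eq] at ha hb
    have e1 := (mem_part.1 (ht ha.1)).2
    have e2 := (mem_part.1 (ht hb.1)).2
    rcases lt_trichotomy a b with h | h | h
    · have := prior_lt_prior (leaf := leaf) (g := g) h (by rw [e1, e2]) hab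
      omega
    · exact h
    · have := prior_lt_prior (leaf := leaf) (g := g) h (by rw [e1, e2]) hab.symm
      omega

theorem card_first_part (s : ℕ) :
    ∑ b ∈ range N with leaf b = s, (if prior leaf g b = 0 then 1 else 0) =
      #((part N leaf s).image g) := by
  rw [← card_filter, ← card_first s (part N leaf s) Subset.rfl, part]
  intro b hb b' hb' h1 h2
  exact mem_part.2 ⟨hb'.trans (mem_part.1 hb).1, h1⟩

theorem tl_mem_verts {a : ℕ} (ha : a < N) : tl a ∈ verts N tl leaf (leaf a) :=
  mem_image_of_mem _ (mem_part.2 ⟨ha, rfl⟩)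

/-- The number of a vertex is found by counting first arcs. -/
theorem sum_first_eq (hmono : ∀ a b, a ≤ b → b < N → tl a ≤ tl b) {a : ℕ} (ha : a < N) :
    (∑ b ∈ range a with leaf b = leaf a, if prior leaf tl b = 0 then 1 else 0) +
      (if prior leaf tl a = 0 then 1 else 0) - 1 = vertNum N tl leaf a := by
  have h1 := card_first (g := tl) (leaf a) {b ∈ part N leaf (leaf a) | b ≤ a} (filter_subset _ _)
    (fun b hb b' hb' h1 h2 => by
      simp only [mem_filter, mem_part] at hb ⊢
      exact ⟨⟨by omega, h1⟩, by omega⟩)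
  have h2 : {b ∈ part N leaf (leaf a) | b ≤ a}.image tl =
      insert (tl a) {v ∈ verts N tl leaf (leaf a) | v < tl a} := by
    ext v
    simp only [mem_image, mem_filter, mem_part, mem_insert, verts]
    constructor
    · rintro ⟨b, ⟨⟨h3, h4⟩, h5⟩, rfl⟩
      rcases (hmono b a h5 ha).eq_or_lt with h | h
      · exact .inl h
      · exact .inr ⟨⟨b, ⟨h3, h4⟩, rfl⟩, h⟩
    · rintro (rfl | ⟨⟨b, ⟨h3, h4⟩, rfl⟩, h5⟩)
      · exact ⟨a, ⟨⟨ha, rfl⟩, le_rfl⟩, rfl⟩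
      · refine ⟨b, ⟨⟨h3, h4⟩, ?_⟩, rfl⟩
        by_contra! h6
        exact absurd (hmono a b h6.le h3) (not_le.2 h5)
  have h3 : {b ∈ part N leaf (leaf a) | b ≤ a} = insert a {b ∈ range a | leaf b = leaf a} := by
    ext b
    simp only [mem_filter, mem_part, mem_insert, mem_range]
    constructor
    · rintro ⟨⟨h3, h4⟩, h5⟩
      rcases h5.eq_or_lt with h | h
      · exact .inl h
      · exact .inr ⟨h, h4⟩
    · rintro (rfl | ⟨h3, h4⟩)
      · exact ⟨⟨ha, rfl⟩, le_rfl⟩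
      · exact ⟨⟨by omega, h4⟩, by omega⟩
  rw [h2, card_insert_of_notMem (by simp), h3, card_filter, sum_insert (by simp)] at h1
  unfold vertNum
  omega

theorem arcsBefore_add_prior (hmono : ∀ a b, a ≤ b → b < N → tl a ≤ tl b) {a : ℕ} (ha : a < N) :
    arcsBefore N tl leaf a + prior leaf tl a = posIn leaf a := by
  unfold arcsBefore prior posIn
  rw [← card_union_of_disjoint]
  · congr 1
    ext b
    simp only [mem_union, mem_filter, mem_part, mem_range]
    constructor
    · rintro (⟨⟨h1, h2⟩, h3⟩ | ⟨h1, h2, h3⟩)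
      · refine ⟨?_, h2⟩
        by_contra! h6
        exact absurd (hmono a b h6 h1) (not_le.2 h3)
      · exact ⟨h1, h2⟩
    · rintro ⟨h1, h2⟩
      rcases (hmono b a h1.le ha).eq_or_lt with h | h
      · exact .inr ⟨h1, h2, h⟩
      · exact .inl ⟨⟨h1.trans ha, h2⟩, h⟩
  · rw [disjoint_left]
    intro b h1 h2
    simp only [mem_filter] at h1 h2
    omega

theorem image_prior_class (s v : ℕ) :
    {b ∈ part N leaf s | tl b = v}.image (prior leaf tl) =
      range #{b ∈ part N leaf s | tl b = v} := by
  apply eq_of_subset_of_card_le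
  · intro x hx
    obtain ⟨b, hb, rfl⟩ := mem_image.1 hx
    simp only [mem_filter, mem_part] at hb
    obtain ⟨⟨hb, rfl⟩, rfl⟩ := hb
    rw [mem_range]
    refine card_lt_card ⟨fun c hc => ?_, fun h => ?_⟩
    · simp only [mem_filter, mem_range, mem_part] at hc ⊢
      exact ⟨⟨by omega, hc.2.1⟩, hc.2.2⟩
    · have := h (mem_filter.2 ⟨mem_part.2 ⟨hb, rfl⟩, rfl⟩)
      simp at this
  · rw [card_image_of_injOn, card_range]
    intro a ha b hb hab
    simp only [coe_filter, Set.mem_ofPred_eq, mem_part] at ha hb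
    rcases lt_trichotomy a b with h | h | h
    · have := prior_lt_prior (leaf := leaf) (g := tl) h (by rw [ha.1.2, hb.1.2])
        (by rw [ha.2, hb.2])
      omega
    · exact h
    · have := prior_lt_prior (leaf := leaf) (g := tl) h (by rw [ha.1.2, hb.1.2])
        (by rw [ha.2, hb.2])
      omega

/-- The maximum degree of a part is the number of different ranks in its adjacency lists. -/
theorem card_image_prior (s : ℕ) :
    #((part N leaf s).image (prior leaf tl)) = partDeg N tl leaf s := by
  have : (part N leaf s).image (prior leaf tl) = range (partDeg N tl leaf s) := by
    ext x
    rw [mem_range, partDeg, Finset.lt_sup_iff]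
    constructor
    · intro hx
      obtain ⟨b, hb, rfl⟩ := mem_image.1 hx
      refine ⟨tl b, mem_image_of_mem _ hb, mem_range.1 ?_⟩
      rw [← image_prior_class]
      exact mem_image_of_mem _ (mem_filter.2 ⟨hb, rfl⟩)
    · rintro ⟨v, -, hx⟩
      rw [← mem_range, ← image_prior_class] at hx
      obtain ⟨b, hb, rfl⟩ := mem_image.1 hx
      exact mem_image_of_mem _ (mem_filter.1 hb).1
  rw [this, card_range]

theorem partDeg_le (s : ℕ) : partDeg N tl leaf s ≤ N :=
  Finset.sup_le fun _ _ => ((card_filter_le _ _).trans (card_filter_le _ _)).trans (by simp)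

end

end PRAM

/-! ### The program that splits the graph and numbers the parts -/

namespace PRAM

open Finset

/-- Runs the halving `h + 1` times. Finally, register `21` holds `2 ^ h` and register `20` the
number of the part of the arc, which is `lf` without its first bit. -/
def halvingLoop : Stmt :=
  .set 9 (.reg 5 - .reg 29) ;;
  .set 10 0 ;;
  .set 11 0 ;;
  .set 12 1 ;;
  .set 13 (.reg 4 + 1) ;;
  .while (.reg 13) levelStep ;;
  .set 21 (.reg 12 / 2) ;;
  .set 20 (.reg 10 % .reg 21)

section

variable {N n h P W : ℕ} {tl tw : ℕ → ℕ} {M : Memory} {ρ : Fin P → ℕ → ℕ}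

/-- The partition of the arcs into `2 ^ h` parts that results from halving `h` times. -/
structure IsLeafMap (N h : ℕ) (tl tw leaf : ℕ → ℕ) : Prop where
  lt : ∀ a < N, leaf a < 2 ^ h
  twin : ∀ a < N, leaf (tw a) = leaf a
  halves : Halves N tl h leaf

theorem rank_eq (hG : IsArcs N n tl tw) {a : ℕ} (ha : a < N) :
    arcsBefore N tl (fun _ => 0) a + prior (fun _ => 0) tl a = a := by
  rw [arcsBefore_add_prior hG.mono ha]
  simp [posIn]

theorem levelInv_zero :
    LevelInv N tl tw 0 (prior (fun _ => 0) tl) (fun _ => 0) (fun _ => 0) where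
  ranked :=
    { rk_lt := fun a ha => prior_lt ha
      lf_lt := by simp
      inj := fun a ha b hb h1 _ h2 => by
        by_contra hab
        rcases lt_or_gt_of_ne hab with h' | h'
        · have := prior_lt_prior (leaf := fun _ => 0) h' rfl h1
          omega
        · have := prior_lt_prior (leaf := fun _ => 0) h' rfl h1.symm
          omega
      closed := fun a ha r hr => by
        have h1 := image_prior_class (N := N) (tl := tl) (leaf := fun _ => 0) 0 (tl a)
        have h2 : r ∈ range #{b ∈ part N (fun _ => 0) 0 | tl b = tl a} := by
          rw [mem_range]
          refine hr.trans ?_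
          rw [← mem_range, ← h1]
          exact mem_image_of_mem _ (by simp [part, ha])
        rw [← h1] at h2
        obtain ⟨b, hb, rfl⟩ := mem_image.1 h2
        simp only [mem_filter, mem_part] at hb
        exact ⟨b, hb.1.1, hb.2, rfl, rfl⟩ }
  sd_zero := by simp
  sides := by simp
  halves := by simp

theorem halvingLoop_ens (hG : IsArcs N n tl tw) (hK : Knows N n h tl tw ρ)
    (h29 : ∀ p, ρ p 29 = arcsBefore N tl (fun _ => 0) (p % N))
    (hM : ∀ i, M 6 i = 0) (hN : 0 < N) (hNP : 2 * N ≤ P) (hNW : 4 * N < W) (hh : 2 ^ h ≤ N) :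
    Ens W halvingLoop ((h + 1) * (9 * Nat.clog 2 (2 * N) + 21) + 8) M ρ fun M' ρ' =>
      (∃ leaf, IsLeafMap N h tl tw leaf ∧ ∀ p, ρ' p 20 = leaf (p % N)) ∧
      (∀ p, ρ' p 21 = 2 ^ h) ∧ (∀ p, ρ' p 13 = 0) ∧
      (∀ p r, r ∉ [9, 10, 11, 12, 13, 14, 15, 16, 17, 18, 19, 20, 21] → ρ' p r = ρ p r) ∧
      ∀ a, a ∉ [6, 7, 8, 9] → M' a = M a := by
  have hmod : ∀ p : Fin P, (p : ℕ) % N < N := fun p => Nat.mod_lt _ hN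
  have hrk : ∀ p : Fin P, (p : ℕ) % N - arcsBefore N tl (fun _ => 0) (p % N) =
      prior (fun _ => 0) tl (p % N) := fun p => by
    have := rank_eq hG (hmod p)
    omega
  have hhN : h < N := (Nat.lt_two_pow_self).trans_le hh
  rw [show (h + 1) * (9 * Nat.clog 2 (2 * N) + 21) + 8 =
    ((h + 1) * (9 * Nat.clog 2 (2 * N) + 19 + 2) + 1) + 2 + 1 + 1 + 1 + 1 + 1 by ring]
  refine Ens.set_seq (fun p => ?_) ?_
  · have := prior_lt (leaf := fun _ => 0) (g := tl) (hmod p)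
    simp [hK.r5, h29, hrk]
    omega
  refine Ens.set_seq (fun p => by simp; omega) ?_
  refine Ens.set_seq (fun p => by simp; omega) ?_
  refine Ens.set_seq (fun p => by simp; omega) ?_
  refine Ens.set_seq (fun p => by simp [hK.r4]; omega) ?_
  refine Ens.seq (T' := 2) (Ens.while (h + 1) (fun k M' ρ' =>
    (∃ rk lf sd, LevelState N n tl tw k rk lf sd M' ρ') ∧
    (∀ p, ρ' p 13 = h + 1 - k) ∧
    (∀ p r, r ∉ [9, 10, 11, 12, 13, 14, 15, 16, 17, 18, 19] → ρ' p r = ρ p r) ∧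
    ∀ a, a ∉ [6, 7, 8, 9] → M' a = M a) ?_ ?_ ?_)
  · refine ⟨⟨_, _, _, levelInv_zero, ?_, ?_, ?_, ?_, hM⟩, ?_, ?_, fun _ _ => rfl⟩
    · simp [hK.r5, h29, hrk]
    · simp
    · simp
    · simp
    · simp [hK.r4]
    · intro p r hr
      simp only [List.mem_cons, List.not_mem_nil, or_false, not_or] at hr
      simp [hr]
  · rintro k hk M' ρ' ⟨⟨rk, lf, sd, hS⟩, h13, hr, ha⟩
    have hkh : 2 ^ (k + 1) ≤ 2 * N := by
      have : 2 ^ k ≤ 2 ^ h := Nat.pow_le_pow_right (by norm_num) (by omega)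
      rw [pow_succ]; omega
    refine ⟨fun p => by simp [h13]; omega, ?_⟩
    refine (levelStep_ens (h := h) hG (hK.congr fun p r h => hr p r ?_) hS hN hNP hNW (by omega)
      (fun p => by rw [h13]; omega)).weaken le_rfl ?_
    · simp; omega
    rintro M₂ ρ₂ - ⟨hS', h13', hr', ha'⟩
    exact ⟨hS', fun p => by rw [h13', h13]; omega, fun p r h => by rw [hr' p r h, hr p r h],
      fun a h => by rw [ha' a h, ha a h]⟩
  · rintro M' ρ' ⟨⟨rk, lf, sd, hI, h9, h10, h11, h12, hT⟩, h13, hr, ha⟩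
    refine ⟨fun p => by simp [h13], ?_⟩
    have hdiv : 2 ^ (h + 1) / 2 = 2 ^ h := by rw [pow_succ]; omega
    refine Ens.set_seq (T := 1) (fun p => by simp [h12, hdiv]; omega) ?_
    refine Ens.set (fun p => ?_) ?_
    · simp [h12, hdiv, h10]
      exact (Nat.mod_lt _ (by positivity)).trans_le (by omega)
    have hleaf : IsLeafMap N h tl tw fun a => lf a % 2 ^ h :=
      { lt := fun a _ => Nat.mod_lt _ (by positivity)
        twin := fun a ha => (hI.sides h rfl a ha).2.2.2
        halves := hI.halves h rfl }
    refine ⟨⟨_, hleaf, ?_⟩, ?_, ?_, ?_, ha⟩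
    · simp [h12, hdiv, h10]
    · simp [h12, hdiv]
    · simp [h13]
    · intro p r h
      rw [← hr p r (by simp at h ⊢; omega)]
      simp only [List.mem_cons, List.not_mem_nil, or_false, not_or] at h
      simp [h]

/-- Computes, for the arc of every processor and the part that contains it, the numbers that
`IsNumbered` lists. -/
def numberParts : Stmt :=
  -- register `30`: the rank of the arc among those of its part with the same tail
  .set 32 (.reg 20 * .reg 2 + .reg 7) ;;
  .set 34 1 ;;
  prefixSums 10 ;;
  .set 30 (.reg 33) ;;
  -- the position of the arc in its part, and the number of arcs there
  .set 32 (.reg 20) ;;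
  .set 34 1 ;;
  prefixSums 11 ;;
  .set 22 (.reg 33) ;;
  .set 26 (.reg 34) ;;
  -- vertices are counted by their first arcs
  .set 34 (.eq (.reg 30) 0) ;;
  prefixSums 12 ;;
  .set 23 (.reg 33 + .eq (.reg 30) 0 - 1) ;;
  .set 27 (.reg 34) ;;
  -- the maximum degree of a part is the number of ranks that occur in it
  .set 32 (.reg 20 * .reg 3 + .reg 30) ;;
  .set 34 1 ;;
  prefixSums 13 ;;
  .set 32 (.reg 20) ;;
  .set 34 (.eq (.reg 33) 0) ;;
  prefixSums 14 ;;
  -- the prefix sums of the numbers of colors of the parts, the processors of arc `a` standing for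
  -- part `a`
  .store 16 (.reg 20) (.reg 34) ;;
  .load 31 16 (.reg 5) ;;
  .set 32 0 ;;
  .set 34 (.lt (.reg 5) (.reg 21) * (.reg 31 + 1)) ;;
  prefixSums 15 ;;
  .store 17 (.reg 5) (.reg 33) ;;
  .load 28 17 (.reg 20) ;;
  .set 29 (.reg 22 - .reg 30) ;;
  -- the numbers of the head and of the twin are read from the twin
  .store 18 (.reg 5) (.reg 23) ;;
  .store 21 (.reg 5) (.reg 22) ;;
  .load 24 18 (.reg 8) ;;
  .load 25 21 (.reg 8)

/-- Every processor knows, for its arc: the part, the position of the arc and of its twin in the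
adjacency lists of the part, the numbers of the tail and the head in the part, the numbers of arcs
and vertices of the part, the number of colors that precede those of the part, and the position of
the first arc with the same tail. -/
structure IsNumbered (N h : ℕ) (tl tw leaf : ℕ → ℕ) (ρ : Fin P → ℕ → ℕ) : Prop where
  r20 : ∀ p, ρ p 20 = leaf (p % N)
  r21 : ∀ p, ρ p 21 = 2 ^ h
  r22 : ∀ p, ρ p 22 = posIn leaf (p % N)
  r23 : ∀ p, ρ p 23 = vertNum N tl leaf (p % N)
  r24 : ∀ p, ρ p 24 = vertNum N tl leaf (tw (p % N))
  r25 : ∀ p, ρ p 25 = posIn leaf (tw (p % N))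
  r26 : ∀ p, ρ p 26 = #(part N leaf (leaf (p % N)))
  r27 : ∀ p, ρ p 27 = #(verts N tl leaf (leaf (p % N)))
  r28 : ∀ p, ρ p 28 = colorOffset N tl leaf (leaf (p % N))
  r29 : ∀ p, ρ p 29 = arcsBefore N tl leaf (p % N)

/-- `prefixSums_ens` with the names of the sets that occur below. -/
theorem prefixSums_ens' {arr : ℕ} {key w : ℕ → ℕ} {M : Memory} {ρ : Fin P → ℕ → ℕ}
    (hK : Knows N n h tl tw ρ) (hkey : ∀ p, ρ p 32 = key (p % N))
    (hw : ∀ p, ρ p 34 = w (p % N)) (hM : ∀ i, M arr i = 0) (hN : 0 < N) (hNP : N ≤ P)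
    (B : ℕ) (hB : ∀ b < N, w b ≤ B) (hW : N * B < W) (hNW : 2 * N < W) :
    Ens W (prefixSums arr) (7 * Nat.clog 2 (2 * N) + 4) M ρ fun M' ρ' =>
      (∀ p, ρ' p 33 = ∑ b ∈ range (p % N) with key b = key (p % N), w b) ∧
      (∀ p, ρ' p 34 = ∑ b ∈ range N with key b = key (p % N), w b) ∧
      (∀ p, ρ' p 33 ≤ N * B ∧ ρ' p 34 ≤ N * B) ∧
      (∀ p r, r ∉ [14, 18, 33, 34] → ρ' p r = ρ p r) ∧
      ∀ a, a ≠ arr → M' a = M a := by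
  have hsum : ∑ b ∈ range N, w b ≤ N * B := by
    simpa using sum_le_card_nsmul (range N) w B fun b hb => hB b (mem_range.1 hb)
  refine (prefixSums_ens hK.r3 hK.r5 hkey hw hM hN hNP (hsum.trans_lt hW) hNW).weaken ?_ ?_
  · have := Nat.clog_mono_right 2 (show N ≤ 2 * N by omega)
    omega
  · rintro M' ρ' - ⟨h1, h2, h3, h4⟩
    refine ⟨h1, h2, fun p => ⟨?_, ?_⟩, fun p r hr => ?_, h4⟩
    · rw [h1]
      refine (sum_le_sum_of_subset ((filter_subset _ _).trans ?_)).trans hsum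
      exact range_subset_range.2 (Nat.mod_lt _ hN).le
    · rw [h2]
      exact (sum_le_sum_of_subset (filter_subset _ _)).trans hsum
    · simp only [List.mem_cons, List.not_mem_nil, or_false, not_or] at hr
      exact h3 p r hr.1 hr.2.1 hr.2.2.1 hr.2.2.2

/-- Six prefix sums, each over all arcs at once, number the arcs and the vertices of all parts. -/
theorem numberParts_ens {leaf : ℕ → ℕ} (hG : IsArcs N n tl tw) (hK : Knows N n h tl tw ρ)
    (hL : IsLeafMap N h tl tw leaf) (h20 : ∀ p, ρ p 20 = leaf (p % N)) (h21 : ∀ p, ρ p 21 = 2 ^ h)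
    (hM : ∀ a, 10 ≤ a → ∀ i, M a i = 0) (hN : 0 < N) (hNP : 2 * N ≤ P) (hNW : 4 * N < W)
    (hW₁ : N * n + n < W) (hW₂ : N * (N + 1) < W) (hh : 2 ^ h ≤ N) :
    Ens W numberParts (42 * Nat.clog 2 (2 * N) + 49) M ρ fun M' ρ' =>
      IsNumbered N h tl tw leaf ρ' ∧
      (∀ p r, r ∉ [14, 18, 22, 23, 24, 25, 26, 27, 28, 29, 30, 31, 32, 33, 34] →
        ρ' p r = ρ p r) ∧
      ∀ a, a ∉ [10, 11, 12, 13, 14, 15, 16, 17, 18, 21] → M' a = M a := by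
  have hmod : ∀ p : Fin P, (p : ℕ) % N < N := fun p => Nat.mod_lt _ hN
  have hN1 : N ≤ N * (N + 1) := Nat.le_mul_of_pos_right N (by omega)
  have hleaf : ∀ a < N, leaf a < N := fun a ha => (hL.lt a ha).trans_le hh
  obtain ⟨K, hKe⟩ : ∃ K, K = 7 * Nat.clog 2 (2 * N) + 4 := ⟨_, rfl⟩
  rw [show 42 * Nat.clog 2 (2 * N) + 49 = (K + (((K + ((K + ((K + ((K + ((K + (7)) + 1 + 1 + 1 + 1))
    + 1 + 1)) + 1 + 1 + 1 + 1)) + 1 + 1 + 1)) + 1 + 1 + 1))) + 1 + 1 by omega]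
  -- the ranks of the arcs in the adjacency lists of their parts
  refine Ens.set_seq (fun p => ?_) (Ens.set_seq (fun p => by simp; omega) ?_)
  · have h1 := hleaf _ (hmod p)
    have h2 := hG.tl_lt _ (hmod p)
    simp [h20, hK.r2, hK.r7]
    have := Nat.mul_le_mul_right n h1.le
    omega
  refine Ens.seq (((prefixSums_ens' (key := fun a => leaf a * n + tl a) (w := fun _ => 1)
    (hK.congr fun p r hr => ?_) ?_ ?_ (hM 10 le_rfl) hN (by omega) 1 (by simp) (by omega)
    (by omega))).weaken hKe.ge ?_)
  · rw [Function.update_of_ne (by omega), Function.update_of_ne (by omega)]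
  · simp [h20, hK.r2, hK.r7]
  · simp
  rintro M₁ ρ₁ - ⟨a₁, -, -, hr₁, ha₁⟩
  replace hr₁ : ∀ p r, r ∉ [14, 18, 32, 33, 34] → ρ₁ p r = ρ p r := fun p r hr => by
    simp only [List.mem_cons, List.not_mem_nil, or_false, not_or] at hr
    rw [hr₁ p r (by simp [hr])]
    simp [hr]
  replace a₁ : ∀ p, ρ₁ p 33 = prior leaf tl (p % N) := fun p => by
    rw [a₁, sum_const, smul_eq_mul, mul_one]
    refine prior_eq_posIn fun b hb => ⟨fun hk => ?_, fun hk => by rw [hk.1, hk.2]⟩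
    have := slot_inj (n := n) (pl := 2 ^ h) (r₁ := 0) (r₂ := 0)
      (hL.lt b (hb.trans (hmod p))) (hL.lt _ (hmod p))
      (hG.tl_lt b (hb.trans (hmod p))) (hG.tl_lt _ (hmod p)) (by simpa [slot] using hk)
    exact this.2
  have hpr : ∀ a < N, prior leaf tl a < N := fun a ha => prior_lt ha
  have hK₁ : Knows N n h tl tw ρ₁ := hK.congr fun p r hr => hr₁ p r (by simp; omega)
  have e20 : ∀ p, ρ₁ p 20 = leaf (p % N) := fun p => (hr₁ p 20 (by simp)).trans (h20 p)
  -- the positions of the arcs in their parts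
  refine Ens.set_seq (fun p => ?_) (Ens.set_seq (fun p => ?_) (Ens.set_seq (fun p => ?_) ?_))
  · have := hpr _ (hmod p)
    simp [a₁]; omega
  · have := hleaf _ (hmod p)
    simp [e20]; omega
  · simp; omega
  refine Ens.seq (((prefixSums_ens' (key := leaf) (w := fun _ => 1)
    (hK₁.congr fun p r hr => ?_) ?_ ?_ (arr := 11) ?_ hN (by omega) 1 (by simp) (by omega)
    (by omega))).weaken hKe.ge ?_)
  · rw [Function.update_of_ne (by omega), Function.update_of_ne (by omega),
      Function.update_of_ne (by omega)]
  · simp [e20]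
  · simp
  · intro i
    rw [ha₁ _ (by norm_num), hM _ (by norm_num)]
  rintro M₂ ρ₂ - ⟨a₂, b₂, -, hr₂, ha₂⟩
  have f30 : ∀ p, ρ₂ p 30 = prior leaf tl (p % N) := fun p => by
    rw [hr₂ p 30 (by simp)]; simp [a₁]
  have f32 : ∀ p, ρ₂ p 32 = leaf (p % N) := fun p => by
    rw [hr₂ p 32 (by simp)]; simp [e20]
  replace hr₂ : ∀ p r, r ∉ [14, 18, 30, 32, 33, 34] → ρ₂ p r = ρ p r := fun p r hr => by
    simp only [List.mem_cons, List.not_mem_nil, or_false, not_or] at hr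
    rw [hr₂ p r (by simp [hr])]
    simp [hr, hr₁]
  replace a₂ : ∀ p, ρ₂ p 33 = posIn leaf (p % N) := fun p => by
    rw [a₂, sum_const, smul_eq_mul, mul_one, posIn]
  replace b₂ : ∀ p, ρ₂ p 34 = #(part N leaf (leaf (p % N))) := fun p => by
    rw [b₂, sum_const, smul_eq_mul, mul_one, part]
  have hpart : ∀ s, #(part N leaf s) ≤ N := fun s => (card_filter_le _ _).trans (by simp)
  have hpos : ∀ a < N, posIn leaf a < N := fun a ha => (posIn_lt ha).trans_le (hpart _)
  have hK₂ : Knows N n h tl tw ρ₂ := hK.congr fun p r hr => hr₂ p r (by simp; omega)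
  -- the numbers of the vertices in the parts
  refine Ens.set_seq (fun p => ?_) (Ens.set_seq (fun p => ?_) (Ens.set_seq (fun p => ?_) ?_))
  · have := hpos _ (hmod p)
    simp [a₂]; omega
  · have := hpart (leaf (p % N))
    simp [b₂]; omega
  · simp; split_ifs <;> omega
  refine Ens.seq (((prefixSums_ens' (key := leaf)
    (w := fun a => if prior leaf tl a = 0 then 1 else 0)
    (hK₂.congr fun p r hr => ?_) ?_ ?_ (arr := 12) ?_ hN (by omega) 1
    (fun b _ => by split_ifs <;> omega) (by omega) (by omega))).weaken hKe.ge ?_)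
  · rw [Function.update_of_ne (by omega), Function.update_of_ne (by omega),
      Function.update_of_ne (by omega)]
  · simp [f32]
  · simp [f30]
  · intro i
    rw [ha₂ _ (by norm_num), ha₁ _ (by norm_num), hM _ (by norm_num)]
  rintro M₃ ρ₃ - ⟨a₃, b₃, c₃, hr₃, ha₃⟩
  have g22 : ∀ p, ρ₃ p 22 = posIn leaf (p % N) := fun p => by
    rw [hr₃ p 22 (by simp)]; simp [a₂]
  have g26 : ∀ p, ρ₃ p 26 = #(part N leaf (leaf (p % N))) := fun p => by
    rw [hr₃ p 26 (by simp)]; simp [b₂]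
  have g30 : ∀ p, ρ₃ p 30 = prior leaf tl (p % N) := fun p => by
    rw [hr₃ p 30 (by simp)]; simp [f30]
  replace hr₃ : ∀ p r, r ∉ [14, 18, 22, 26, 30, 32, 33, 34] → ρ₃ p r = ρ p r := fun p r hr => by
    simp only [List.mem_cons, List.not_mem_nil, or_false, not_or] at hr
    rw [hr₃ p r (by simp [hr])]
    simp [hr, hr₂]
  have g23 : ∀ p, ρ₃ p 33 + (if prior leaf tl (p % N) = 0 then 1 else 0) - 1 =
      vertNum N tl leaf (p % N) := fun p => by
    rw [a₃]
    exact sum_first_eq hG.mono (hmod p)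
  replace b₃ : ∀ p, ρ₃ p 34 = #(verts N tl leaf (leaf (p % N))) := fun p => by
    rw [b₃, card_first_part, verts]
  have g20 : ∀ p, ρ₃ p 20 = leaf (p % N) := fun p => (hr₃ p 20 (by simp)).trans (h20 p)
  have hK₃ : Knows N n h tl tw ρ₃ := hK.congr fun p r hr => hr₃ p r (by simp; omega)
  have hvert : ∀ p : Fin P, vertNum N tl leaf (p % N) < W := fun p => by
    have := (c₃ p).1
    rw [← g23]
    split_ifs <;> omega
  -- the maximum degrees
  refine Ens.set_seq (fun p => ?_) (Ens.set_seq (fun p => ?_) (Ens.set_seq (fun p => ?_)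
    (Ens.set_seq (fun p => ?_) ?_)))
  · simpa [g30, g23] using hvert p
  · have := (c₃ p).2
    simp; omega
  · have h1 := hleaf _ (hmod p)
    have h2 := hpr _ (hmod p)
    simp [g20, g30, hK₃.r3]
    have : leaf (p % N) * N ≤ N * N := Nat.mul_le_mul_right _ h1.le
    rw [mul_add] at hW₂
    omega
  · simp; omega
  refine Ens.seq (((prefixSums_ens' (key := fun a => leaf a * N + prior leaf tl a)
    (w := fun _ => 1) (hK₃.congr fun p r hr => ?_) ?_ ?_ (arr := 13) ?_ hN (by omega) 1
    (by simp) (by omega) (by omega))).weaken hKe.ge ?_)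
  · rw [Function.update_of_ne (by omega), Function.update_of_ne (by omega),
      Function.update_of_ne (by omega), Function.update_of_ne (by omega)]
  · simp [g20, g30, hK₃.r3]
  · simp
  · intro i
    rw [ha₃ _ (by norm_num), ha₂ _ (by norm_num), ha₁ _ (by norm_num), hM _ (by norm_num)]
  rintro M₄ ρ₄ - ⟨a₄, -, -, hr₄, ha₄⟩
  have i22 : ∀ p, ρ₄ p 22 = posIn leaf (p % N) := fun p => by
    rw [hr₄ p 22 (by simp)]; simp [g22]
  have i23 : ∀ p, ρ₄ p 23 = vertNum N tl leaf (p % N) := fun p => by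
    rw [hr₄ p 23 (by simp)]; simp [g30, g23]
  have i26 : ∀ p, ρ₄ p 26 = #(part N leaf (leaf (p % N))) := fun p => by
    rw [hr₄ p 26 (by simp)]; simp [g26]
  have i27 : ∀ p, ρ₄ p 27 = #(verts N tl leaf (leaf (p % N))) := fun p => by
    rw [hr₄ p 27 (by simp)]; simp [b₃]
  have i30 : ∀ p, ρ₄ p 30 = prior leaf tl (p % N) := fun p => by
    rw [hr₄ p 30 (by simp)]; simp [g30]
  replace hr₄ : ∀ p r, r ∉ [14, 18, 22, 23, 26, 27, 30, 32, 33, 34] → ρ₄ p r = ρ p r :=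
    fun p r hr => by
    simp only [List.mem_cons, List.not_mem_nil, or_false, not_or] at hr
    rw [hr₄ p r (by simp [hr])]
    simp [hr, hr₃]
  replace a₄ : ∀ p, ρ₄ p 33 = prior leaf (prior leaf tl) (p % N) := fun p => by
    rw [a₄, sum_const, smul_eq_mul, mul_one]
    refine prior_eq_posIn fun b hb => ⟨fun hk => ?_, fun hk => by rw [hk.1, hk.2]⟩
    have := slot_inj (n := N) (pl := 2 ^ h) (r₁ := 0) (r₂ := 0)
      (hL.lt b (hb.trans (hmod p))) (hL.lt _ (hmod p))
      (hpr b (hb.trans (hmod p))) (hpr _ (hmod p)) (by simpa [slot] using hk)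
    exact this.2
  have i20 : ∀ p, ρ₄ p 20 = leaf (p % N) := fun p => (hr₄ p 20 (by simp)).trans (h20 p)
  have hK₄ : Knows N n h tl tw ρ₄ := hK.congr fun p r hr => hr₄ p r (by simp; omega)
  refine Ens.set_seq (fun p => ?_) (Ens.set_seq (fun p => ?_) ?_)
  · have := hleaf _ (hmod p)
    simp [i20]; omega
  · simp; split_ifs <;> omega
  refine Ens.seq (((prefixSums_ens' (key := leaf)
    (w := fun a => if prior leaf (prior leaf tl) a = 0 then 1 else 0)
    (hK₄.congr fun p r hr => ?_) ?_ ?_ (arr := 14) ?_ hN (by omega) 1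
    (fun b _ => by split_ifs <;> omega) (by omega) (by omega))).weaken hKe.ge ?_)
  · rw [Function.update_of_ne (by omega), Function.update_of_ne (by omega)]
  · simp [i20]
  · simp [a₄]
  · intro i
    rw [ha₄ _ (by norm_num), ha₃ _ (by norm_num), ha₂ _ (by norm_num), ha₁ _ (by norm_num),
      hM _ (by norm_num)]
  rintro M₅ ρ₅ - ⟨-, b₅, -, hr₅, ha₅⟩
  replace hr₅ : ∀ p r, r ∉ [14, 18, 32, 33, 34] → ρ₅ p r = ρ₄ p r := fun p r hr => by
    simp only [List.mem_cons, List.not_mem_nil, or_false, not_or] at hr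
    rw [hr₅ p r (by simp [hr])]
    simp [hr]
  replace b₅ : ∀ p, ρ₅ p 34 = partDeg N tl leaf (leaf (p % N)) := fun p => by
    rw [b₅, card_first_part, card_image_prior]
  have hdeg : ∀ s, partDeg N tl leaf s ≤ N := partDeg_le
  have hK₅ : Knows N n h tl tw ρ₅ := hK₄.congr fun p r hr => hr₅ p r (by simp; omega)
  have j20 : ∀ p, ρ₅ p 20 = leaf (p % N) := fun p => (hr₅ p 20 (by simp)).trans (i20 p)
  have j21 : ∀ p, ρ₅ p 21 = 2 ^ h := fun p => by
    rw [hr₅ p 21 (by simp), hr₄ p 21 (by simp), h21]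
  -- the color offsets: part number `a` is in the care of the processors of the arc `a`
  refine Ens.store_seq (fun p => ?_) fun M₆ hM₆ => Ens.load_seq ?_
  · have := hdeg (leaf (p % N))
    simp [b₅]; omega
  obtain ⟨w₆, w₆'⟩ := Written.mod (n := N) (idx := leaf)
    (val := fun a => partDeg N tl leaf (leaf a))
    (by convert hM₆ using 2 with p p <;> simp [j20, b₅]) hN (by omega)
    (fun a _ b _ hab => by rw [hab])
  have hD : ∀ s, M₆ 16 s = partDeg N tl leaf s := by
    intro s
    by_cases hs : ∃ a < N, leaf a = s
    · obtain ⟨a, ha, rfl⟩ := hs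
      exact w₆ a ha
    · push Not at hs
      rw [w₆' s fun a ha h => hs a ha h.symm, ha₅ _ (by norm_num), ha₄ _ (by norm_num),
        ha₃ _ (by norm_num), ha₂ _ (by norm_num), ha₁ _ (by norm_num), hM _ (by norm_num),
        partDeg, verts, part, filter_false_of_mem (fun b hb => hs b (mem_range.1 hb))]
      simp
  simp only [Expr.eval_reg, hK₅.r5, hD]
  refine Ens.set_seq (fun p => by simp; omega) (Ens.set_seq (fun p => ?_) ?_)
  · have := hdeg (p % N)
    simp [hK₅.r5, j21]; split_ifs <;> omega
  refine Ens.seq (((prefixSums_ens' (key := fun _ => 0)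
    (w := fun a => (if a < 2 ^ h then 1 else 0) * (partDeg N tl leaf a + 1))
    (hK₅.congr fun p r hr => ?_) ?_ ?_ (arr := 15) ?_ hN (by omega) (N + 1)
    (fun b _ => ?_) hW₂ (by omega))).weaken hKe.ge ?_)
  · rw [Function.update_of_ne (by omega), Function.update_of_ne (by omega),
      Function.update_of_ne (by omega)]
  · simp
  · simp [hK₅.r5, j21]
  · intro i
    rw [hM₆.1 _ (by norm_num), ha₅ _ (by norm_num), ha₄ _ (by norm_num), ha₃ _ (by norm_num),
      ha₂ _ (by norm_num), ha₁ _ (by norm_num), hM _ (by norm_num)]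
  · have := hdeg b
    split_ifs <;> omega
  rintro M₇ ρ₇ - ⟨a₇, -, c₇, hr₇, ha₇⟩
  replace hr₇ : ∀ p r, r ∉ [14, 18, 31, 32, 33, 34] → ρ₇ p r = ρ₄ p r := fun p r hr => by
    simp only [List.mem_cons, List.not_mem_nil, or_false, not_or] at hr
    rw [hr₇ p r (by simp [hr])]
    simp [hr, hr₅]
  have hK₇ : Knows N n h tl tw ρ₇ := hK₄.congr fun p r hr => hr₇ p r (by simp; omega)
  have hoff : ∀ s, s < 2 ^ h → ∑ b ∈ range s with (fun _ => 0) b = (fun _ => 0) s,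
      (if b < 2 ^ h then 1 else 0) * (partDeg N tl leaf b + 1) = colorOffset N tl leaf s := by
    intro s hs
    rw [filter_true_of_mem (by simp), colorOffset]
    refine sum_congr rfl fun b hb => ?_
    rw [if_pos ((mem_range.1 hb).trans hs), one_mul]
  have l20 : ∀ p, ρ₇ p 20 = leaf (p % N) := fun p => (hr₇ p 20 (by simp)).trans (i20 p)
  have l21 : ∀ p, ρ₇ p 21 = 2 ^ h := fun p => by
    rw [hr₇ p 21 (by simp), hr₄ p 21 (by simp), h21]
  have l22 : ∀ p, ρ₇ p 22 = posIn leaf (p % N) := fun p => (hr₇ p 22 (by simp)).trans (i22 p)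
  have l23 : ∀ p, ρ₇ p 23 = _ := fun p => (hr₇ p 23 (by simp)).trans (i23 p)
  have l26 : ∀ p, ρ₇ p 26 = _ := fun p => (hr₇ p 26 (by simp)).trans (i26 p)
  have l27 : ∀ p, ρ₇ p 27 = _ := fun p => (hr₇ p 27 (by simp)).trans (i27 p)
  have l30 : ∀ p, ρ₇ p 30 = _ := fun p => (hr₇ p 30 (by simp)).trans (i30 p)
  refine Ens.store_seq (T := 6) (fun p => ?_) fun M₈ hM₈ => Ens.load_seq (T := 5) ?_
  · have := (c₇ p).1
    simp; omega
  obtain ⟨w₈, -⟩ := Written.mod (n := N) (idx := fun a => a)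
    (val := fun a => ∑ b ∈ range a with (fun _ => 0) b = (fun _ => 0) a,
      (if b < 2 ^ h then 1 else 0) * (partDeg N tl leaf b + 1))
    (by convert hM₈ using 2 with p p <;> simp [hK₇.r5, a₇]) hN (by omega) (by simp +contextual)
  have hO : ∀ p : Fin P, M₈ 17 (leaf (p % N)) = colorOffset N tl leaf (leaf (p % N)) := fun p => by
    rw [w₈ _ (hleaf _ (hmod p)), hoff _ (hL.lt _ (hmod p))]
  simp only [Expr.eval_reg, l20, hO]
  have hsub : ∀ p : Fin P, posIn leaf (p % N) - prior leaf tl (p % N) =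
      arcsBefore N tl leaf (p % N) := fun p => by
    have := arcsBefore_add_prior (leaf := leaf) hG.mono (hmod p)
    omega
  refine Ens.set_seq (T := 4) (fun p => ?_) ?_
  · have := hpos _ (hmod p)
    simp [l22, l30]; omega
  refine Ens.store_seq (T := 3) (fun p => by simpa [l23] using hvert p) fun M₉ hM₉ => ?_
  obtain ⟨w₉, -⟩ := Written.mod (n := N) (idx := fun a => a) (val := vertNum N tl leaf)
    (by convert hM₉ using 2 with p p <;> simp [hK₇.r5, l23]) hN (by omega)
    (by simp +contextual)
  refine Ens.store_seq (T := 2) (fun p => ?_) fun M₁₀ hM₁₀ => ?_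
  · have := hpos _ (hmod p)
    simp [l22]; omega
  obtain ⟨w₁₀, -⟩ := Written.mod (n := N) (idx := fun a => a) (val := posIn leaf)
    (by convert hM₁₀ using 2 with p p <;> simp [hK₇.r5, l22]) hN (by omega)
    (by simp +contextual)
  have htw : ∀ p : Fin P, tw (p % N) < N := fun p => hG.twin.lt _ (hmod p)
  have hl18 : ∀ p : Fin P, M₁₀ 18 (tw (p % N)) = vertNum N tl leaf (tw (p % N)) := fun p => by
    rw [hM₁₀.1 _ (by norm_num), w₉ _ (htw p)]
  have hl21 : ∀ p : Fin P, M₁₀ 21 (tw (p % N)) = posIn leaf (tw (p % N)) := fun p =>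
    w₁₀ _ (htw p)
  refine Ens.load_seq (T := 1) (Ens.load ⟨⟨?_, ?_, ?_, ?_, ?_, ?_, ?_, ?_, ?_, ?_⟩, ?_, ?_⟩)
  · simp [l20]
  · simp [l21]
  · simp [l22]
  · simp [l23]
  · simp [hK₇.r8, hl18]
  · simp [hK₇.r8, hl21]
  · simp [l26]
  · simp [l27]
  · simp
  · simp [l22, l30, hsub]
  · intro p r hr
    simp only [List.mem_cons, List.not_mem_nil, or_false, not_or] at hr
    simp [hr, hr₇, hr₄]
  · intro a ha
    simp only [List.mem_cons, List.not_mem_nil, or_false, not_or] at ha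
    obtain ⟨x1, x2, x3, x4, x5, x6, x7, x8, x9, x10⟩ := ha
    rw [hM₁₀.1 a x10, hM₉.1 a x9, hM₈.1 a x8, ha₇ a x6, hM₆.1 a x7, ha₅ a x5, ha₄ a x4, ha₃ a x3,
      ha₂ a x2, ha₁ a x1]

end

end PRAM

/-! ### Preparing the inputs of the base algorithm -/

namespace PRAM

open Finset

/-- Reads the input, and sets the numbers of `IsNumbered` as if there were only one part, the whole
graph; if `h` is not `0`, they are replaced. -/
def numberArcs : Stmt :=
  .load 2 0 0 ;;
  .load 3 0 1 ;;
  .load 4 0 2 ;;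
  .set 5 (.reg 0 % .reg 3) ;;
  .set 6 (.reg 0 / .reg 3 % 2) ;;
  .load 7 2 (.reg 5) ;;
  .load 8 4 (.reg 5) ;;
  .set 21 1 ;;
  .set 22 (.reg 5) ;;
  .set 23 (.reg 7) ;;
  .load 24 3 (.reg 5) ;;
  .set 25 (.reg 8) ;;
  .set 26 (.reg 3) ;;
  .set 27 (.reg 2) ;;
  .load 29 1 (.reg 7) ;;
  .set 13 (.reg 4) ;;
  .while (.reg 13) (halvingLoop ;; numberParts)

/-- Entry `i` of an array of part number `s` is stored at this address; `s` is in register `20`, and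
the number of parts in register `21`. -/
def partIdx (i : Expr) : Expr := i * .reg 21 + .reg 20

/-- Writes the adjacency lists of all parts, into arrays whose numbers are shifted by `40`, and the
table of the original numbers of the arcs, into array `20`. It also determines for every processor
its index, and the number of processors, in the run of the base algorithm on its part. -/
def writeInputs : Stmt :=
  .store 40 (partIdx 0) (.reg 27) ;;
  .store 40 (partIdx 1) (.reg 26) ;;
  .store 41 (partIdx (.reg 23)) (.reg 29) ;;
  .store 41 (partIdx (.reg 27)) (.reg 26) ;;
  .store 42 (partIdx (.reg 22)) (.reg 23) ;;
  .store 43 (partIdx (.reg 22)) (.reg 24) ;;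
  .store 44 (partIdx (.reg 22)) (.reg 25) ;;
  .store 20 (partIdx (.reg 22)) (.reg 5 + 1) ;;
  .set 40 (.reg 0 / .reg 3 * .reg 26 + .reg 22) ;;
  .set 41 (.reg 1 / .reg 3 * .reg 26)

section

variable {N n h P W : ℕ} {tl tw leaf : ℕ → ℕ}

theorem vertNum_lt {a : ℕ} (ha : a < N) : vertNum N tl leaf a < #(verts N tl leaf (leaf a)) := by
  refine card_lt_card ⟨filter_subset _ _, fun h => ?_⟩
  have := h (tl_mem_verts ha)
  simp at this

theorem vertNum_lt_iff {a b : ℕ} (ha : a < N) (h : leaf a = leaf b) :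
    vertNum N tl leaf a < vertNum N tl leaf b ↔ tl a < tl b := by
  have mono : ∀ {a b}, leaf a = leaf b → tl a ≤ tl b →
      vertNum N tl leaf a ≤ vertNum N tl leaf b := by
    intro a b h hab
    refine card_le_card fun v hv => ?_
    simp only [mem_filter] at hv ⊢
    exact ⟨by rw [← h]; exact hv.1, by omega⟩
  constructor
  · intro h'
    by_contra! hle
    exact absurd (mono h.symm hle) (by omega)
  · intro hlt
    refine card_lt_card ⟨fun v hv => ?_, fun h' => ?_⟩
    · simp only [mem_filter] at hv ⊢
      exact ⟨by rw [← h]; exact hv.1, by omega⟩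
    · have := h' (mem_filter.2 ⟨h ▸ tl_mem_verts ha, hlt⟩)
      simp at this

theorem vertNum_eq_iff {a b : ℕ} (ha : a < N) (hb : b < N) (h : leaf a = leaf b) :
    vertNum N tl leaf a = vertNum N tl leaf b ↔ tl a = tl b := by
  have h1 := vertNum_lt_iff (tl := tl) ha h
  have h2 := vertNum_lt_iff (tl := tl) hb h.symm
  omega

theorem exists_vertNum_eq {s i : ℕ} (hi : i < #(verts N tl leaf s)) :
    ∃ a < N, leaf a = s ∧ vertNum N tl leaf a = i := by
  have himg : (part N leaf s).image (vertNum N tl leaf) = range #(verts N tl leaf s) := by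
    apply eq_of_subset_of_card_le
    · intro x hx
      obtain ⟨a, ha, rfl⟩ := mem_image.1 hx
      obtain ⟨ha', rfl⟩ := mem_part.1 ha
      exact mem_range.2 (vertNum_lt ha')
    · rw [card_range]
      refine card_le_card_of_injOn (fun v => #{u ∈ verts N tl leaf s | u < v}) ?_ ?_
      · intro v hv
        obtain ⟨a, ha, rfl⟩ := mem_image.1 (mem_coe.1 hv)
        refine mem_coe.2 (mem_image.2 ⟨a, ha, ?_⟩)
        rw [vertNum, (mem_part.1 ha).2]
      · intro v hv u hu huv
        obtain ⟨a, ha, rfl⟩ := mem_image.1 (mem_coe.1 hv)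
        obtain ⟨b, hb, rfl⟩ := mem_image.1 (mem_coe.1 hu)
        obtain ⟨ha', rfl⟩ := mem_part.1 ha
        obtain ⟨hb', hs⟩ := mem_part.1 hb
        refine (vertNum_eq_iff ha' hb' hs.symm).1 ?_
        simpa only [vertNum, hs] using huv
  have := mem_range.2 hi
  rw [← himg] at this
  obtain ⟨a, ha, rfl⟩ := mem_image.1 this
  obtain ⟨ha', rfl⟩ := mem_part.1 ha
  exact ⟨a, ha', rfl, rfl⟩

theorem exists_posIn_eq {s i : ℕ} (hi : i < #(part N leaf s)) :
    ∃ a < N, leaf a = s ∧ posIn leaf a = i := by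
  have := mem_range.2 hi
  rw [← image_posIn] at this
  obtain ⟨a, ha, rfl⟩ := mem_image.1 this
  obtain ⟨ha', rfl⟩ := mem_part.1 ha
  exact ⟨a, ha', rfl, rfl⟩

theorem isLeafMap_zero : IsLeafMap N 0 tl tw fun _ => 0 :=
  ⟨by simp, by simp, fun i hi => absurd hi (by omega)⟩

theorem vertNum_zero (hG : IsArcs N n tl tw) {a : ℕ} (ha : a < N) :
    vertNum N tl (fun _ => 0) a = tl a := by
  rw [vertNum]
  convert card_range (tl a)
  ext v
  simp only [verts, part, filter_true, mem_filter, mem_image, mem_range]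
  constructor
  · exact fun h => h.2
  · exact fun h => ⟨hG.surj v (h.trans (hG.tl_lt a ha)), h⟩

theorem card_verts_zero (hG : IsArcs N n tl tw) : #(verts N tl (fun _ => 0) 0) = n := by
  convert card_range n
  ext v
  simp only [verts, part, filter_true, mem_image, mem_range]
  constructor
  · rintro ⟨a, ha, rfl⟩
    exact hG.tl_lt a ha
  · exact hG.surj v

/-- The memory holds the adjacency lists of the graph with the given arcs, and the number `h`. -/
structure IsArcInput (N n h : ℕ) (tl tw : ℕ → ℕ) (M : Memory) : Prop where
  m00 : M 0 0 = n
  m01 : M 0 1 = N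
  m02 : M 0 2 = h
  m1 : ∀ a < N, M 1 (tl a) = arcsBefore N tl (fun _ => 0) a
  m2 : ∀ a < N, M 2 a = tl a
  m3 : ∀ a < N, M 3 a = tl (tw a)
  m4 : ∀ a < N, M 4 a = tw a
  zero : ∀ a, 5 ≤ a → ∀ i, M a i = 0

theorem numberArcs_ens {M : Memory} (hG : IsArcs N n tl tw) (hM : IsArcInput N n h tl tw M)
    (hN : 0 < N) (hNP : 2 * N ≤ P) (hNW : 4 * N < W)
    (hW₁ : N * n + n < W) (hW₂ : N * (N + 1) < W) (hh : 2 ^ h ≤ N) :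
    Ens W numberArcs (17 + if h = 0 then 0 else
        (h + 1) * (9 * Nat.clog 2 (2 * N) + 21) + (42 * Nat.clog 2 (2 * N) + 59))
      M (fun (p : Fin P) r => if r = 0 then p else if r = 1 then P else 0) fun M' ρ' =>
      Knows N n h tl tw ρ' ∧
      (∃ leaf, IsLeafMap N h tl tw leaf ∧ IsNumbered N h tl tw leaf ρ') ∧
      (∀ p r, 40 ≤ r → ρ' p r = 0) ∧
      ∀ a i, a = 5 ∨ a = 20 ∨ 40 ≤ a → M' a i = 0 := by
  have hmod : ∀ p : Fin P, (p : ℕ) % N < N := fun p => Nat.mod_lt _ hN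
  obtain ⟨T, hT⟩ : ∃ T, T = if h = 0 then 0 else
        (h + 1) * (9 * Nat.clog 2 (2 * N) + 21) + (42 * Nat.clog 2 (2 * N) + 59) := ⟨_, rfl⟩
  have hhN : h < N := (Nat.lt_two_pow_self).trans_le hh
  have hnW : n < W := by omega
  have htl : ∀ p : Fin P, tl (p % N) < W := fun p => (hG.tl_lt _ (hmod p)).trans hnW
  have htw : ∀ p : Fin P, tw (p % N) < N := fun p => hG.twin.lt _ (hmod p)
  rw [← hT, show 17 + T = (T + 1) + 16 by omega]
  refine Ens.load_seq (Ens.load_seq (Ens.load_seq ?_))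
  simp only [Expr.eval_zero, Expr.eval_one, Expr.eval_two, hM.m00, hM.m01, hM.m02]
  refine Ens.set_seq (fun p => ?_) (Ens.set_seq (fun p => ?_) (Ens.load_seq (Ens.load_seq ?_)))
  · have := hmod p
    simp; omega
  · simp; omega
  simp only [Expr.eval_mod, Expr.eval_div, Expr.eval_two, Expr.eval_reg, ne_eq, Nat.reduceEqDiff,
    not_false_eq_true, Function.update_of_ne, Function.update_self, if_true, OfNat.zero_ne_ofNat,
    hM.m2 _ (hmod _), hM.m4 _ (hmod _)]
  refine Ens.set_seq (fun p => by simp; omega) (Ens.set_seq (fun p => ?_) (Ens.set_seq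
    (fun p => by simpa using htl p) (Ens.load_seq ?_)))
  · have := hmod p
    simp; omega
  simp only [Expr.eval_reg, ne_eq, Nat.reduceEqDiff,
    not_false_eq_true, Function.update_of_ne, Function.update_self, hM.m3 _ (hmod _)]
  refine Ens.set_seq (fun p => ?_) (Ens.set_seq (fun p => ?_) (Ens.set_seq (fun p => ?_)
    (Ens.load_seq (Ens.set_seq (fun p => ?_) ?_))))
  · have := htw p
    simp; omega
  · simp; omega
  · simpa using hnW
  · simp; omega
  simp only [Expr.eval_reg, ne_eq, Nat.reduceEqDiff,
    not_false_eq_true, Function.update_of_ne, Function.update_self, hM.m1 _ (hmod _)]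
  generalize hρ : (fun p : Fin P => Function.update (β := fun _ => ℕ) _ 13 h) = ρ
  have e : ∀ p r, r ∉ [2, 3, 4, 5, 6, 7, 8, 13, 21, 22, 23, 24, 25, 26, 27, 29] →
      ρ p r = if r = 0 then (p : ℕ) else if r = 1 then P else 0 := by
    intro p r hr
    simp only [List.mem_cons, List.not_mem_nil, or_false, not_or] at hr
    simp [← hρ, hr]
  have hK : Knows N n h tl tw ρ := by
    constructor <;> intro p <;> simp [← hρ]
  have h29 : ∀ p, ρ p 29 = arcsBefore N tl (fun _ => 0) (p % N) := by
    intro p; simp [← hρ]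
  have h13 : ∀ p, ρ p 13 = h := by
    intro p; simp [← hρ]
  have hone : h = 0 → IsNumbered N h tl tw (fun _ => 0) ρ := by
    rintro rfl
    constructor <;> intro p
    · rw [e p 20 (by simp)]; simp
    · simp [← hρ]
    · simp [← hρ, posIn]
    · simp [← hρ, vertNum_zero hG (hmod p)]
    · simp [← hρ, vertNum_zero hG (htw p)]
    · simp [← hρ, posIn]
    · simp [← hρ, part]
    · simp [← hρ, card_verts_zero hG]
    · rw [e p 28 (by simp)]; simp [colorOffset]
    · exact h29 p
  clear hρ
  by_cases hh0 : h = 0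
  · rw [if_pos hh0] at hT
    subst hT
    rw [show 0 + 1 = 0 * (0 + 2) + 1 by rfl]
    refine Ens.while 0 (fun _ M' ρ' => M' = M ∧ ρ' = ρ) ⟨rfl, rfl⟩ (by omega) ?_
    rintro _ _ ⟨rfl, rfl⟩
    refine ⟨fun p => by simp [h13, hh0], hK, ⟨_, ?_, hone hh0⟩, ?_, ?_⟩
    · subst hh0
      exact isLeafMap_zero
    · intro p r hr
      rw [e p r (by simp; omega), if_neg (by omega), if_neg (by omega)]
    · intro a i ha
      exact hM.zero a (by omega) i
  · rw [if_neg hh0] at hT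
    rw [show T + 1 = 1 * (((h + 1) * (9 * Nat.clog 2 (2 * N) + 21) + 8 +
      (42 * Nat.clog 2 (2 * N) + 49)) + 2) + 1 by rw [hT]; ring]
    refine Ens.while 1 (fun k M' ρ' => (k = 0 ∧ M' = M ∧ ρ' = ρ) ∨ (k = 1 ∧ (∀ p, ρ' p 13 = 0) ∧
      Knows N n h tl tw ρ' ∧
      (∃ leaf, IsLeafMap N h tl tw leaf ∧ IsNumbered N h tl tw leaf ρ') ∧
      (∀ p r, 40 ≤ r → ρ' p r = 0) ∧
      ∀ a i, a = 5 ∨ a = 20 ∨ 40 ≤ a → M' a i = 0)) (.inl ⟨rfl, rfl, rfl⟩) ?_ ?_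
    · rintro k hk _ _ (⟨-, rfl, rfl⟩ | ⟨rfl, -⟩)
      swap
      · omega
      refine ⟨fun p => by simp [h13, hh0], ?_⟩
      refine Ens.seq ((halvingLoop_ens hG hK h29 (hM.zero 6 (by norm_num)) hN hNP hNW hh).weaken
        le_rfl ?_)
      rintro M₁ ρ₁ - ⟨⟨leaf, hL, h20⟩, h21, h13', hr, ha⟩
      refine (numberParts_ens hG (hK.congr fun p r h => hr p r (by simp; omega)) hL h20 h21
        (fun a ha' i => ?_) hN hNP hNW hW₁ hW₂ hh).weaken le_rfl ?_
      · rw [ha a (by simp; omega)]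
        exact hM.zero a (by omega) i
      rintro M₂ ρ₂ - ⟨hnum, hr', ha'⟩
      refine .inr ⟨by omega, fun p => ?_, hK.congr fun p r h => ?_, ⟨leaf, hL, hnum⟩,
        fun p r h => ?_, fun a i h => ?_⟩
      · rw [hr' p 13 (by simp), h13']
      · rw [hr' p r (by simp; omega), hr p r (by simp; omega)]
      · rw [hr' p r (by simp; omega), hr p r (by simp; omega), e p r (by simp; omega),
          if_neg (by omega), if_neg (by omega)]
      · rw [ha' a (by simp; omega), ha a (by simp; omega)]
        exact hM.zero a (by omega) i
    · rintro M' ρ' (⟨h, -⟩ | ⟨-, h13, h⟩)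
      · omega
      · exact ⟨h13, h⟩

end

end PRAM

namespace PRAM

open Finset

section

variable {N n h P W : ℕ} {tl tw leaf : ℕ → ℕ}

/-- The memory holds the adjacency lists of part number `s`. -/
structure IsPartInput (N : ℕ) (tl tw leaf : ℕ → ℕ) (s : ℕ) (I : Memory) : Prop where
  i00 : I 0 0 = #(verts N tl leaf s)
  i01 : I 0 1 = #(part N leaf s)
  i0 : ∀ i, 2 ≤ i → I 0 i = 0
  i1 : ∀ a < N, leaf a = s → I 1 (vertNum N tl leaf a) = arcsBefore N tl leaf a
  i1_card : I 1 #(verts N tl leaf s) = #(part N leaf s)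
  i1_zero : ∀ i, #(verts N tl leaf s) < i → I 1 i = 0
  i2 : ∀ a < N, leaf a = s → I 2 (posIn leaf a) = vertNum N tl leaf a
  i3 : ∀ a < N, leaf a = s → I 3 (posIn leaf a) = vertNum N tl leaf (tw a)
  i4 : ∀ a < N, leaf a = s → I 4 (posIn leaf a) = posIn leaf (tw a)
  i_zero : ∀ i, #(part N leaf s) ≤ i → I 2 i = 0 ∧ I 3 i = 0 ∧ I 4 i = 0
  zero : ∀ a, 5 ≤ a → ∀ i, I a i = 0

/-- Entry `i` of the array of part `s` is stored at `i * H + s`, so that the arrays of the parts are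
interleaved and all arcs can write to the array of their own part at the same time. -/
theorem Written.part {arr H : ℕ} {f g : ℕ → ℕ} {M M' : Memory}
    (hw : Written (P := P) arr (fun p => f (p % N) * H + leaf (p % N)) (fun p => g (p % N)) M M')
    (hN : 0 < N) (hNP : N ≤ P) (hlt : ∀ a < N, leaf a < H)
    (hv : ∀ a < N, ∀ b < N, leaf a = leaf b → f a = f b → g a = g b) :
    (∀ a < N, M' arr (f a * H + leaf a) = g a) ∧
    ∀ s < H, ∀ i, (∀ a < N, leaf a = s → f a ≠ i) → M' arr (i * H + s) = M arr (i * H + s) := by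
  obtain ⟨h1, h2⟩ := Written.mod (n := N) (idx := fun a => f a * H + leaf a) (val := g) hw hN hNP
    fun a ha b hb hab => by
      obtain ⟨e1, e2⟩ := mul_add_inj (hlt a ha) (hlt b hb) hab
      exact hv a ha b hb e2 e1
  refine ⟨h1, fun s hs i hi => h2 _ fun a ha hab => ?_⟩
  obtain ⟨e1, e2⟩ := mul_add_inj hs (hlt a ha) hab
  exact hi a ha e2.symm e1.symm

/-- The state in which the simulation of the base algorithm starts. -/
structure IsReady (N h : ℕ) (tl tw leaf : ℕ → ℕ) (M : Memory) (ρ : Fin P → ℕ → ℕ) : Prop where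
  r0 : ∀ p, ρ p 0 = p
  r1 : ∀ p, ρ p 1 = P
  r3 : ∀ p, ρ p 3 = N
  r20 : ∀ p, ρ p 20 = leaf (p % N)
  r21 : ∀ p, ρ p 21 = 2 ^ h
  r28 : ∀ p, ρ p 28 = colorOffset N tl leaf (leaf (p % N))
  r40 : ∀ p, ρ p 40 = p / N * #(part N leaf (leaf (p % N))) + posIn leaf (p % N)
  r41 : ∀ p, ρ p 41 = P / N * #(part N leaf (leaf (p % N)))
  zero : ∀ p r, 42 ≤ r → ρ p r = 0
  orig : ∀ a < N, M 20 (posIn leaf a * 2 ^ h + leaf a) = a + 1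
  orig_zero : ∀ s < 2 ^ h, ∀ i, #(part N leaf s) ≤ i → M 20 (i * 2 ^ h + s) = 0
  input : ∀ s, (part N leaf s).Nonempty → ∀ I, IsPartInput N tl tw leaf s I →
    ∀ a i, M (a + 40) (i * 2 ^ h + s) = I a i

theorem writeInputs_ens {M : Memory} {ρ : Fin P → ℕ → ℕ} (hG : IsArcs N n tl tw)
    (hK : Knows N n h tl tw ρ) (hL : IsLeafMap N h tl tw leaf) (hnum : IsNumbered N h tl tw leaf ρ)
    (hr : ∀ p r, 40 ≤ r → ρ p r = 0)
    (hM : ∀ a i, a = 5 ∨ a = 20 ∨ 40 ≤ a → M a i = 0)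
    (hN : 0 < N) (hNP : 2 * N ≤ P) (hNW : 2 * P < W) (hnW : n < W) :
    Ens W writeInputs 10 M ρ fun M' ρ' => IsReady N h tl tw leaf M' ρ' := by
  have hmod : ∀ p : Fin P, (p : ℕ) % N < N := fun p => Nat.mod_lt _ hN
  have hlt := hL.lt
  have htw := hG.twin.lt
  have hpart : ∀ s, #(PRAM.part N leaf s) ≤ N := fun s => (card_filter_le _ _).trans (by simp)
  have hverts : ∀ s, #(verts N tl leaf s) < W := fun s => by
    refine lt_of_le_of_lt ?_ hnW
    refine (card_le_card (t := range n) fun v hv => ?_).trans (by simp)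
    obtain ⟨a, ha, rfl⟩ := mem_image.1 hv
    exact mem_range.2 (hG.tl_lt a (mem_part.1 ha).1)
  have hvn : ∀ a < N, vertNum N tl leaf a < W := fun a ha => (vertNum_lt ha).trans (hverts _)
  have hpos : ∀ a < N, posIn leaf a < N := fun a ha => (posIn_lt ha).trans_le (hpart _)
  have hbef : ∀ a, arcsBefore N tl leaf a ≤ N := fun a => (card_filter_le _ _).trans (hpart _)
  have hpi : ∀ a < N, ∀ b < N, leaf a = leaf b → posIn leaf a = posIn leaf b → a = b :=
    fun a _ b _ h h' => posIn_inj h h'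
  refine Ens.store_seq (fun p => by simpa [hnum.r27] using hverts _) fun M₁ h₁ => ?_
  obtain ⟨w₁, w₁'⟩ := Written.part (f := fun _ => 0) (H := 2 ^ h) (leaf := leaf)
    (g := fun a => #(verts N tl leaf (leaf a)))
    (by convert h₁ using 2 with p p <;> simp [partIdx, hnum.r20, hnum.r27]) hN (by omega) hlt
    (fun a _ b _ h _ => by rw [h])
  refine Ens.store_seq (fun p => ?_) fun M₂ h₂ => ?_
  · have := hpart (leaf (p % N))
    simp [hnum.r26]; omega
  obtain ⟨w₂, w₂'⟩ := Written.part (f := fun _ => 1) (H := 2 ^ h) (leaf := leaf)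
    (g := fun a => #(PRAM.part N leaf (leaf a)))
    (by convert h₂ using 2 with p p <;> simp [partIdx, hnum.r20, hnum.r21, hnum.r26])
    hN (by omega) hlt (fun a _ b _ h _ => by rw [h])
  refine Ens.store_seq (fun p => ?_) fun M₃ h₃ => ?_
  · have := hbef (p % N)
    simp [hnum.r29]; omega
  obtain ⟨w₃, w₃'⟩ := Written.part (f := vertNum N tl leaf) (H := 2 ^ h) (leaf := leaf)
    (g := arcsBefore N tl leaf)
    (by convert h₃ using 2 with p p <;> simp [partIdx, hnum.r20, hnum.r21, hnum.r23, hnum.r29])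
    hN (by omega) hlt (fun a ha b hb h h' => by
      have := (vertNum_eq_iff ha hb h).1 h'
      rw [arcsBefore, arcsBefore, h, this])
  refine Ens.store_seq (fun p => ?_) fun M₄ h₄ => ?_
  · have := hpart (leaf (p % N))
    simp [hnum.r26]; omega
  obtain ⟨w₄, w₄'⟩ := Written.part (f := fun a => #(verts N tl leaf (leaf a))) (H := 2 ^ h)
    (leaf := leaf) (g := fun a => #(PRAM.part N leaf (leaf a)))
    (by convert h₄ using 2 with p p <;> simp [partIdx, hnum.r20, hnum.r21, hnum.r26, hnum.r27])
    hN (by omega) hlt (fun a _ b _ h _ => by rw [h])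
  refine Ens.store_seq (fun p => by simpa [hnum.r23] using hvn _ (hmod p)) fun M₅ h₅ => ?_
  obtain ⟨w₅, w₅'⟩ := Written.part (f := posIn leaf) (H := 2 ^ h)
    (leaf := leaf) (g := vertNum N tl leaf)
    (by convert h₅ using 2 with p p <;> simp [partIdx, hnum.r20, hnum.r21, hnum.r22, hnum.r23])
    hN (by omega) hlt (fun a ha b hb h h' => by rw [hpi a ha b hb h h'])
  refine Ens.store_seq (fun p => by simpa [hnum.r24] using hvn _ (htw _ (hmod p)))
    fun M₆ h₆ => ?_
  obtain ⟨w₆, w₆'⟩ := Written.part (f := posIn leaf) (H := 2 ^ h)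
    (leaf := leaf) (g := fun a => vertNum N tl leaf (tw a))
    (by convert h₆ using 2 with p p <;> simp [partIdx, hnum.r20, hnum.r21, hnum.r22, hnum.r24])
    hN (by omega) hlt (fun a ha b hb h h' => by rw [hpi a ha b hb h h'])
  refine Ens.store_seq (fun p => ?_) fun M₇ h₇ => ?_
  · have := hpos _ (htw _ (hmod p))
    simp [hnum.r25]; omega
  obtain ⟨w₇, w₇'⟩ := Written.part (f := posIn leaf) (H := 2 ^ h)
    (leaf := leaf) (g := fun a => posIn leaf (tw a))
    (by convert h₇ using 2 with p p <;> simp [partIdx, hnum.r20, hnum.r21, hnum.r22, hnum.r25])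
    hN (by omega) hlt (fun a ha b hb h h' => by rw [hpi a ha b hb h h'])
  refine Ens.store_seq (fun p => ?_) fun M₈ h₈ => ?_
  · have := hmod p
    simp [hK.r5]; omega
  obtain ⟨w₈, w₈'⟩ := Written.part (f := posIn leaf) (H := 2 ^ h)
    (leaf := leaf) (g := fun a => a + 1)
    (by convert h₈ using 2 with p p <;> simp [partIdx, hnum.r20, hnum.r21, hnum.r22, hK.r5])
    hN (by omega) hlt (fun a ha b hb h h' => by rw [hpi a ha b hb h h'])
  refine Ens.set_seq (T := 1) (fun p => ?_) (Ens.set (fun p => ?_) ?_)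
  · have h1 := Nat.mul_le_mul_left (p / N) (hpart (leaf (p % N)))
    have h2 := Nat.div_mul_le_self p N
    have h3 := hpos _ (hmod p)
    simp [hK.r0, hK.r3, hnum.r26, hnum.r22]
    omega
  · have h1 := Nat.mul_le_mul_left (P / N) (hpart (leaf (p % N)))
    have h2 := Nat.div_mul_le_self P N
    simp [hK.r1, hK.r3, hnum.r26]
    omega
  have hz : ∀ s i, #(PRAM.part N leaf s) ≤ i → ∀ a < N, leaf a = s → posIn leaf a ≠ i := by
    rintro s i hi a ha rfl rfl
    exact absurd (posIn_lt (leaf := leaf) ha) (by omega)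
  refine ⟨?_, ?_, ?_, ?_, ?_, ?_, ?_, ?_, ?_, w₈, fun s hs i hi => ?_, ?_⟩
  · simp [hK.r0]
  · simp [hK.r1]
  · simp [hK.r3]
  · simp [hnum.r20]
  · simp [hnum.r21]
  · simp [hnum.r28]
  · simp [hnum.r26, hnum.r22, hK.r0, hK.r3]
  · simp [hnum.r26, hK.r1, hK.r3]
  · intro p r h
    rw [Function.update_of_ne (by omega), Function.update_of_ne (by omega), hr p r (by omega)]
  · rw [w₈' s hs i (hz s i hi), h₇.1 _ (by norm_num), h₆.1 _ (by norm_num), h₅.1 _ (by norm_num),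
      h₄.1 _ (by norm_num), h₃.1 _ (by norm_num), h₂.1 _ (by norm_num), h₁.1 _ (by norm_num),
      hM _ _ (by norm_num)]
  · intro s ⟨a₀, hm₀⟩ I hI a i
    obtain ⟨ha₀, rfl⟩ := mem_part.1 hm₀
    have hs := hlt a₀ ha₀
    have f0 : ∀ x, M₈ 40 x = M₂ 40 x := fun x => by
      rw [h₈.1 _ (by norm_num), h₇.1 _ (by norm_num), h₆.1 _ (by norm_num), h₅.1 _ (by norm_num),
        h₄.1 _ (by norm_num), h₃.1 _ (by norm_num)]
    have f1 : ∀ x, M₈ 41 x = M₄ 41 x := fun x => by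
      rw [h₈.1 _ (by norm_num), h₇.1 _ (by norm_num), h₆.1 _ (by norm_num), h₅.1 _ (by norm_num)]
    have g1 : ∀ x, M₂ 41 x = 0 := fun x => by
      rw [h₂.1 _ (by norm_num), h₁.1 _ (by norm_num), hM _ _ (by norm_num)]
    have f2 : ∀ x, M₈ 42 x = M₅ 42 x := fun x => by
      rw [h₈.1 _ (by norm_num), h₇.1 _ (by norm_num), h₆.1 _ (by norm_num)]
    have g2 : ∀ x, M₄ 42 x = 0 := fun x => by
      rw [h₄.1 _ (by norm_num), h₃.1 _ (by norm_num), h₂.1 _ (by norm_num), h₁.1 _ (by norm_num),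
        hM _ _ (by norm_num)]
    have f3 : ∀ x, M₈ 43 x = M₆ 43 x := fun x => by
      rw [h₈.1 _ (by norm_num), h₇.1 _ (by norm_num)]
    have g3 : ∀ x, M₅ 43 x = 0 := fun x => by
      rw [h₅.1 _ (by norm_num), h₄.1 _ (by norm_num), h₃.1 _ (by norm_num), h₂.1 _ (by norm_num),
        h₁.1 _ (by norm_num), hM _ _ (by norm_num)]
    have f4 : ∀ x, M₈ 44 x = M₇ 44 x := fun x => by
      rw [h₈.1 _ (by norm_num)]
    have g4 : ∀ x, M₆ 44 x = 0 := fun x => by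
      rw [h₆.1 _ (by norm_num), h₅.1 _ (by norm_num), h₄.1 _ (by norm_num), h₃.1 _ (by norm_num),
        h₂.1 _ (by norm_num), h₁.1 _ (by norm_num), hM _ _ (by norm_num)]
    obtain rfl | rfl | rfl | rfl | rfl | ha :
      a = 0 ∨ a = 1 ∨ a = 2 ∨ a = 3 ∨ a = 4 ∨ 5 ≤ a := by omega
    · simp only [Nat.zero_add, f0]
      obtain rfl | rfl | hi : i = 0 ∨ i = 1 ∨ 2 ≤ i := by omega
      · rw [w₂' _ hs 0 (by simp), w₁ a₀ ha₀, hI.i00]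
      · rw [w₂ a₀ ha₀, hI.i01]
      · rw [w₂' _ hs i (by omega), w₁' _ hs i (by omega), hM _ _ (by norm_num), hI.i0 i hi]
    · simp only [Nat.reduceAdd, f1]
      obtain hi | rfl | hi := lt_trichotomy i #(verts N tl leaf (leaf a₀))
      · obtain ⟨b, hb, hbl, rfl⟩ := exists_vertNum_eq hi
        rw [w₄' _ hs _ fun c _ hc => by rw [hc]; omega, ← hbl, w₃ b hb, hI.i1 b hb hbl]
      · rw [w₄ a₀ ha₀, hI.i1_card]
      · rw [w₄' _ hs _ fun c _ hc => by rw [hc]; omega, w₃' _ hs _ fun c hc hc' => ?_, g1,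
          hI.i1_zero i hi]
        have := vertNum_lt (tl := tl) (leaf := leaf) hc
        rw [hc'] at this
        omega
    · simp only [Nat.reduceAdd, f2]
      rcases lt_or_ge i #(PRAM.part N leaf (leaf a₀)) with hi | hi
      · obtain ⟨b, hb, hbl, rfl⟩ := exists_posIn_eq hi
        rw [← hbl, w₅ b hb, hI.i2 b hb hbl]
      · rw [w₅' _ hs _ (hz _ _ hi), g2, (hI.i_zero i hi).1]
    · simp only [Nat.reduceAdd, f3]
      rcases lt_or_ge i #(PRAM.part N leaf (leaf a₀)) with hi | hi
      · obtain ⟨b, hb, hbl, rfl⟩ := exists_posIn_eq hi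
        rw [← hbl, w₆ b hb, hI.i3 b hb hbl]
      · rw [w₆' _ hs _ (hz _ _ hi), g3, (hI.i_zero i hi).2.1]
    · simp only [Nat.reduceAdd, f4]
      rcases lt_or_ge i #(PRAM.part N leaf (leaf a₀)) with hi | hi
      · obtain ⟨b, hb, hbl, rfl⟩ := exists_posIn_eq hi
        rw [← hbl, w₇ b hb, hI.i4 b hb hbl]
      · rw [w₇' _ hs _ (hz _ _ hi), g4, (hI.i_zero i hi).2.2]
    · rw [h₈.1 _ (by omega), h₇.1 _ (by omega), h₆.1 _ (by omega), h₅.1 _ (by omega),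
        h₄.1 _ (by omega), h₃.1 _ (by omega), h₂.1 _ (by omega), h₁.1 _ (by omega),
        hM _ _ (by omega), hI.zero a ha]

end

end PRAM

/-! ### Simulating the base algorithm on all parts at once -/

namespace PRAM

/-- The expression that refers to register `r + 40` instead of register `r`. -/
def Expr.shift : Expr → Expr
  | .const c => .const c
  | .reg r => .reg (r + 40)
  | .op o e f => .op o e.shift f.shift

theorem Expr.eval_shift (e : Expr) (ρ : ℕ → ℕ) : e.shift.eval ρ = e.eval fun r => ρ (r + 40) := by
  induction e with
  | const c => rfl
  | reg r => rfl
  | op o e f he hf => simp only [Expr.shift, Expr.eval, he, hf]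

/-- Four instructions that simulate one instruction of the base algorithm, whose code of length `L`
is simulated from instruction number `b` on. The first one performs the read or the write. After a
write, all processors that took part in it read the value that was actually written, and if it
belongs to the output, then the color is copied, with the offset of the palette, to the output
array, at the original number of the arc. A jump takes place in the last instruction. -/
def simInstr (b L : ℕ) : Instr → List Instr
  | .set r e => [.set (r + 40) e.shift, .set 18 0, .set 18 0, .set 18 0]
  | .load r arr idx => [.load (r + 40) (arr + 40) (partIdx idx.shift), .set 18 0, .set 18 0,
      .set 18 0]
  | .store arr idx val => [.store (arr + 40) (partIdx idx.shift) val.shift,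
      .load 18 (arr + 40) (partIdx idx.shift), .load 19 20 (partIdx idx.shift),
      .store (if arr = 5 then 5 else 19) (.reg 19 - 1 + .eq (.reg 19) 0 * .reg 3)
        (.reg 18 + .reg 28)]
  | .jump c t => [.set 18 0, .set 18 0, .set 18 0, .jump c.shift (b + 4 * min t L)]

/-- The code that simulates the program `A`. -/
def simCode (b : ℕ) (A : Program) : List Instr := A.flatMap (simInstr b A.length)

theorem length_simInstr (b L : ℕ) (I : Instr) : (simInstr b L I).length = 4 := by
  cases I <;> rfl

theorem length_flatMap_simInstr (b L : ℕ) (A : Program) :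
    (A.flatMap (simInstr b L)).length = 4 * A.length := by
  induction A with
  | nil => rfl
  | cons I A ih => simp [length_simInstr, ih]; ring

theorem getElem?_flatMap_simInstr (b L : ℕ) (A : Program) (k j : ℕ) (hj : j < 4) :
    (A.flatMap (simInstr b L))[4 * k + j]? = A[k]?.bind fun I => (simInstr b L I)[j]? := by
  induction A generalizing k with
  | nil => simp
  | cons I A ih =>
    rw [List.flatMap_cons]
    rcases k with _ | k
    · rw [List.getElem?_append_left (by rw [length_simInstr]; omega)]
      simp
    · rw [List.getElem?_append_right (by rw [length_simInstr]; omega), length_simInstr,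
        show 4 * (k + 1) + j - 4 = 4 * k + j by omega, ih]
      simp

/-- The distribution of the processors among the parts, and what depends on it: `part p` and `idx p`
are the part of processor `p` and its index there, `num s` is the number of processors and `off s`
the color offset of part `s`. `tab` is the table of the original numbers of the arcs (plus `1`). -/
structure Assignment (P : ℕ) where
  H : ℕ
  N : ℕ
  act : Fin P → Prop
  part : Fin P → ℕ
  idx : Fin P → ℕ
  num : ℕ → ℕ
  off : ℕ → ℕ
  tab : ℕ → ℕ
  part_lt : ∀ p, part p < H
  idx_lt : ∀ p, act p → idx p < num (part p)
  surj : ∀ s l, l < num s → ∃ p, act p ∧ part p = s ∧ idx p = l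
  tab_le : ∀ x, tab x ≤ N
  tab_inj : ∀ x y, tab x = tab y → tab x ≠ 0 → x = y

section

variable {P : ℕ} (S : Assignment P) (A B : Program) (b : ℕ)

/-- The part of the invariant that does not depend on the phase within a simulated step. -/
structure SimBase (cs : ∀ s, Config (S.num s)) (c : Config P) : Prop where
  r3 : ∀ p, (c.proc p).reg 3 = S.N
  r20 : ∀ p, (c.proc p).reg 20 = S.part p
  r21 : ∀ p, (c.proc p).reg 21 = S.H
  r28 : ∀ p, (c.proc p).reg 28 = S.off (S.part p)
  idle : ∀ p, ¬ S.act p → (c.proc p).pc = b + 4 * A.length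
  tab : ∀ x, c.mem 20 x = S.tab x
  mirror : ∀ s, 0 < S.num s → ∀ i o, S.tab (i * S.H + s) = o + 1 →
    (cs s).mem 5 i = 0 ∨ c.mem 5 o = (cs s).mem 5 i + S.off s

/-- The configuration `c` of the simulating program represents the configurations `cs` of the runs
of `A` on the parts. -/
structure Simulates (cs : ∀ s, Config (S.num s)) (c : Config P) : Prop where
  base : SimBase S A b cs c
  pc : ∀ p, S.act p → ∀ l : Fin (S.num (S.part p)), l = S.idx p →
    (c.proc p).pc = b + 4 * min ((cs _).proc l).pc A.length
  reg : ∀ p, S.act p → ∀ l : Fin (S.num (S.part p)), l = S.idx p →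
    ∀ r, (c.proc p).reg (r + 40) = ((cs _).proc l).reg r
  mem : ∀ s, 0 < S.num s → ∀ a i, c.mem (a + 40) (i * S.H + s) = (cs s).mem a i

/-- After `j` of the four instructions that simulate a step from `cs` to `cs'`. -/
structure Midway (cs cs' : ∀ s, Config (S.num s)) (j : ℕ) (c : Config P) : Prop where
  base : SimBase S A b cs c
  pc : ∀ p, S.act p → ∀ l : Fin (S.num (S.part p)), l = S.idx p →
    (c.proc p).pc = b + 4 * min ((cs _).proc l).pc A.length +
      if ((cs _).proc l).pc < A.length then j else 0
  reg : ∀ p, S.act p → ∀ l : Fin (S.num (S.part p)), l = S.idx p →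
    ∀ r, (c.proc p).reg (r + 40) = ((cs' _).proc l).reg r
  mem : ∀ s, 0 < S.num s → ∀ a i, c.mem (a + 40) (i * S.H + s) = (cs' s).mem a i
  step : ∀ s, 0 < S.num s → Step A (cs s) (cs' s)
  r18 : 2 ≤ j → ∀ p, S.act p → ∀ l : Fin (S.num (S.part p)), l = S.idx p → ∀ arr e v,
    A[((cs (S.part p)).proc l).pc]? = some (.store arr e v) →
    (c.proc p).reg 18 = (cs' (S.part p)).mem arr (e.eval ((cs (S.part p)).proc l).reg)
  r19 : 3 ≤ j → ∀ p, S.act p → ∀ l : Fin (S.num (S.part p)), l = S.idx p → ∀ arr e v,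
    A[((cs (S.part p)).proc l).pc]? = some (.store arr e v) →
    (c.proc p).reg 19 = S.tab (e.eval ((cs (S.part p)).proc l).reg * S.H + S.part p)

variable {S A B b}

/-- `B` contains the code that simulates `A`, from instruction number `b` to the end. -/
structure SimAt (A B : Program) (b : ℕ) : Prop where
  length : B.length = b + 4 * A.length
  get : ∀ k j, j < 4 → B[b + (4 * k + j)]? = A[k]?.bind fun I => (simInstr b A.length I)[j]?

theorem SimAt.next_of_end (hB : SimAt A B b) (M : Memory) {p : Proc}
    (hp : p.pc = b + 4 * A.length) : p.next B M = p := by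
  have : B[p.pc]? = none := List.getElem?_eq_none (by rw [hB.length, hp])
  simp [Proc.next, this]

theorem SimAt.not_writes_of_end (hB : SimAt A B b) {p : Proc}
    (hp : p.pc = b + 4 * A.length) (a i x : ℕ) : ¬ p.Writes B a i x := by
  have : B[p.pc]? = none := List.getElem?_eq_none (by rw [hB.length, hp])
  simp [Proc.Writes, this]

theorem Proc.next_of_halted {p : Proc} (M : Memory) (hp : A.length ≤ p.pc) : p.next A M = p := by
  have : A[p.pc]? = none := List.getElem?_eq_none hp
  simp [Proc.next, this]

theorem Proc.not_writes_of_halted {p : Proc} (hp : A.length ≤ p.pc) (a i x : ℕ) :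
    ¬ p.Writes A a i x := by
  have : A[p.pc]? = none := List.getElem?_eq_none hp
  simp [Proc.Writes, this]

/-- The configurations of the parts after the simulated step that starts with a step of the
simulating program to the memory `M`. -/
def partStep (S : Assignment P) (A : Program) (cs : ∀ s, Config (S.num s)) (M : Memory) (s : ℕ) :
    Config (S.num s) :=
  ⟨fun a i => M (a + 40) (i * S.H + s), fun l => ((cs s).proc l).next A (cs s).mem⟩

theorem part_addr_inj {s s' i i' : ℕ} (hs : s < S.H) (hs' : s' < S.H)
    (h : i * S.H + s = i' * S.H + s') : i = i' ∧ s = s' :=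
  mul_add_inj hs hs' h

theorem num_part_lt {s : ℕ} (hs : 0 < S.num s) : s < S.H := by
  obtain ⟨p, -, rfl, -⟩ := S.surj s 0 hs
  exact S.part_lt p

/-- The first instruction performs the simulated step. -/
theorem Simulates.first {cs : ∀ s, Config (S.num s)} {c c' : Config P} (hB : SimAt A B b)
    (h : Simulates S A b cs c) (hs : Step B c c') :
    Midway S A b cs (partStep S A cs c'.mem) 1 c' ∧
      ∀ W, (∀ s, 0 < S.num s → (partStep S A cs c'.mem s).WordsBelow W) → c.WordsBelow W →
        c'.WordsBelow W := by
  obtain ⟨hp, hm⟩ := hs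
  -- what an active processor does
  have key : ∀ p, S.act p → ∀ l : Fin (S.num (S.part p)), l = S.idx p →
      (c'.proc p).pc = b + 4 * min ((cs _).proc l).pc A.length +
        (if ((cs _).proc l).pc < A.length then 1 else 0) ∧
      (∀ r, (c'.proc p).reg (r + 40) =
        (((cs (S.part p)).proc l).next A (cs (S.part p)).mem).reg r) ∧
      (∀ r < 40, r ≠ 18 → (c'.proc p).reg r = (c.proc p).reg r) ∧
      ((c'.proc p).reg 18 = (c.proc p).reg 18 ∨ (c'.proc p).reg 18 = 0) ∧
      (∀ a i x, (c.proc p).Writes B a i x ↔ ∃ a' i', a = a' + 40 ∧ i = i' * S.H + S.part p ∧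
        ((cs _).proc l).Writes A a' i' x) := by
    intro p ha l hl
    rw [hp p]
    have hpc := h.pc p ha l hl
    have hreg := h.reg p ha l hl
    have hnum : 0 < S.num (S.part p) := (Nat.zero_le _).trans_lt (S.idx_lt p ha)
    have hmem := h.mem _ hnum
    have h20 := h.base.r20 p
    have h21 := h.base.r21 p
    generalize (cs (S.part p)).mem = m at hmem
    generalize (cs (S.part p)).proc l = q at hpc hreg
    generalize c.proc p = u at hpc hreg h20 h21
    have hsh : ∀ e : Expr, e.shift.eval u.reg = e.eval q.reg := fun e => by
      rw [Expr.eval_shift]; congr 1; funext r; exact hreg r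
    have hidx : ∀ e : Expr, (partIdx e.shift).eval u.reg = e.eval q.reg * S.H + S.part p := by
      intro e; simp [partIdx, hsh, h20, h21]
    by_cases hlt : q.pc < A.length
    · rw [min_eq_left hlt.le] at hpc ⊢
      obtain ⟨I, hI⟩ : ∃ I, A[q.pc]? = some I := ⟨_, List.getElem?_eq_getElem hlt⟩
      have hg := hB.get q.pc 0 (by norm_num)
      rw [Nat.add_zero, ← hpc, hI] at hg
      simp only [hlt, if_true, Proc.next, Proc.Writes, hI]
      rcases I with ⟨r, e⟩ | ⟨r, arr, e⟩ | ⟨arr, e, v⟩ | ⟨e, t⟩ <;>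
        simp only [simInstr, Option.bind_some, List.getElem?_cons_zero] at hg <;>
        simp only [hg] <;> simp only [hpc, hsh, hidx, hmem]
      · refine ⟨trivial, fun r' => ?_, fun r' h1 h2 => ?_, .inl ?_, by simp⟩
        · simp [Function.update_apply, hreg]
        · rw [Function.update_of_ne (by omega)]
        · rw [Function.update_of_ne (by omega)]
      · refine ⟨trivial, fun r' => ?_, fun r' h1 h2 => ?_, .inl ?_, by simp⟩
        · simp [Function.update_apply, hreg]
        · rw [Function.update_of_ne (by omega)]
        · rw [Function.update_of_ne (by omega)]
      · refine ⟨trivial, hreg, by simp, by simp, fun a i x => ?_⟩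
        simp only [Option.some.injEq, Instr.store.injEq]
        constructor
        · rintro ⟨idx, val, ⟨rfl, rfl, rfl⟩, rfl, rfl⟩
          exact ⟨arr, _, rfl, hidx e, e, v, ⟨rfl, rfl, rfl⟩, rfl, hsh v⟩
        · rintro ⟨a', i', rfl, rfl, idx, val, ⟨rfl, rfl, rfl⟩, rfl, rfl⟩
          exact ⟨_, _, ⟨rfl, rfl, rfl⟩, (hidx e).symm, (hsh v).symm⟩
      · refine ⟨trivial, fun r' => ?_, fun r' h1 h2 => ?_, .inr ?_, by simp⟩
        · rw [Function.update_of_ne (by omega), hreg]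
        · rw [Function.update_of_ne (by omega)]
        · simp
    · have hle := not_lt.1 hlt
      rw [min_eq_right hle] at hpc ⊢
      rw [hB.next_of_end _ hpc, Proc.next_of_halted _ hle]
      refine ⟨by simp [hlt, hpc], hreg, fun _ _ _ => rfl, .inl rfl, fun a i x => ⟨fun h => ?_, ?_⟩⟩
      · exact absurd h (hB.not_writes_of_end hpc a i x)
      · rintro ⟨a', i', -, -, h⟩
        exact absurd h (Proc.not_writes_of_halted hle a' i' x)
  have hidle : ∀ p, ¬ S.act p → c'.proc p = c.proc p ∧ ∀ a i x, ¬ (c.proc p).Writes B a i x :=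
    fun p ha => ⟨by rw [hp p, hB.next_of_end _ (h.base.idle p ha)],
      hB.not_writes_of_end (h.base.idle p ha)⟩
  have hregs : ∀ p, ∀ r < 40, r ≠ 18 → (c'.proc p).reg r = (c.proc p).reg r := by
    intro p
    by_cases ha : S.act p
    · exact (key p ha ⟨_, S.idx_lt p ha⟩ rfl).2.2.1
    · rw [(hidle p ha).1]
      exact fun _ _ _ => rfl
  have hwr : ∀ a i, (∃ p, S.act p ∧ ∃ a' i', a = a' + 40 ∧ i = i' * S.H + S.part p) ∨
      c'.mem a i = c.mem a i := by
    intro a i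
    rcases hm a i with ⟨p, hw⟩ | h'
    · by_cases hact : S.act p
      · obtain ⟨a', i', h1, h2, -⟩ := ((key p hact ⟨_, S.idx_lt p hact⟩ rfl).2.2.2.2 _ _ _).1 hw
        exact .inl ⟨p, hact, a', i', h1, h2⟩
      · exact absurd hw ((hidle p hact).2 _ _ _)
    · exact .inr h'.2
  have hlow : ∀ a < 40, ∀ i, c'.mem a i = c.mem a i := by
    intro a ha i
    rcases hwr a i with ⟨p, -, a', i', rfl, -⟩ | h'
    · omega
    · exact h'
  refine ⟨⟨⟨?_, ?_, ?_, ?_, ?_, ?_, ?_⟩,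
    fun p ha l hl => (key p ha l hl).1, fun p ha l hl => (key p ha l hl).2.1,
    fun s hs a i => rfl, fun s hs0 => ⟨fun l => rfl, fun a i => ?_⟩, by omega, by omega⟩, ?_⟩
  · intro p; rw [hregs p 3 (by norm_num) (by norm_num), h.base.r3]
  · intro p; rw [hregs p 20 (by norm_num) (by norm_num), h.base.r20]
  · intro p; rw [hregs p 21 (by norm_num) (by norm_num), h.base.r21]
  · intro p; rw [hregs p 28 (by norm_num) (by norm_num), h.base.r28]
  · intro p ha; rw [(hidle p ha).1, h.base.idle p ha]
  · intro x; rw [hlow 20 (by norm_num), h.base.tab]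
  · intro s hs i o ho; rw [hlow 5 (by norm_num)]; exact h.base.mirror s hs i o ho
  · simp only [partStep]
    rcases hm (a + 40) (i * S.H + s) with ⟨p, hw⟩ | ⟨h1, h2⟩
    · left
      by_cases hact : S.act p
      · obtain ⟨a', i', h3, h4, h5⟩ := ((key p hact ⟨_, S.idx_lt p hact⟩ rfl).2.2.2.2 _ _ _).1 hw
        obtain ⟨rfl, rfl⟩ := part_addr_inj (num_part_lt hs0) (S.part_lt p) h4
        obtain rfl : a = a' := by omega
        exact ⟨_, h5⟩
      · exact absurd hw ((hidle p hact).2 _ _ _)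
    · right
      refine ⟨fun l x hx => ?_, by rw [h2, h.mem s hs0]⟩
      obtain ⟨p, hact, rfl, hidx⟩ := S.surj s l l.2
      exact h1 p x (((key p hact l hidx.symm).2.2.2.2 _ _ _).2 ⟨a, i, rfl, rfl, hx⟩)
  · refine fun W hW hc => ⟨fun a i => ?_, fun p r => ?_⟩
    · rcases hwr a i with ⟨p, hact, a', i', rfl, rfl⟩ | h'
      · exact (hW (S.part p) ((Nat.zero_le _).trans_lt (S.idx_lt p hact))).1 a' i'
      · rw [h']; exact hc.1 a i
    · have h0 : 0 < W := (Nat.zero_le _).trans_lt (hc.1 0 0)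
      by_cases ha : S.act p
      · obtain ⟨-, k1, k2, k3, -⟩ := key p ha ⟨_, S.idx_lt p ha⟩ rfl
        by_cases hr : r < 40
        · by_cases h18 : r = 18
          · subst h18
            rcases k3 with k3 | k3 <;> rw [k3]
            · exact hc.2 p 18
            · exact h0
          · rw [k2 r hr h18]; exact hc.2 p r
        · obtain ⟨r, rfl⟩ := Nat.exists_eq_add_of_le' (not_lt.1 hr)
          rw [k1 r]
          exact (hW (S.part p) ((Nat.zero_le _).trans_lt (S.idx_lt p ha))).2 _ r
      · rw [(hidle p ha).1]; exact hc.2 p r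

/-- The second and the third instruction write nothing. -/
theorem Midway.middle {cs cs' : ∀ s, Config (S.num s)} {c c' : Config P} (hB : SimAt A B b)
    {j : ℕ} (hj : j = 1 ∨ j = 2) (h : Midway S A b cs cs' j c) (hs : Step B c c') :
    Midway S A b cs cs' (j + 1) c' ∧ ∀ W, c.WordsBelow W → c'.WordsBelow W := by
  obtain ⟨hp, hm⟩ := hs
  have key : ∀ p, S.act p → ∀ l : Fin (S.num (S.part p)), l = S.idx p →
      (c'.proc p).pc = b + 4 * min ((cs _).proc l).pc A.length +
        (if ((cs _).proc l).pc < A.length then j + 1 else 0) ∧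
      (∀ r, r ≠ 18 → r ≠ 19 → (c'.proc p).reg r = (c.proc p).reg r) ∧
      (∀ a i x, ¬ (c.proc p).Writes B a i x) ∧
      (∀ r, (c'.proc p).reg r = (c.proc p).reg r ∨ (c'.proc p).reg r = 0 ∨
        ∃ a i, (c'.proc p).reg r = c.mem a i) ∧
      ∀ arr e v, A[((cs (S.part p)).proc l).pc]? = some (.store arr e v) →
        (c'.proc p).reg 18 = (cs' (S.part p)).mem arr (e.eval ((cs (S.part p)).proc l).reg) ∧
        (j = 2 → (c'.proc p).reg 19 =
          S.tab (e.eval ((cs (S.part p)).proc l).reg * S.H + S.part p)) := by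
    intro p ha l hl
    rw [hp p]
    have hpc := h.pc p ha l hl
    have hnum : 0 < S.num (S.part p) := (Nat.zero_le _).trans_lt (S.idx_lt p ha)
    have hmem := h.mem _ hnum
    have h20 := h.base.r20 p
    have h21 := h.base.r21 p
    have h18 := fun h2 => h.r18 h2 p ha l hl
    have htab := h.base.tab
    by_cases hlt : ((cs (S.part p)).proc l).pc < A.length
    · rw [min_eq_left hlt.le] at hpc ⊢
      obtain ⟨I, hI⟩ : ∃ I, A[((cs (S.part p)).proc l).pc]? = some I :=
        ⟨_, List.getElem?_eq_getElem hlt⟩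
      have hg := hB.get ((cs (S.part p)).proc l).pc j (by omega)
      rw [if_pos hlt] at hpc
      rw [← add_assoc, ← hpc, hI] at hg
      have hreg := h.reg p ha l hl
      -- a write leaves the registers unchanged, so that the address can be computed again
      have hstore : ∀ arr e v, A[((cs (S.part p)).proc l).pc]? = some (.store arr e v) →
          (partIdx e.shift).eval (c.proc p).reg =
            e.eval ((cs (S.part p)).proc l).reg * S.H + S.part p := by
        intro arr e v he
        have : (fun r => (c.proc p).reg (r + 40)) = ((cs (S.part p)).proc l).reg := by
          funext r
          rw [hreg r, (h.step _ hnum).1 l]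
          simp [Proc.next, he]
        simp [partIdx, Expr.eval_shift, this, h20, h21]
      simp only [hlt, if_true, Proc.next, Proc.Writes]
      rw [hI] at h18 ⊢
      rcases I with ⟨r, e⟩ | ⟨r, arr, e⟩ | ⟨arr, e, v⟩ | ⟨e, t⟩ <;> obtain rfl | rfl := hj <;>
        simp only [simInstr, Option.bind_some, List.getElem?_cons_zero,
          List.getElem?_cons_succ] at hg <;>
        simp only [hg] <;> simp only [hpc]
      case store.inl =>
        have hidx := hstore arr e v hI
        refine ⟨trivial, fun r' h1 h2 => ?_, by simp, fun r' => ?_, ?_⟩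
        · rw [Function.update_of_ne h1]
        · rw [Function.update_apply]
          split_ifs
          · exact .inr (.inr ⟨_, _, rfl⟩)
          · exact .inl rfl
        · simp only [Option.some.injEq, Instr.store.injEq]
          rintro arr e v ⟨rfl, rfl, rfl⟩
          simp [hidx, hmem]
      case store.inr =>
        have hidx := hstore arr e v hI
        refine ⟨trivial, fun r' h1 h2 => ?_, by simp, fun r' => ?_, ?_⟩
        · rw [Function.update_of_ne h2]
        · rw [Function.update_apply]
          split_ifs
          · exact .inr (.inr ⟨_, _, rfl⟩)
          · exact .inl rfl
        · simp only [Option.some.injEq, Instr.store.injEq]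
          rintro arr e v ⟨rfl, rfl, rfl⟩
          simp [hidx, htab, h18 le_rfl arr e v rfl]
      all_goals
        refine ⟨trivial, fun r' h1 h2 => ?_, by simp, fun r' => ?_, by simp⟩
        · rw [Function.update_of_ne h1]
        · rw [Function.update_apply]
          split_ifs
          · simp
          · simp
    · have hle := not_lt.1 hlt
      rw [min_eq_right hle, if_neg hlt, add_zero] at hpc ⊢
      rw [hB.next_of_end _ hpc]
      refine ⟨hpc, fun _ _ _ => rfl, hB.not_writes_of_end hpc,
        fun _ => .inl rfl, fun arr e v he => ?_⟩
      rw [List.getElem?_eq_none hle] at he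
      simp at he
  have hidle : ∀ p, ¬ S.act p → c'.proc p = c.proc p ∧ ∀ a i x, ¬ (c.proc p).Writes B a i x :=
    fun p ha => ⟨by rw [hp p, hB.next_of_end _ (h.base.idle p ha)],
      hB.not_writes_of_end (h.base.idle p ha)⟩
  have hregs : ∀ p, ∀ r, r ≠ 18 → r ≠ 19 → (c'.proc p).reg r = (c.proc p).reg r := by
    intro p
    by_cases ha : S.act p
    · exact (key p ha ⟨_, S.idx_lt p ha⟩ rfl).2.1
    · rw [(hidle p ha).1]
      exact fun _ _ _ => rfl
  have hmem : c'.mem = c.mem := by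
    funext a i
    rcases hm a i with ⟨p, hw⟩ | h'
    · by_cases hact : S.act p
      · exact absurd hw ((key p hact ⟨_, S.idx_lt p hact⟩ rfl).2.2.1 _ _ _)
      · exact absurd hw ((hidle p hact).2 _ _ _)
    · exact h'.2
  refine ⟨⟨⟨?_, ?_, ?_, ?_, ?_, ?_, ?_⟩, fun p ha l hl => (key p ha l hl).1,
    fun p ha l hl r => ?_, fun s hs a i => ?_, h.step,
    fun _ p ha l hl arr e v he => ((key p ha l hl).2.2.2.2 arr e v he).1,
    fun hj p ha l hl arr e v he => ((key p ha l hl).2.2.2.2 arr e v he).2 (by omega)⟩, ?_⟩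
  · intro p; rw [hregs p 3 (by norm_num) (by norm_num), h.base.r3]
  · intro p; rw [hregs p 20 (by norm_num) (by norm_num), h.base.r20]
  · intro p; rw [hregs p 21 (by norm_num) (by norm_num), h.base.r21]
  · intro p; rw [hregs p 28 (by norm_num) (by norm_num), h.base.r28]
  · intro p ha; rw [(hidle p ha).1, h.base.idle p ha]
  · rw [hmem]; exact h.base.tab
  · rw [hmem]; exact h.base.mirror
  · rw [hregs p _ (by omega) (by omega), h.reg p ha l hl]
  · rw [hmem, h.mem s hs]
  · refine fun W hc => ⟨fun a i => by rw [hmem]; exact hc.1 a i, fun p r => ?_⟩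
    by_cases ha : S.act p
    · rcases (key p ha ⟨_, S.idx_lt p ha⟩ rfl).2.2.2.1 r with k | k | ⟨a, i, k⟩ <;> rw [k]
      · exact hc.2 p r
      · exact (Nat.zero_le _).trans_lt (hc.1 0 0)
      · exact hc.1 a i
    · rw [(hidle p ha).1]; exact hc.2 p r

/-- The last instruction copies the colors that were written to the output. -/
theorem Midway.last {cs cs' : ∀ s, Config (S.num s)} {c c' : Config P} (hB : SimAt A B b)
    (h : Midway S A b cs cs' 3 c) (hs : Step B c c') :
    Simulates S A b cs' c' ∧ ∀ W, (∀ s, 0 < S.num s → ∀ a i, (cs' s).mem a i + S.off s < W) →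
      c.WordsBelow W → c'.WordsBelow W := by
  obtain ⟨hp, hm⟩ := hs
  have key : ∀ p, S.act p → ∀ l : Fin (S.num (S.part p)), l = S.idx p →
      (c'.proc p).pc = b + 4 * min ((cs' (S.part p)).proc l).pc A.length ∧
      (∀ r, r ≠ 18 → (c'.proc p).reg r = (c.proc p).reg r) ∧
      ((c'.proc p).reg 18 = (c.proc p).reg 18 ∨ (c'.proc p).reg 18 = 0) ∧
      (∀ a i x, (c.proc p).Writes B a i x ↔ ∃ arr e v,
        A[((cs (S.part p)).proc l).pc]? = some (.store arr e v) ∧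
        a = (if arr = 5 then 5 else 19) ∧
        i = S.tab (e.eval ((cs (S.part p)).proc l).reg * S.H + S.part p) - 1 +
          (if S.tab (e.eval ((cs (S.part p)).proc l).reg * S.H + S.part p) = 0 then 1 else 0) *
            S.N ∧
        x = (cs' (S.part p)).mem arr (e.eval ((cs (S.part p)).proc l).reg) + S.off (S.part p)) := by
    intro p ha l hl
    have hpc := h.pc p ha l hl
    have hnum : 0 < S.num (S.part p) := (Nat.zero_le _).trans_lt (S.idx_lt p ha)
    rw [hp p, (h.step _ hnum).1 l]
    have h3 := h.base.r3 p
    have h28 := h.base.r28 p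
    have h18 := h.r18 (by norm_num) p ha l hl
    have h19 := h.r19 (by norm_num) p ha l hl
    have hreg := h.reg p ha l hl
    simp only [(h.step _ hnum).1 l] at hreg
    by_cases hlt : ((cs (S.part p)).proc l).pc < A.length
    · rw [min_eq_left hlt.le] at hpc
      obtain ⟨I, hI⟩ : ∃ I, A[((cs (S.part p)).proc l).pc]? = some I :=
        ⟨_, List.getElem?_eq_getElem hlt⟩
      have hg := hB.get ((cs (S.part p)).proc l).pc 3 (by omega)
      rw [if_pos hlt] at hpc
      rw [← add_assoc, ← hpc, hI] at hg
      simp only [Proc.next, Proc.Writes]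
      simp only [Proc.next] at hreg
      rw [hI] at h18 h19 ⊢
      rw [hI] at hreg
      rcases I with ⟨r, e⟩ | ⟨r, arr, e⟩ | ⟨arr, e, v⟩ | ⟨e, t⟩ <;>
        simp only [simInstr, Option.bind_some, List.getElem?_cons_zero,
          List.getElem?_cons_succ] at hg <;>
        simp only [hg] <;> simp only [hpc, min_eq_left (Nat.succ_le_of_lt hlt)]
      · refine ⟨by omega, fun r' h1 => ?_, .inr ?_, by simp⟩
        · rw [Function.update_of_ne h1]
        · simp
      · refine ⟨by omega, fun r' h1 => ?_, .inr ?_, by simp⟩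
        · rw [Function.update_of_ne h1]
        · simp
      · refine ⟨by omega, by simp, by simp, fun a i x => ?_⟩
        simp only [Option.some.injEq, Instr.store.injEq]
        constructor
        · rintro ⟨idx, val, ⟨rfl, rfl, rfl⟩, rfl, rfl⟩
          refine ⟨arr, e, v, ⟨rfl, rfl, rfl⟩, rfl, ?_, ?_⟩
          · simp [h19 arr e v rfl, h3]
          · simp [h18 arr e v rfl, h28]
        · rintro ⟨_, _, _, ⟨rfl, rfl, rfl⟩, rfl, rfl, rfl⟩
          refine ⟨_, _, ⟨rfl, rfl, rfl⟩, ?_, ?_⟩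
          · simp [h19 arr e v rfl, h3]
          · simp [h18 arr e v rfl, h28]
      · refine ⟨?_, by simp, by simp, by simp⟩
        have : e.shift.eval (c.proc p).reg = e.eval ((cs (S.part p)).proc l).reg := by
          rw [Expr.eval_shift]
          congr 1
          funext r
          exact hreg r
        rw [this]
        split_ifs
        · simp only [min_eq_left (Nat.succ_le_of_lt hlt)]; omega
        · simp
    · have hle := not_lt.1 hlt
      rw [min_eq_right hle, if_neg hlt, add_zero] at hpc
      rw [hB.next_of_end _ hpc, Proc.next_of_halted _ hle, min_eq_right hle]
      refine ⟨hpc, by simp, by simp, fun a i x => ⟨fun h => ?_, ?_⟩⟩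
      · exact absurd h (hB.not_writes_of_end hpc a i x)
      · rintro ⟨arr, e, v, he, -⟩
        rw [List.getElem?_eq_none hle] at he
        simp at he
  have hidle : ∀ p, ¬ S.act p → c'.proc p = c.proc p ∧ ∀ a i x, ¬ (c.proc p).Writes B a i x :=
    fun p ha => ⟨by rw [hp p, hB.next_of_end _ (h.base.idle p ha)],
      hB.not_writes_of_end (h.base.idle p ha)⟩
  have hregs : ∀ p, ∀ r, r ≠ 18 → (c'.proc p).reg r = (c.proc p).reg r := by
    intro p
    by_cases ha : S.act p
    · exact (key p ha ⟨_, S.idx_lt p ha⟩ rfl).2.1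
    · rw [(hidle p ha).1]
      exact fun _ _ => rfl
  have hwr : ∀ a i, (∃ p, S.act p ∧ ((a = 5 ∨ a = 19) ∧ ∃ arr j,
        c'.mem a i = (cs' (S.part p)).mem arr j + S.off (S.part p))) ∨
      c'.mem a i = c.mem a i := by
    intro a i
    rcases hm a i with ⟨p, hw⟩ | h'
    · by_cases hact : S.act p
      · obtain ⟨arr, e, v, -, h1, -, h2⟩ :=
          ((key p hact ⟨_, S.idx_lt p hact⟩ rfl).2.2.2 _ _ _).1 hw
        exact .inl ⟨p, hact, by split_ifs at h1 <;> simp [h1], _, _, h2⟩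
      · exact absurd hw ((hidle p hact).2 _ _ _)
    · exact .inr h'.2
  have hother : ∀ a, a ≠ 5 → a ≠ 19 → ∀ i, c'.mem a i = c.mem a i := by
    intro a h5 h19 i
    rcases hwr a i with ⟨p, -, h1 | h1, -⟩ | h'
    · exact absurd h1 h5
    · exact absurd h1 h19
    · exact h'
  refine ⟨⟨⟨?_, ?_, ?_, ?_, ?_, ?_, ?_⟩, fun p ha l hl => (key p ha l hl).1,
    fun p ha l hl r => ?_, fun s hs a i => ?_⟩, ?_⟩
  · intro p; rw [hregs p 3 (by norm_num), h.base.r3]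
  · intro p; rw [hregs p 20 (by norm_num), h.base.r20]
  · intro p; rw [hregs p 21 (by norm_num), h.base.r21]
  · intro p; rw [hregs p 28 (by norm_num), h.base.r28]
  · intro p ha; rw [(hidle p ha).1, h.base.idle p ha]
  · intro x; rw [hother 20 (by norm_num) (by norm_num), h.base.tab]
  · intro s hs i o ho
    have hoN : o < S.N := by have := S.tab_le (i * S.H + s); omega
    by_cases hw : ∃ l x, ((cs s).proc l).Writes A 5 i x
    · -- an entry of the output that was written in this step
      right
      obtain ⟨l, x, e, v, h1, h2, -⟩ := hw
      rcases hm 5 o with ⟨p, hw⟩ | ⟨h', -⟩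
      · by_cases hact : S.act p
        · obtain ⟨arr, e', v', -, k2, k3, k4⟩ :=
            ((key p hact ⟨_, S.idx_lt p hact⟩ rfl).2.2.2 _ _ _).1 hw
          obtain rfl : arr = 5 := by
            by_contra hne
            rw [if_neg hne] at k2
            exact absurd k2 (by norm_num)
          split_ifs at k3 with hz
          · omega
          · obtain ⟨rfl, rfl⟩ := part_addr_inj (num_part_lt hs) (S.part_lt p)
              (S.tab_inj (i * S.H + s) (e'.eval ((cs (S.part p)).proc ⟨_, S.idx_lt p hact⟩).reg *
                S.H + S.part p) (by omega) (by omega))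
            exact k4
        · exact absurd hw ((hidle p hact).2 _ _ _)
      · exfalso
        obtain ⟨p, hact, rfl, hidx⟩ := S.surj s l l.2
        refine h' p _ (((key p hact l hidx.symm).2.2.2 _ _ _).2 ⟨5, e, v, h1, rfl, ?_, rfl⟩)
        rw [← h2, ho]
        simp
    · push Not at hw
      have h1 : (cs' s).mem 5 i = (cs s).mem 5 i := by
        rcases (h.step s hs).2 5 i with ⟨l, hl⟩ | hl
        · exact absurd hl (hw _ _)
        · exact hl.2
      rw [h1]
      refine (h.base.mirror s hs i o ho).imp_right fun h2 => ?_
      rw [← h2]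
      rcases hm 5 o with ⟨p, hw'⟩ | h'
      · by_cases hact : S.act p
        · obtain ⟨arr, e', v', k1, k2, k3, k4⟩ :=
            ((key p hact ⟨_, S.idx_lt p hact⟩ rfl).2.2.2 _ _ _).1 hw'
          obtain rfl : arr = 5 := by
            by_contra hne
            rw [if_neg hne] at k2
            exact absurd k2 (by norm_num)
          split_ifs at k3 with hz
          · omega
          · obtain ⟨rfl, rfl⟩ := part_addr_inj (num_part_lt hs) (S.part_lt p)
              (S.tab_inj (i * S.H + s) (e'.eval ((cs (S.part p)).proc ⟨_, S.idx_lt p hact⟩).reg *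
                S.H + S.part p) (by omega) (by omega))
            exact absurd ⟨e', v', k1, rfl, rfl⟩ (hw ⟨_, S.idx_lt p hact⟩ _)
        · exact absurd hw' ((hidle p hact).2 _ _ _)
      · exact h'.2
  · rw [hregs p _ (by omega), h.reg p ha l hl]
  · rw [hother _ (by omega) (by omega), h.mem s hs]
  · refine fun W hW hc => ⟨fun a i => ?_, fun p r => ?_⟩
    · rcases hwr a i with ⟨p, hact, -, arr, j, h'⟩ | h'
      · rw [h']
        exact hW (S.part p) ((Nat.zero_le _).trans_lt (S.idx_lt p hact)) arr j
      · rw [h']; exact hc.1 a i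
    · by_cases h18 : r = 18
      · subst h18
        by_cases ha : S.act p
        · rcases (key p ha ⟨_, S.idx_lt p ha⟩ rfl).2.2.1 with k | k <;> rw [k]
          · exact hc.2 p 18
          · exact (Nat.zero_le _).trans_lt (hc.1 0 0)
        · rw [(hidle p ha).1]; exact hc.2 p 18
      · rw [hregs p r h18]; exact hc.2 p r

/-- Simulating `T` steps takes `4 * T` steps. -/
theorem Simulates.leads {W T : ℕ} {Ws : ℕ → ℕ} {init : ∀ s, Config (S.num s)} (hB : SimAt A B b)
    (hWs : ∀ s, 0 < S.num s → Ws s + S.off s ≤ W)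
    (hrun : ∀ s, 0 < S.num s → ∀ t c, Reaches A t (init s) c → c.WordsBelow (Ws s))
    {c : Config P} (h : Simulates S A b init c) (hc : c.WordsBelow W) :
    Leads B W (fun c => ∃ cs, (∀ s, 0 < S.num s → Reaches A T (init s) (cs s)) ∧
      Simulates S A b cs c) (4 * T) c := by
  suffices ∀ n k, k + n = T → ∀ cs c, (∀ s, 0 < S.num s → Reaches A k (init s) (cs s)) →
      Simulates S A b cs c → c.WordsBelow W →
      Leads B W (fun c => ∃ cs, (∀ s, 0 < S.num s → Reaches A T (init s) (cs s)) ∧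
        Simulates S A b cs c) (4 * n) c from
    this T 0 (by omega) init c (fun s _ => .refl _) h hc
  intro n
  induction n with
  | zero => exact fun k hk cs c hcs h hc => .done hc ⟨cs, by simpa [← hk] using hcs, h⟩
  | succ n ih =>
    intro k hk cs c hcs h hc
    rw [show 4 * (n + 1) = 4 * n + 1 + 1 + 1 + 1 by ring]
    refine .step hc fun c₁ h₁ => ?_
    obtain ⟨m₁, w₁⟩ := h.first hB h₁
    have hcs' : ∀ s, 0 < S.num s → Reaches A (k + 1) (init s) (partStep S A cs c₁.mem s) :=
      fun s hs => .tail (hcs s hs) (m₁.step s hs)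
    have hW : ∀ s, 0 < S.num s → (partStep S A cs c₁.mem s).WordsBelow (Ws s) :=
      fun s hs => hrun s hs _ _ (hcs' s hs)
    have w₁ := w₁ W (fun s hs => ⟨fun a i => ((hW s hs).1 a i).trans_le
      ((Nat.le_add_right _ _).trans (hWs s hs)), fun p r => ((hW s hs).2 p r).trans_le
      ((Nat.le_add_right _ _).trans (hWs s hs))⟩) hc
    refine .step w₁ fun c₂ h₂ => ?_
    obtain ⟨m₂, w₂⟩ := m₁.middle hB (.inl rfl) h₂
    refine .step (w₂ W w₁) fun c₃ h₃ => ?_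
    obtain ⟨m₃, w₃⟩ := m₂.middle hB (.inr rfl) h₃
    refine .step (w₃ W (w₂ W w₁)) fun c₄ h₄ => ?_
    obtain ⟨m₄, w₄⟩ := m₃.last hB h₄
    exact ih (k + 1) (by omega) _ c₄ hcs' m₄ (w₄ W (fun s hs a i => by
      have h1 := (hW s hs).1 a i
      have h2 := hWs s hs
      omega) (w₃ W (w₂ W w₁)))

theorem Simulates.halted {cs : ∀ s, Config (S.num s)} {c : Config P} (hB : SimAt A B b)
    (h : Simulates S A b cs c) (hcs : ∀ s, 0 < S.num s → (cs s).Halted A) : c.Halted B := by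
  intro p
  rw [Proc.Halted, hB.length]
  by_cases ha : S.act p
  · rw [h.pc p ha ⟨_, S.idx_lt p ha⟩ rfl,
      min_eq_right (hcs _ ((Nat.zero_le _).trans_lt (S.idx_lt p ha)) _)]
  · rw [h.base.idle p ha]

end

end PRAM

/-! ### The implementation of the procedure -/

namespace PRAM

open Finset

/-- The program that implements the procedure with base algorithm `A`. After the arcs have been
distributed among the parts, the processors that would not complete a copy of the set of arcs
leave the program, and the others simulate the base algorithm. -/
def approxProgram (A : Program) : Program :=
  (numberArcs ;; writeInputs).code 0 ++
    .jump (1 - .lt (.reg 0 / .reg 3) (.reg 1 / .reg 3))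
      ((numberArcs ;; writeInputs).size + 1 + 4 * A.length) ::
    simCode ((numberArcs ;; writeInputs).size + 1) A

theorem simAt_approxProgram (A : Program) :
    SimAt A (approxProgram A) ((numberArcs ;; writeInputs).size + 1) where
  length := by
    simp only [approxProgram, List.length_append, List.length_cons, Stmt.length_code, simCode,
      length_flatMap_simInstr]
    omega
  get k j hj := by
    rw [approxProgram, List.getElem?_append_right (by rw [Stmt.length_code]; omega),
      Stmt.length_code, show (numberArcs ;; writeInputs).size + 1 + (4 * k + j) -
        (numberArcs ;; writeInputs).size = 4 * k + j + 1 by omega, List.getElem?_cons_succ,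
      simCode, getElem?_flatMap_simInstr _ _ _ _ _ hj]

section

variable {N n h P W : ℕ} {tl tw leaf : ℕ → ℕ} {M : Memory} {ρ : Fin P → ℕ → ℕ}

theorem IsReady.orig_cases (hr : IsReady N h tl tw leaf M ρ) (x : ℕ) :
    M 20 x = 0 ∨ ∃ a < N, x = posIn leaf a * 2 ^ h + leaf a ∧ M 20 x = a + 1 := by
  have hx : x = x / 2 ^ h * 2 ^ h + x % 2 ^ h := (Nat.div_add_mod' x _).symm
  have hs : x % 2 ^ h < 2 ^ h := Nat.mod_lt _ (by positivity)
  rcases le_or_gt #(part N leaf (x % 2 ^ h)) (x / 2 ^ h) with hi | hi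
  · exact .inl (by rw [hx, hr.orig_zero _ hs _ hi])
  · obtain ⟨a, ha, hl, hp⟩ := exists_posIn_eq hi
    rw [← hl, ← hp] at hx
    exact .inr ⟨a, ha, hx, by rw [hx, hr.orig a ha]⟩

/-- The processors with the same part and the same quotient by `N` run the base algorithm on
the part; only the quotients are used for which all arcs of the part occur. -/
def IsReady.assignment (hr : IsReady N h tl tw leaf M ρ) (hN : 0 < N)
    (hlt : ∀ a < N, leaf a < 2 ^ h) : Assignment P where
  H := 2 ^ h
  N := N
  act p := p / N < P / N
  part p := leaf (p % N)
  idx p := p / N * #(part N leaf (leaf (p % N))) + posIn leaf (p % N)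
  num s := P / N * #(part N leaf s)
  off := colorOffset N tl leaf
  tab := M 20
  part_lt p := hlt _ (Nat.mod_lt _ hN)
  idx_lt p hp := by
    have h1 := posIn_lt (leaf := leaf) (Nat.mod_lt p.1 hN)
    have h2 := Nat.mul_le_mul_right #(part N leaf (leaf (p % N))) hp
    rw [Nat.succ_mul] at h2
    omega
  surj s l hl := by
    have hk : 0 < #(part N leaf s) := Nat.pos_of_ne_zero fun h0 => by simp [h0] at hl
    obtain ⟨a, ha, hs, hp⟩ := exists_posIn_eq (Nat.mod_lt l hk)
    have hd : l / #(part N leaf s) < P / N := Nat.div_lt_of_lt_mul (by rwa [Nat.mul_comm])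
    have h1 : (l / #(part N leaf s) * N + a) / N = l / #(part N leaf s) := by
      rw [Nat.mul_comm, Nat.mul_add_div hN, Nat.div_eq_of_lt ha, Nat.add_zero]
    have h2 : (l / #(part N leaf s) * N + a) % N = a := by
      rw [Nat.mul_comm, Nat.mul_add_mod, Nat.mod_eq_of_lt ha]
    refine ⟨⟨l / #(part N leaf s) * N + a, ?_⟩, ?_, ?_, ?_⟩
    · have := Nat.mul_le_mul_right N hd
      rw [Nat.succ_mul] at this
      have := Nat.div_mul_le_self P N
      omega
    · simpa [h1] using hd
    · simpa [h2] using hs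
    · simp only [h1, h2, hs, hp]
      exact Nat.div_add_mod' l _
  tab_le x := by
    rcases hr.orig_cases x with h0 | ⟨a, ha, -, h1⟩ <;> omega
  tab_inj x y hxy hx := by
    rcases hr.orig_cases x with h0 | ⟨a, ha, h1, h2⟩
    · exact absurd h0 hx
    rcases hr.orig_cases y with h0 | ⟨b, hb, h3, h4⟩
    · exact absurd (hxy.trans h0) hx
    obtain rfl : a = b := by omega
    rw [h1, h3]

theorem IsReady.simulates (hr : IsReady N h tl tw leaf M ρ) (hN : 0 < N)
    (hlt : ∀ a < N, leaf a < 2 ^ h) (A : Program) (b : ℕ) (I : ℕ → Memory)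
    (hI : ∀ s, (part N leaf s).Nonempty → IsPartInput N tl tw leaf s (I s)) {c : Config P}
    (hm : c.mem = M) (hreg : ∀ p, (c.proc p).reg = ρ p)
    (hpc : ∀ p, (c.proc p).pc = if (p : ℕ) / N < P / N then b else b + 4 * A.length) :
    Simulates (hr.assignment hN hlt) A b (fun s => initial _ (I s)) c := by
  have hne : ∀ s, 0 < (hr.assignment hN hlt).num s → (part N leaf s).Nonempty := fun s hs =>
    card_pos.1 (Nat.pos_of_mul_pos_left hs)
  refine ⟨⟨?_, ?_, ?_, ?_, ?_, ?_, ?_⟩, ?_, ?_, ?_⟩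
  · simp [hreg, hr.r3, assignment]
  · simp [hreg, hr.r20, assignment]
  · simp [hreg, hr.r21, assignment]
  · simp [hreg, hr.r28, assignment]
  · intro p hp
    exact (hpc p).trans (if_neg hp)
  · simp [hm, assignment]
  · exact fun s hs i o _ => .inl ((hI s (hne s hs)).zero 5 le_rfl i)
  · intro p hp l hl
    rw [(hpc p).trans (if_pos hp)]
    simp [initial]
  · intro p hp l hl r
    rw [hreg]
    obtain rfl | rfl | hr2 : r = 0 ∨ r = 1 ∨ 2 ≤ r := by omega
    · simp [hr.r40, initial, hl, assignment]
    · simp [hr.r41, initial, assignment]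
    · rw [hr.zero p _ (by omega)]
      simp [initial, show r ≠ 0 by omega, show r ≠ 1 by omega]
  · intro s hs a i
    rw [hm]
    exact hr.input s (hne s hs) _ (hI s (hne s hs)) a i

end

/-- The running time of the implementation, when the base algorithm runs in time `T`. -/
def approxTime (N h T : ℕ) : ℕ :=
  28 + (if h = 0 then 0 else
    (h + 1) * (9 * Nat.clog 2 (2 * N) + 21) + (42 * Nat.clog 2 (2 * N) + 59)) + 4 * T

/-- If the base algorithm meets `post` on every part, whatever the parts are, then the
implementation combines its results. (An entry `0` of the output of a part is an entry that has
not been written.) -/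
theorem approxProgram_leads {N n h P W T Ws : ℕ} {tl tw : ℕ → ℕ} {M : Memory} {A : Program}
    {post : (ℕ → ℕ) → ℕ → Memory → Prop} (hG : IsArcs N n tl tw)
    (hM : IsArcInput N n h tl tw M) (hN : 0 < N) (hNP : 2 * N ≤ P) (hNW : 2 * P < W)
    (hW₁ : N * n + n < W) (hW₂ : N * (N + 1) < W) (hh : 2 ^ h ≤ N)
    (hrun : ∀ leaf, IsLeafMap N h tl tw leaf → ∀ s, (part N leaf s).Nonempty →
      Ws + colorOffset N tl leaf s ≤ W ∧ ∃ I, IsPartInput N tl tw leaf s I ∧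
        ∀ t c, Reaches A t (initial (P / N * #(part N leaf s)) I) c →
          c.WordsBelow Ws ∧ (T ≤ t → c.Halted A ∧ post leaf s c.mem))
    (hMW : ∀ a i, M a i < W) :
    Leads (approxProgram A) W (fun c => c.Halted (approxProgram A) ∧
      ∃ leaf, IsLeafMap N h tl tw leaf ∧ ∀ s, (part N leaf s).Nonempty → ∃ M', post leaf s M' ∧
        ∀ a ∈ part N leaf s, M' 5 (posIn leaf a) = 0 ∨
          c.mem 5 a = M' 5 (posIn leaf a) + colorOffset N tl leaf s)
      (approxTime N h T) (initial P M) := by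
  obtain ⟨b, hb⟩ : ∃ b, b = (numberArcs ;; writeInputs).size := ⟨_, rfl⟩
  have hcode : CodeAt (approxProgram A) 0 ((numberArcs ;; writeInputs).code 0) := by
    intro j hj
    rw [approxProgram, Nat.zero_add, List.getElem?_append_left hj]
  have hjump : (approxProgram A)[b]? = some (.jump (1 - .lt (.reg 0 / .reg 3) (.reg 1 / .reg 3))
      (b + 1 + 4 * A.length)) := by
    rw [approxProgram, List.getElem?_append_right (by rw [Stmt.length_code, hb]),
      Stmt.length_code, hb]
    simp
  have hsim := simAt_approxProgram A
  rw [← hb] at hsim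
  have hn : n < W := by omega
  -- the distribution of the arcs
  have hens := Ens.seq (t := writeInputs) (T' := 10) (Q := fun M' ρ' => ∃ leaf,
      IsLeafMap N h tl tw leaf ∧ IsReady N h tl tw leaf M' ρ')
    ((numberArcs_ens (P := P) (W := W) hG hM hN hNP (by omega) hW₁ hW₂ hh).weaken le_rfl
      fun M' ρ' _ ⟨hK, ⟨leaf, hL, hnum⟩, hr, hz⟩ =>
        (writeInputs_ens hG hK hL hnum hr hz hN hNP hNW hn).weaken le_rfl
          fun _ _ _ hR => ⟨leaf, hL, hR⟩)
  have h1W : 1 < W := by omega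
  have hW : (initial P M).WordsBelow W := by
    refine ⟨hMW, fun p r => ?_⟩
    have := p.2
    simp only [initial]
    split_ifs <;> omega
  rw [show approxTime N h T = 17 + (if h = 0 then 0 else
    (h + 1) * (9 * Nat.clog 2 (2 * N) + 21) + (42 * Nat.clog 2 (2 * N) + 59)) + 10 +
      (4 * T + 1) by rw [approxTime]; omega]
  refine (hens _ 0 hcode hW).bind ?_
  rintro c hc ⟨M', ρ', rfl, leaf, hL, hr⟩
  rw [← hb, Nat.zero_add] at hc ⊢
  refine .step hc fun c' hs => ?_
  -- the inactive processors have left the program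
  have hm : c'.mem = M' := by
    funext a i
    rcases hs.2 a i with ⟨p, idx, val, h1, -⟩ | h1
    · simp [lock, hjump] at h1
    · exact h1.2
  have hreg : ∀ p, (c'.proc p).reg = ρ' p := fun p => by
    rw [hs.1 p]
    simp [Proc.next, lock, hjump]
  have hpc : ∀ p, (c'.proc p).pc =
      if (p : ℕ) / N < P / N then b + 1 else b + 1 + 4 * A.length := fun p => by
    rw [hs.1 p]
    simp only [Proc.next, lock, hjump, Expr.eval_sub, Expr.eval_lt, Expr.eval_div, Expr.eval_reg,
      Expr.eval_one, hr.r0, hr.r1, hr.r3]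
    split_ifs <;> simp_all
  have hc' : c'.WordsBelow W :=
    ⟨fun a i => by rw [hm]; exact hc.1 a i, fun p r => by rw [hreg]; exact hc.2 p r⟩
  have hex : ∀ s, ∃ I, (part N leaf s).Nonempty → IsPartInput N tl tw leaf s I ∧
      ∀ t c, Reaches A t (initial (P / N * #(part N leaf s)) I) c →
        c.WordsBelow Ws ∧ (T ≤ t → c.Halted A ∧ post leaf s c.mem) := fun s => by
    by_cases hs : (part N leaf s).Nonempty
    · obtain ⟨-, I, hI⟩ := hrun leaf hL s hs
      exact ⟨I, fun _ => hI⟩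
    · exact ⟨fun _ _ => 0, fun hs' => absurd hs' hs⟩
  choose I hI using hex
  have hne : ∀ s, 0 < (hr.assignment hN hL.lt).num s → (part N leaf s).Nonempty := fun s hs =>
    card_pos.1 (Nat.pos_of_mul_pos_left hs)
  have hsimul := hr.simulates hN hL.lt A (b + 1) I (fun s hs => (hI s hs).1) hm hreg hpc
  refine (hsimul.leads (T := T) (Ws := fun _ => Ws) hsim
    (fun s hs => (hrun leaf hL s (hne s hs)).1)
    (fun s hs t c hR => ((hI s (hne s hs)).2 t c hR).1) hc').weaken le_rfl ?_
  rintro c'' - ⟨cs, hcs, hS⟩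
  refine ⟨hS.halted hsim fun s hs => (((hI s (hne s hs)).2 T _ (hcs s hs)).2 le_rfl).1,
    leaf, hL, fun s hs => ?_⟩
  have hnum : 0 < (hr.assignment hN hL.lt).num s :=
    Nat.mul_pos (Nat.div_pos (by omega) hN) (card_pos.2 hs)
  refine ⟨_, (((hI s hs).2 T _ (hcs s hnum)).2 le_rfl).2, fun a ha => ?_⟩
  obtain ⟨ha', rfl⟩ := mem_part.1 ha
  exact hS.base.mirror _ hnum _ a (hr.orig a ha')

end PRAM

/-! ### Graphs given by sets of arcs -/

namespace EdgeColoring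

open Finset

variable {V : Type}

theorem two_mul_numEdges [Fintype V] (G : SimpleGraph V) : 2 * numEdges G = Nat.card G.Dart := by
  classical
  rw [Nat.card_eq_fintype_card, G.dart_card_eq_twice_card_edges, numEdges,
    Set.ncard_eq_toFinset_card', SimpleGraph.edgeFinset]

theorem card_filter_fin {n : ℕ} (p : ℕ → Prop) [DecidablePred p] :
    #{a : Fin n | p a} = #{a ∈ range n | p a} := by
  rw [← card_map Fin.valEmbedding]
  congr 1
  ext a
  simp only [mem_map, mem_filter, mem_univ, true_and, Fin.valEmbedding_apply, mem_range]
  exact ⟨fun ⟨b, hb, h⟩ => h ▸ ⟨b.2, hb⟩, fun ⟨ha, h⟩ => ⟨⟨a, ha⟩, h, rfl⟩⟩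

theorem deg_eq_zero {G : SimpleGraph V} {v : V} (hv : v ∉ G.support) : deg G v = 0 := by
  rw [deg, Set.eq_empty_of_forall_notMem (s := G.neighborSet v) fun u hu =>
    hv (G.mem_support.2 ⟨u, hu⟩), Set.ncard_empty]

namespace AdjacencyLists

variable {G : SimpleGraph V} (R : AdjacencyLists G)

/-- The number of the tail of arc number `a`. -/
noncomputable def tl (a : ℕ) : ℕ := R.input 0 2 a

/-- The number of the opposite arc of arc number `a`. -/
noncomputable def tw (a : ℕ) : ℕ := R.input 0 4 a

theorem tl_coe (a : Fin (2 * numEdges G)) : R.tl a = R.tail a := dif_pos a.2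

theorem tw_coe (a : Fin (2 * numEdges G)) : R.tw a = R.twin a := dif_pos a.2

theorem arc_twin (a : Fin (2 * numEdges G)) : R.arc (R.twin a) = (R.arc a).symm := by simp [twin]

theorem tail_twin (a : Fin (2 * numEdges G)) : R.tail (R.twin a) = R.head a := by
  simp [tail, head, twin]

theorem vert_tail (a : Fin (2 * numEdges G)) : (R.vert (R.tail a) : V) = (R.arc a).fst := by
  simp [tail]

theorem isArcs : IsArcs (2 * numEdges G) (numVertices G) R.tl R.tw where
  tl_lt a ha := by
    rw [R.tl_coe ⟨a, ha⟩]
    exact (R.tail _).2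
  twin :=
    { lt := fun a ha => by
        rw [R.tw_coe ⟨a, ha⟩]
        exact (R.twin _).2
      invol := fun a ha => by
        rw [R.tw_coe ⟨a, ha⟩, R.tw_coe, twin, R.arc_twin]
        simp
      ne := fun a ha h => by
        rw [R.tw_coe ⟨a, ha⟩] at h
        have := R.arc_twin ⟨a, ha⟩
        rw [show R.twin ⟨a, ha⟩ = ⟨a, ha⟩ from Fin.ext h] at this
        exact SimpleGraph.Dart.symm_ne _ this.symm }
  mono a b hab hb := by
    rw [R.tl_coe ⟨a, hab.trans_lt hb⟩, R.tl_coe ⟨b, hb⟩]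
    exact R.sorted (show (⟨a, hab.trans_lt hb⟩ : Fin _) ≤ ⟨b, hb⟩ from hab)
  surj v hv := by
    obtain ⟨u, hu⟩ := G.mem_support.1 (R.vert ⟨v, hv⟩).2
    refine ⟨R.arc.symm ⟨(_, u), hu⟩, Fin.is_lt _, ?_⟩
    rw [R.tl_coe]
    simp [tail]

theorem offset_eq (i : ℕ) : R.offset i = #{b ∈ range (2 * numEdges G) | R.tl b < i} := by
  rw [← card_filter_fin fun b => R.tl b < i, offset]
  simp only [tl_coe]

theorem isArcInput (h : ℕ) :
    IsArcInput (2 * numEdges G) (numVertices G) h R.tl R.tw (R.input h) where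
  m00 := rfl
  m01 := rfl
  m02 := rfl
  m1 a ha := by
    have := R.isArcs.tl_lt a ha
    rw [arcsBefore, part, filter_true_of_mem (fun _ _ => rfl), ← offset_eq]
    exact if_pos this.le
  m2 a ha := rfl
  m3 a ha := by
    rw [R.tw_coe ⟨a, ha⟩, R.tl_coe, R.tail_twin]
    exact dif_pos ha
  m4 a ha := rfl
  zero a ha i := by
    obtain ⟨a, rfl⟩ := Nat.exists_eq_add_of_le' ha
    rfl

/-- The graph that consists of the edges of the arcs with numbers in `p`. -/
def arcGraph (p : ℕ → Prop) : SimpleGraph V :=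
  .fromEdgeSet {e | ∃ a : Fin (2 * numEdges G), p a ∧ (R.arc a).edge = e}

variable {R} {p : ℕ → Prop}

theorem mem_edgeSet_arcGraph {e : Sym2 V} :
    e ∈ (R.arcGraph p).edgeSet ↔ ∃ a : Fin (2 * numEdges G), p a ∧ (R.arc a).edge = e := by
  rw [arcGraph, SimpleGraph.edgeSet_fromEdgeSet]
  refine ⟨fun h => h.1, fun h => ⟨h, ?_⟩⟩
  obtain ⟨a, -, rfl⟩ := h
  exact SimpleGraph.not_isDiag_of_mem_edgeSet _ (R.arc a).edge_mem

theorem arcGraph_adj (hp : ∀ a < 2 * numEdges G, p a → p (R.tw a)) {u v : V} :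
    (R.arcGraph p).Adj u v ↔ ∃ h : G.Adj u v, p (R.arc.symm ⟨(u, v), h⟩) := by
  rw [← SimpleGraph.mem_edgeSet, mem_edgeSet_arcGraph]
  constructor
  · rintro ⟨a, ha, he⟩
    have hadj : G.Adj u v := by
      rw [← SimpleGraph.mem_edgeSet, ← he]
      exact (R.arc a).edge_mem
    refine ⟨hadj, ?_⟩
    rcases (SimpleGraph.dart_edge_eq_iff (R.arc a) ⟨(u, v), hadj⟩).1 he with h | h
    · rwa [← h, R.arc.symm_apply_apply]
    · have := hp a a.2 ha
      rw [R.tw_coe, twin, h] at this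
      simpa using this
  · rintro ⟨h, hp⟩
    exact ⟨_, hp, by simp⟩

theorem arcGraph_le (hp : ∀ a < 2 * numEdges G, p a → p (R.tw a)) : R.arcGraph p ≤ G :=
  fun _ _ h => ((arcGraph_adj hp).1 h).1

/-- The number of the arc of `G` for an arc of a subgraph that is given by a set of arcs. -/
def arcNum (hp : ∀ a < 2 * numEdges G, p a → p (R.tw a)) (d : (R.arcGraph p).Dart) :
    Fin (2 * numEdges G) :=
  R.arc.symm ⟨d.toProd, ((arcGraph_adj hp).1 d.adj).1⟩

theorem arcNum_mem (hp : ∀ a < 2 * numEdges G, p a → p (R.tw a)) (d : (R.arcGraph p).Dart) :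
    p (arcNum hp d) := ((arcGraph_adj hp).1 d.adj).2

theorem arcNum_inj (hp : ∀ a < 2 * numEdges G, p a → p (R.tw a)) {d d' : (R.arcGraph p).Dart}
    (h : arcNum hp d = arcNum hp d') : d = d' := by
  have := R.arc.symm.injective h
  rw [SimpleGraph.Dart.ext_iff] at this ⊢
  exact this

theorem exists_arcNum (hp : ∀ a < 2 * numEdges G, p a → p (R.tw a)) {a : Fin (2 * numEdges G)}
    (ha : p a) : ∃ d : (R.arcGraph p).Dart, arcNum hp d = a :=
  have h : R.arc.symm ⟨(R.arc a).toProd, (R.arc a).adj⟩ = a := R.arc.symm_apply_apply a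
  ⟨⟨(R.arc a).toProd, (arcGraph_adj hp).2 ⟨(R.arc a).adj, by simpa only [h] using ha⟩⟩, h⟩

theorem arc_arcNum (hp : ∀ a < 2 * numEdges G, p a → p (R.tw a)) (d : (R.arcGraph p).Dart) :
    (R.arc (arcNum hp d)).toProd = d.toProd := by simp [arcNum]

theorem two_mul_numEdges_arcGraph [Fintype V] [DecidablePred p]
    (hp : ∀ a < 2 * numEdges G, p a → p (R.tw a)) :
    2 * numEdges (R.arcGraph p) = #{a ∈ range (2 * numEdges G) | p a} := by
  rw [two_mul_numEdges, ← card_filter_fin, ← Fintype.card_coe, ← Nat.card_eq_fintype_card]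
  refine Nat.card_eq_of_bijective (fun d => ⟨arcNum hp d, by simpa using arcNum_mem hp d⟩)
    ⟨fun d d' h => arcNum_inj hp (Subtype.ext_iff.1 h), fun ⟨a, ha⟩ => ?_⟩
  obtain ⟨d, rfl⟩ := exists_arcNum hp (by simpa using ha)
  exact ⟨d, rfl⟩

theorem fst_arc_eq_iff {a : Fin (2 * numEdges G)} {i : Fin (numVertices G)} :
    (R.arc a).fst = R.vert i ↔ R.tl a = i := by
  rw [tl_coe, ← vert_tail, ← Subtype.ext_iff, R.vert.apply_eq_iff_eq, Fin.ext_iff]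

theorem neighborSet_arcGraph (hp : ∀ a < 2 * numEdges G, p a → p (R.tw a))
    (i : Fin (numVertices G)) :
    (R.arcGraph p).neighborSet (R.vert i) =
      (fun a => (R.arc a).snd) '' {a : Fin (2 * numEdges G) | p a ∧ R.tl a = i} := by
  ext u
  rw [SimpleGraph.mem_neighborSet, arcGraph_adj hp]
  constructor
  · rintro ⟨h, hu⟩
    exact ⟨_, ⟨hu, fst_arc_eq_iff.1 (by simp)⟩, by simp⟩
  · rintro ⟨a, ⟨ha, hi⟩, rfl⟩
    have hi := fst_arc_eq_iff.2 hi
    have h : R.arc a = ⟨(↑(R.vert i), (R.arc a).snd), hi ▸ (R.arc a).adj⟩ := by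
      rw [SimpleGraph.Dart.ext_iff]
      exact Prod.ext hi rfl
    exact ⟨hi ▸ (R.arc a).adj, by rw [← h]; simpa using ha⟩

theorem mem_support_arcGraph (hp : ∀ a < 2 * numEdges G, p a → p (R.tw a))
    (i : Fin (numVertices G)) :
    (R.vert i : V) ∈ (R.arcGraph p).support ↔ ∃ a < 2 * numEdges G, p a ∧ R.tl a = i := by
  have := neighborSet_arcGraph hp i
  simp only [Set.ext_iff, SimpleGraph.mem_neighborSet] at this
  simp only [SimpleGraph.mem_support, this]
  exact ⟨fun ⟨_, a, h, _⟩ => ⟨a, a.2, h⟩, fun ⟨a, ha, h⟩ => ⟨_, ⟨a, ha⟩, h, rfl⟩⟩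

theorem deg_arcGraph [DecidablePred p] (hp : ∀ a < 2 * numEdges G, p a → p (R.tw a))
    (i : Fin (numVertices G)) :
    deg (R.arcGraph p) (R.vert i) = #{a ∈ range (2 * numEdges G) | p a ∧ R.tl a = i} := by
  rw [deg, neighborSet_arcGraph hp, Set.InjOn.ncard_image, ← card_filter_fin,
    ← Set.ncard_coe_finset]
  · congr 1
    ext a
    simp
  · rintro a ⟨-, ha⟩ b ⟨-, hb⟩ h
    refine R.arc.injective ?_
    rw [SimpleGraph.Dart.ext_iff]
    exact Prod.ext ((fst_arc_eq_iff.2 ha).trans (fst_arc_eq_iff.2 hb).symm) h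

end AdjacencyLists

end EdgeColoring

/-! ### Adjacency lists of the parts -/

namespace EdgeColoring

open Finset

namespace AdjacencyLists

variable {V : Type} {G : SimpleGraph V} (R : AdjacencyLists G)

/-- Part number `s` of the graph, when `leaf a` is the number of the part of arc number `a`. -/
abbrev partGraph (leaf : ℕ → ℕ) (s : ℕ) : SimpleGraph V := R.arcGraph fun a => leaf a = s

variable {R} {leaf : ℕ → ℕ} {s : ℕ}

section

variable (htw : ∀ a < 2 * numEdges G, leaf (R.tw a) = leaf a)
include htw

theorem leaf_tw_iff : ∀ a < 2 * numEdges G, leaf a = s → leaf (R.tw a) = s :=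
  fun a ha h => (htw a ha).trans h

theorem partGraph_le : R.partGraph leaf s ≤ G := arcGraph_le (leaf_tw_iff htw)

theorem two_mul_numEdges_partGraph [Fintype V] :
    2 * numEdges (R.partGraph leaf s) = #(part (2 * numEdges G) leaf s) :=
  two_mul_numEdges_arcGraph (leaf_tw_iff htw)

theorem tl_mem_verts_iff {i : Fin (numVertices G)} :
    (i : ℕ) ∈ verts (2 * numEdges G) R.tl leaf s ↔
      (R.vert i : V) ∈ (R.partGraph leaf s).support := by
  rw [partGraph, mem_support_arcGraph (leaf_tw_iff htw), verts, mem_image]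
  simp only [mem_part, and_assoc]

theorem numVertices_partGraph [Fintype V] :
    numVertices (R.partGraph leaf s) = #(verts (2 * numEdges G) R.tl leaf s) := by
  have hlt : ∀ i ∈ verts (2 * numEdges G) R.tl leaf s, i < numVertices G := fun i hi => by
    obtain ⟨a, ha, rfl⟩ := mem_image.1 hi
    exact R.isArcs.tl_lt a (mem_part.1 ha).1
  rw [← Fintype.card_coe, ← Nat.card_eq_fintype_card, numVertices, ← Nat.card_coe_set_eq]
  refine (Nat.card_eq_of_bijective (fun i : verts (2 * numEdges G) R.tl leaf s =>
    (⟨R.vert ⟨i, hlt i i.2⟩, (tl_mem_verts_iff htw).1 i.2⟩ : (R.partGraph leaf s).support))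
    ⟨fun i j h => ?_, fun ⟨v, hv⟩ => ?_⟩).symm
  · have h : (R.vert ⟨i, hlt i i.2⟩ : V) = R.vert ⟨j, hlt j j.2⟩ := by
      simpa only [Subtype.mk.injEq] using h
    exact Subtype.ext (Fin.ext_iff.1 (R.vert.injective (Subtype.ext h)))
  · have hG := SimpleGraph.support_mono (partGraph_le htw) hv
    have h : (R.vert (R.vert.symm ⟨v, hG⟩) : V) = v := by simp
    refine ⟨⟨R.vert.symm ⟨v, hG⟩, (tl_mem_verts_iff htw).2 (by rwa [h])⟩, Subtype.ext h⟩

theorem maxDeg_partGraph [Fintype V] :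
    maxDeg (R.partGraph leaf s) = partDeg (2 * numEdges G) R.tl leaf s := by
  refine le_antisymm (Finset.sup_le fun v _ => ?_) (Finset.sup_le fun i hi => ?_)
  · by_cases hv : v ∈ (R.partGraph leaf s).support
    · have hG := SimpleGraph.support_mono (partGraph_le htw) hv
      obtain ⟨i, rfl⟩ : ∃ i, (R.vert i : V) = v := ⟨R.vert.symm ⟨v, hG⟩, by simp⟩
      rw [partGraph, deg_arcGraph (leaf_tw_iff htw)]
      refine le_trans (le_of_eq ?_) (Finset.le_sup ((tl_mem_verts_iff htw).2 hv))
      rw [part, filter_filter]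
    · rw [deg_eq_zero hv]
      exact Nat.zero_le _
  · obtain ⟨a, ha, rfl⟩ := mem_image.1 hi
    have hlt := R.isArcs.tl_lt a (mem_part.1 ha).1
    refine le_trans (le_of_eq ?_) (Finset.le_sup (mem_univ (R.vert ⟨_, hlt⟩ : V)))
    rw [partGraph, deg_arcGraph (leaf_tw_iff htw), part, filter_filter]

theorem leaf_arcNum (d : (R.partGraph leaf s).Dart) : leaf (arcNum (leaf_tw_iff htw) d) = s :=
  arcNum_mem (leaf_tw_iff htw) d

/-- The number of an arc in its part, in the order of the given adjacency lists. -/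
noncomputable def partArc [Fintype V] (d : (R.partGraph leaf s).Dart) :
    Fin (2 * numEdges (R.partGraph leaf s)) :=
  ⟨posIn leaf (arcNum (leaf_tw_iff htw) d), by
    have h := posIn_lt (leaf := leaf) (arcNum (leaf_tw_iff htw) d).2
    rwa [leaf_arcNum htw d, ← two_mul_numEdges_partGraph htw] at h⟩

theorem partArc_bijective [Fintype V] :
    Function.Bijective (partArc htw : (R.partGraph leaf s).Dart → _) := by
  classical
  refine (Fintype.bijective_iff_injective_and_card _).2 ⟨fun d d' h =>
    arcNum_inj (leaf_tw_iff htw) (Fin.ext ?_), ?_⟩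
  · exact posIn_inj ((leaf_arcNum htw d).trans (leaf_arcNum htw d').symm) (Fin.ext_iff.1 h)
  · rw [Fintype.card_fin, two_mul_numEdges, Nat.card_eq_fintype_card]

/-- The number of a vertex in a part, in the order of the given adjacency lists. -/
noncomputable def partVert [Fintype V] (v : (R.partGraph leaf s).support) :
    Fin (numVertices (R.partGraph leaf s)) :=
  ⟨#{i ∈ verts (2 * numEdges G) R.tl leaf s |
      i < (R.vert.symm ⟨v, SimpleGraph.support_mono (partGraph_le htw) v.2⟩ : ℕ)}, by
    rw [numVertices_partGraph htw]
    refine card_lt_card (filter_ssubset.2 ⟨_, (tl_mem_verts_iff htw).2 ?_, lt_irrefl _⟩)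
    simp⟩

theorem partVert_eq [Fintype V] {a : Fin (2 * numEdges G)} (ha : leaf a = s)
    (hv : (R.arc a).fst ∈ (R.partGraph leaf s).support) :
    (partVert htw ⟨(R.arc a).fst, hv⟩ : ℕ) = vertNum (2 * numEdges G) R.tl leaf a := by
  rw [vertNum, ha, tl_coe]
  rfl

theorem partVert_bijective [Fintype V] :
    Function.Bijective (partVert htw : (R.partGraph leaf s).support → _) := by
  classical
  refine (Fintype.bijective_iff_injective_and_card _).2 ⟨fun v v' h => ?_, ?_⟩
  · have key : ∀ v : (R.partGraph leaf s).support, ∃ a : Fin (2 * numEdges G), leaf a = s ∧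
        (R.arc a).fst = v := fun ⟨v, hv⟩ => by
      obtain ⟨u, hu⟩ := (SimpleGraph.mem_support _).1 hv
      obtain ⟨h, hs⟩ := (arcGraph_adj (leaf_tw_iff htw)).1 hu
      exact ⟨_, hs, by simp⟩
    obtain ⟨v, hv⟩ := v
    obtain ⟨v', hv'⟩ := v'
    obtain ⟨a, ha, rfl⟩ := key ⟨v, hv⟩
    obtain ⟨b, hb, rfl⟩ := key ⟨v', hv'⟩
    have h := Fin.ext_iff.1 h
    rw [partVert_eq htw ha, partVert_eq htw hb,
      vertNum_eq_iff a.2 b.2 (ha.trans hb.symm), tl_coe, tl_coe, ← Fin.ext_iff] at h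
    refine Subtype.ext ?_
    simp only [← vert_tail, h]
  · rw [Fintype.card_fin, numVertices, ← Nat.card_coe_set_eq, Nat.card_eq_fintype_card]

theorem partVert_fst [Fintype V] (d : (R.partGraph leaf s).Dart)
    (hd : d.fst ∈ (R.partGraph leaf s).support) :
    (partVert htw ⟨d.fst, hd⟩ : ℕ) =
      vertNum (2 * numEdges G) R.tl leaf (arcNum (leaf_tw_iff htw) d) := by
  have h := congrArg Prod.fst (arc_arcNum (leaf_tw_iff htw) d)
  rw [← partVert_eq htw (leaf_arcNum htw d) (h ▸ hd)]
  simp only [h]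

/-- The adjacency lists of a part, with vertices and arcs in the order of the given lists. -/
noncomputable def partLists [Fintype V] : AdjacencyLists (R.partGraph leaf s) where
  vert := (Equiv.ofBijective _ (partVert_bijective htw)).symm
  arc := (Equiv.ofBijective _ (partArc_bijective htw)).symm
  sorted i j hij := by
    obtain ⟨d, rfl⟩ := (partArc_bijective htw).2 i
    obtain ⟨d', rfl⟩ := (partArc_bijective htw).2 j
    simp only [Equiv.symm_symm, Equiv.ofBijective_apply, Fin.le_iff_val_le_val, partVert_fst,
      Equiv.ofBijective_symm_apply_apply]
    have hl : leaf (arcNum (leaf_tw_iff htw) d) = leaf (arcNum (leaf_tw_iff htw) d') :=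
      (leaf_arcNum htw d).trans (leaf_arcNum htw d').symm
    by_contra! hlt
    have h1 := (vertNum_lt_iff (Fin.is_lt _) hl.symm).1 hlt
    have h2 : (arcNum (leaf_tw_iff htw) d' : ℕ) < arcNum (leaf_tw_iff htw) d := by
      by_contra! hle
      exact absurd (R.isArcs.mono _ _ hle (Fin.is_lt _)) (not_le.2 h1)
    exact absurd (posIn_lt_posIn h2 hl.symm) (not_lt.2 hij)

theorem partLists_arc [Fintype V] (d : (R.partGraph leaf s).Dart) :
    (partLists htw).arc (partArc htw d) = d :=
  Equiv.ofBijective_symm_apply_apply _ _ _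

theorem partLists_tl [Fintype V] {a : ℕ} (ha : a < 2 * numEdges G) (hs : leaf a = s) :
    (partLists (s := s) htw).tl (posIn leaf a) = vertNum (2 * numEdges G) R.tl leaf a := by
  obtain ⟨d, hd⟩ := exists_arcNum (a := ⟨a, ha⟩) (leaf_tw_iff htw) hs
  obtain rfl := congrArg Fin.val hd
  refine (tl_coe _ (partArc htw d)).trans ?_
  rw [← partVert_fst htw d ((SimpleGraph.mem_support _).2 ⟨_, d.adj⟩)]
  simp only [tail, partLists_arc]
  rfl

theorem arcNum_symm (d : (R.partGraph leaf s).Dart) :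
    arcNum (leaf_tw_iff htw) d.symm = R.twin (arcNum (leaf_tw_iff htw) d) := by
  rw [twin, arcNum, arcNum, R.arc.apply_symm_apply]
  rfl

theorem partLists_tw [Fintype V] {a : ℕ} (ha : a < 2 * numEdges G) (hs : leaf a = s) :
    (partLists (s := s) htw).tw (posIn leaf a) = posIn leaf (R.tw a) := by
  obtain ⟨d, hd⟩ := exists_arcNum (a := ⟨a, ha⟩) (leaf_tw_iff htw) hs
  obtain rfl := congrArg Fin.val hd
  refine (tw_coe _ (partArc htw d)).trans ?_
  have : (partLists htw).twin (partArc htw d) = partArc htw d.symm := by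
    rw [twin, partLists_arc, Equiv.symm_apply_eq, partLists_arc]
  rw [this, tw_coe, ← arcNum_symm htw]
  rfl

theorem isPartInput_partLists [Fintype V] :
    IsPartInput (2 * numEdges G) R.tl R.tw leaf s ((partLists (s := s) htw).input 0) where
  i00 := numVertices_partGraph htw
  i01 := two_mul_numEdges_partGraph htw
  i0 i hi := by
    obtain ⟨i, rfl⟩ := Nat.exists_eq_add_of_le' hi
    cases i <;> rfl
  i1 a ha hs := by
    have hlt := vertNum_lt (tl := R.tl) (leaf := leaf) ha
    rw [hs, ← numVertices_partGraph htw] at hlt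
    refine (if_pos hlt.le).trans ?_
    rw [offset_eq, arcsBefore, hs]
    refine (card_bij (fun b _ => posIn leaf b) (fun b hb => ?_) (fun b hb c hc h => ?_)
      fun x hx => ?_).symm
    · obtain ⟨hb, hlt⟩ := mem_filter.1 hb
      obtain ⟨hb, hbs⟩ := mem_part.1 hb
      rw [mem_filter, mem_range, two_mul_numEdges_partGraph htw, partLists_tl htw hb hbs,
        vertNum_lt_iff hb (hbs.trans hs.symm), ← hbs]
      exact ⟨posIn_lt hb, hlt⟩
    · rw [mem_filter, mem_part] at hb hc
      exact posIn_inj (hb.1.2.trans hc.1.2.symm) h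
    · obtain ⟨hx, hlt⟩ := mem_filter.1 hx
      rw [mem_range, two_mul_numEdges_partGraph htw] at hx
      obtain ⟨b, hb, hbs, rfl⟩ := exists_posIn_eq hx
      rw [partLists_tl htw hb hbs, vertNum_lt_iff hb (hbs.trans hs.symm)] at hlt
      exact ⟨b, mem_filter.2 ⟨mem_part.2 ⟨hb, hbs⟩, hlt⟩, rfl⟩
  i1_card := by
    rw [← numVertices_partGraph htw, ← two_mul_numEdges_partGraph htw]
    refine (if_pos le_rfl).trans ?_
    rw [offset, filter_true_of_mem fun _ _ => Fin.is_lt _, card_univ, Fintype.card_fin]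
  i1_zero i hi := by
    rw [← numVertices_partGraph htw] at hi
    exact if_neg (by omega)
  i2 a ha hs := partLists_tl htw ha hs
  i3 a ha hs := by
    have hlt := posIn_lt (leaf := leaf) ha
    rw [hs, ← two_mul_numEdges_partGraph htw] at hlt
    rw [((partLists (s := s) htw).isArcInput 0).m3 _ hlt, partLists_tw htw ha hs,
      partLists_tl htw (R.isArcs.twin.lt a ha) ((htw a ha).trans hs)]
  i4 a ha hs := partLists_tw htw ha hs
  i_zero i hi := by
    rw [← two_mul_numEdges_partGraph htw] at hi
    exact ⟨dif_neg (by omega), dif_neg (by omega), dif_neg (by omega)⟩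
  zero := ((partLists (s := s) htw).isArcInput 0).zero

theorem stores_partLists_iff [Fintype V] {M : Memory} {φ : Sym2 V → ℕ} :
    (partLists (s := s) htw).Stores M φ ↔ ∀ a : Fin (2 * numEdges G), leaf a = s →
      M 5 (posIn leaf a) = φ (R.arc a).edge := by
  have hedge : ∀ d : (R.partGraph leaf s).Dart,
      (R.arc (arcNum (leaf_tw_iff htw) d)).edge = d.edge := fun d => by
    simp only [SimpleGraph.Dart.edge, arc_arcNum]
  constructor
  · intro h a ha
    obtain ⟨d, rfl⟩ := exists_arcNum (leaf_tw_iff htw) ha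
    refine (h (partArc htw d)).trans ?_
    rw [partLists_arc, hedge]
  · intro h i
    obtain ⟨d, rfl⟩ := (partArc_bijective htw).2 i
    refine (h _ (leaf_arcNum htw d)).trans ?_
    rw [partLists_arc, hedge]

end

end AdjacencyLists

end EdgeColoring

/-! ### Merging the colorings of the parts -/

namespace EdgeColoring

open Finset

variable {V : Type} {G : SimpleGraph V}

theorem IsProperEdgeColoring.congr {k : ℕ} {φ ψ : Sym2 V → ℕ} (h : IsProperEdgeColoring G k φ)
    (hψ : ∀ e ∈ G.edgeSet, ψ e = φ e) : IsProperEdgeColoring G k ψ :=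
  ⟨fun e he => hψ e he ▸ h.1 e he, fun e he e' he' hne hv => by
    rw [hψ e he, hψ e' he']
    exact h.2 e he e' he' hne hv⟩

theorem CanOutput.congr {A : Program} {φ ψ : Sym2 V → ℕ} (h : CanOutput A G φ)
    (hψ : ∀ e ∈ G.edgeSet, ψ e = φ e) : CanOutput A G ψ := by
  obtain ⟨R, P, t, c, h1, h2, h3⟩ := h
  exact ⟨R, P, t, c, h1, h2, fun a => (h3 a).trans (hψ _ (R.arc a).edge_mem).symm⟩

theorem isProperEdgeColoring_bot {k : ℕ} {φ : Sym2 V → ℕ} :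
    IsProperEdgeColoring (⊥ : SimpleGraph V) k φ :=
  ⟨fun e he => by simp at he, fun e he => by simp at he⟩

namespace AdjacencyLists

variable {R : AdjacencyLists G} {leaf : ℕ → ℕ} {h : ℕ}

variable (R) in
/-- The graph with number `σ` among those that the procedure is invoked on with parameter `k`. -/
abbrev levelGraph (leaf : ℕ → ℕ) (k σ : ℕ) : SimpleGraph V := R.arcGraph fun a => leaf a / 2 ^ k = σ

theorem div_pow_succ_eq_iff (x k σ : ℕ) :
    x / 2 ^ (k + 1) = σ ↔ x / 2 ^ k = 2 * σ ∨ x / 2 ^ k = 2 * σ + 1 := by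
  rw [pow_succ, ← Nat.div_div_eq_div_mul]
  omega

theorem isDegreeSplitting_levelGraph
    (hL : IsLeafMap (2 * numEdges G) h R.tl R.tw leaf) {k : ℕ} (hk : k < h) (σ : ℕ) :
    IsDegreeSplitting (R.levelGraph leaf (k + 1) σ) (R.levelGraph leaf k (2 * σ))
      (R.levelGraph leaf k (2 * σ + 1)) := by
  have htw : ∀ τ, ∀ a < 2 * numEdges G, leaf a / 2 ^ k = τ → leaf (R.tw a) / 2 ^ k = τ :=
    fun τ a ha h => by rwa [hL.twin a ha]
  refine ⟨?_, ?_, fun v => ?_⟩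
  · rw [← SimpleGraph.edgeSet_inj, SimpleGraph.edgeSet_sup]
    ext e
    simp only [Set.mem_union, mem_edgeSet_arcGraph, div_pow_succ_eq_iff, or_and_right, exists_or]
  · ext u v
    simp only [SimpleGraph.inf_adj, SimpleGraph.bot_adj, iff_false, not_and]
    intro h1 h2
    obtain ⟨h1, h1'⟩ := (arcGraph_adj (htw _)).1 h1
    obtain ⟨h2, h2'⟩ := (arcGraph_adj (htw _)).1 h2
    omega
  · by_cases hv : v ∈ G.support
    · obtain ⟨i, rfl⟩ : ∃ i, (R.vert i : V) = v := ⟨R.vert.symm ⟨v, hv⟩, by simp⟩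
      rw [deg_arcGraph (htw _), deg_arcGraph (htw _), abs_le]
      have := hL.halves k hk i σ
      simp only [and_comm] at this ⊢
      omega
    · rw [deg_eq_zero fun h => hv (SimpleGraph.support_mono (arcGraph_le (htw _)) h),
        deg_eq_zero fun h => hv (SimpleGraph.support_mono (arcGraph_le (htw _)) h)]
      simp

theorem colorOffset_mono {N : ℕ} {tl : ℕ → ℕ} : Monotone (colorOffset N tl leaf) :=
  fun _ _ h => sum_le_sum_of_subset (range_mono h)

/-- Proper colorings of the parts by the base algorithm, with disjoint palettes, are a result of the
procedure. -/
theorem approxEdgeColoring_of_parts [Fintype V] {A : Program}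
    (hL : IsLeafMap (2 * numEdges G) h R.tl R.tw leaf) {φ : Sym2 V → ℕ}
    (hφ : ∀ s, (part (2 * numEdges G) leaf s).Nonempty → ∃ ψ,
      IsProperEdgeColoring (R.partGraph leaf s) (maxDeg (R.partGraph leaf s) + 1) ψ ∧
      CanOutput A (R.partGraph leaf s) ψ ∧ ∀ a : Fin (2 * numEdges G), leaf a = s →
        φ (R.arc a).edge = ψ (R.arc a).edge + colorOffset (2 * numEdges G) R.tl leaf s) :
    ApproxEdgeColoring A h G (colorOffset (2 * numEdges G) R.tl leaf (2 ^ h)) φ := by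
  obtain ⟨off, hoff⟩ : ∃ off, off = colorOffset (2 * numEdges G) R.tl leaf := ⟨_, rfl⟩
  have hmono : Monotone off := hoff ▸ colorOffset_mono
  have key : ∀ k ≤ h, ∀ σ, ApproxEdgeColoring A k (R.levelGraph leaf k σ)
      (off ((σ + 1) * 2 ^ k) - off (σ * 2 ^ k)) fun e => φ e - off (σ * 2 ^ k) := by
    intro k
    induction k with
    | zero =>
      intro _ s
      have hG : R.levelGraph leaf 0 s = R.partGraph leaf s := by simp [levelGraph, partGraph]
      have hk : off ((s + 1) * 2 ^ 0) - off (s * 2 ^ 0) = maxDeg (R.partGraph leaf s) + 1 := by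
        rw [maxDeg_partGraph hL.twin, hoff, pow_zero, mul_one, mul_one, colorOffset, colorOffset,
          sum_range_succ, Nat.add_sub_cancel_left]
      rw [hG, hk, pow_zero, mul_one]
      by_cases hs : (part (2 * numEdges G) leaf s).Nonempty
      · obtain ⟨ψ, h1, h2, h3⟩ := hφ s hs
        have h4 : ∀ e ∈ (R.partGraph leaf s).edgeSet, φ e - off s = ψ e := fun e he => by
          obtain ⟨a, ha, rfl⟩ := mem_edgeSet_arcGraph.1 he
          rw [h3 a ha, hoff, Nat.add_sub_cancel]
        exact .base (h1.congr h4) fun _ => h2.congr h4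
      · have hbot : R.partGraph leaf s = ⊥ := by
          rw [← SimpleGraph.edgeSet_eq_empty]
          refine Set.eq_empty_of_forall_notMem fun e he => hs ?_
          obtain ⟨a, ha, -⟩ := mem_edgeSet_arcGraph.1 he
          exact ⟨a, mem_part.2 ⟨a.2, ha⟩⟩
        exact .base (hbot ▸ isProperEdgeColoring_bot) fun h => absurd hbot h
    | succ k ih =>
      intro hk σ
      have e1 : σ * 2 ^ (k + 1) = 2 * σ * 2 ^ k := by ring
      have e2 : (σ + 1) * 2 ^ (k + 1) = (2 * σ + 1 + 1) * 2 ^ k := by ring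
      have m1 : off (2 * σ * 2 ^ k) ≤ off ((2 * σ + 1) * 2 ^ k) :=
        hmono (Nat.mul_le_mul_right _ (by omega))
      have m2 : off ((2 * σ + 1) * 2 ^ k) ≤ off ((2 * σ + 1 + 1) * 2 ^ k) :=
        hmono (Nat.mul_le_mul_right _ (by omega))
      rw [e1, e2, show off ((2 * σ + 1 + 1) * 2 ^ k) - off (2 * σ * 2 ^ k) =
        off ((2 * σ + 1) * 2 ^ k) - off (2 * σ * 2 ^ k) +
          (off ((2 * σ + 1 + 1) * 2 ^ k) - off ((2 * σ + 1) * 2 ^ k)) by omega]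
      refine .split (isDegreeSplitting_levelGraph hL (by omega) σ) (ih (by omega) (2 * σ))
        (ih (by omega) (2 * σ + 1)) (fun _ _ => rfl) fun e he => ?_
      -- the colors of the second graph are above the palette of the first one
      obtain ⟨a, ha, rfl⟩ := mem_edgeSet_arcGraph.1 he
      obtain ⟨ψ, -, -, h3⟩ := hφ (leaf a) ⟨a, mem_part.2 ⟨a.2, rfl⟩⟩
      have h1 : off ((2 * σ + 1) * 2 ^ k) ≤ off (leaf a) :=
        hmono (by rw [← ha]; exact Nat.div_mul_le_self _ _)
      have h2 := h3 a rfl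
      rw [← hoff] at h2
      omega
  have hG : R.levelGraph leaf h 0 = G := by
    rw [← SimpleGraph.edgeSet_inj]
    ext e
    rw [mem_edgeSet_arcGraph]
    constructor
    · rintro ⟨a, -, rfl⟩
      exact (R.arc a).edge_mem
    · induction e with | _ u v
      intro he
      exact ⟨R.arc.symm ⟨(u, v), he⟩, Nat.div_eq_of_lt (hL.lt _ (Fin.is_lt _)), by
        rw [R.arc.apply_symm_apply]
        rfl⟩
  have h0 : off 0 = 0 := by simp [hoff, colorOffset]
  simpa [hG, h0, ← hoff] using key h le_rfl 0

/-- A memory in which opposite arcs have the same color stores a coloring. -/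
theorem exists_stores {M : Memory} (hM : ∀ a b : Fin (2 * numEdges G),
    (R.arc a).edge = (R.arc b).edge → M 5 a = M 5 b) : ∃ φ, R.Stores M φ := by
  have hf : Function.FactorsThrough (fun a : Fin (2 * numEdges G) => M 5 a)
      (fun a => (R.arc a).edge) := fun a b => hM a b
  exact ⟨_, fun a => (hf.extend_apply 0 a).symm⟩

theorem leaf_eq_of_edge_eq (htw : ∀ a < 2 * numEdges G, leaf (R.tw a) = leaf a)
    {a b : Fin (2 * numEdges G)} (h : (R.arc a).edge = (R.arc b).edge) : leaf a = leaf b := by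
  rcases (SimpleGraph.dart_edge_eq_iff _ _).1 h with h | h
  · rw [R.arc.injective h]
  · rw [← R.arc_twin] at h
    rw [R.arc.injective h, ← tw_coe, htw b b.2]

end AdjacencyLists

end EdgeColoring

/-! ### The number of colors -/

namespace EdgeColoring

variable {V : Type}

theorem deg_add_deg [Fintype V] {G G₁ G₂ : SimpleGraph V} (h : IsDegreeSplitting G G₁ G₂) (v : V) :
    deg G₁ v + deg G₂ v = deg G v := by
  obtain ⟨h1, h2, -⟩ := h
  rw [deg, deg, deg, ← Set.ncard_union_eq]
  · congr 1
    ext u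
    rw [← h1]
    simp
  · rw [Set.disjoint_left]
    intro u hu hu'
    have : (G₁ ⊓ G₂).Adj v u := ⟨hu, hu'⟩
    rw [h2] at this
    exact this

theorem deg_le_maxDeg [Fintype V] (G : SimpleGraph V) (v : V) : deg G v ≤ maxDeg G :=
  Finset.le_sup (f := deg G) (Finset.mem_univ v)

theorem IsDegreeSplitting.maxDeg_le [Fintype V] {G G₁ G₂ : SimpleGraph V}
    (h : IsDegreeSplitting G G₁ G₂) :
    2 * maxDeg G₁ ≤ maxDeg G + 2 ∧ 2 * maxDeg G₂ ≤ maxDeg G + 2 := by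
  have key : ∀ v, 2 * deg G₁ v ≤ maxDeg G + 2 ∧ 2 * deg G₂ v ≤ maxDeg G + 2 := fun v => by
    have h1 := deg_add_deg h v
    have h2 := abs_le.1 (h.2.2 v)
    have h3 := deg_le_maxDeg G v
    omega
  have h1 : maxDeg G₁ ≤ (maxDeg G + 2) / 2 := Finset.sup_le fun v _ => by have := key v; omega
  have h2 : maxDeg G₂ ≤ (maxDeg G + 2) / 2 := Finset.sup_le fun v _ => by have := key v; omega
  omega

/-- The halving of the degrees costs two colors at every node of the recursion, and the base
algorithm one color at every leaf. -/
theorem ApproxEdgeColoring.isProperEdgeColoring [Fintype V] {A : Program} {h k : ℕ}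
    {G : SimpleGraph V} {φ : Sym2 V → ℕ} (H : ApproxEdgeColoring A h G k φ) :
    IsProperEdgeColoring G k φ ∧ k + 2 ≤ maxDeg G + 3 * 2 ^ h := by
  induction H with
  | base h1 _ => exact ⟨h1, by omega⟩
  | @split h G G₁ G₂ k₁ k₂ φ₁ φ₂ φ hs _ _ e1 e2 ih1 ih2 =>
    obtain ⟨p1, b1⟩ := ih1
    obtain ⟨p2, b2⟩ := ih2
    have hG : G.edgeSet = G₁.edgeSet ∪ G₂.edgeSet := by rw [← hs.1, SimpleGraph.edgeSet_sup]
    refine ⟨⟨fun e he => ?_, fun e he e' he' hne hv => ?_⟩, ?_⟩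
    · rw [hG] at he
      rcases he with he | he
      · have := p1.1 e he
        rw [e1 e he]; omega
      · have := p2.1 e he
        rw [e2 e he]; omega
    · rw [hG] at he he'
      rcases he with he | he <;> rcases he' with he' | he'
      · rw [e1 e he, e1 e' he']
        exact p1.2 e he e' he' hne hv
      · rw [e1 e he, e2 e' he']
        have := p1.1 e he
        have := p2.1 e' he'
        omega
      · rw [e2 e he, e1 e' he']
        have := p2.1 e he
        have := p1.1 e' he'
        omega
      · rw [e2 e he, e2 e' he']
        have := p2.2 e he e' he' hne hv
        omega
    · have := hs.maxDeg_le
      rw [pow_succ]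
      omega

theorem IsProperEdgeColoring.mono {G : SimpleGraph V} {k k' : ℕ} {φ : Sym2 V → ℕ}
    (h : IsProperEdgeColoring G k φ) (hk : k ≤ k') : IsProperEdgeColoring G k' φ :=
  ⟨fun e he => ⟨(h.1 e he).1, (h.1 e he).2.trans hk⟩, h.2⟩

/-- The depth is the largest one, apart from `0`, for which `3 * 2 ^ h ≤ ε * Δ`. -/
theorem depth_spec {ε : ℝ} {Δ : ℕ} (hΔ : 0 < Δ) (hε : 0 < ε) :
    (depth ε Δ = 0 ∨ 3 * 2 ^ depth ε Δ ≤ ε * Δ) ∧ ε * Δ ≤ 6 * 2 ^ depth ε Δ := by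
  have hx : 0 < ε * Δ / 3 := by positivity
  obtain ⟨x, hx'⟩ : ∃ x, x = Real.logb 2 (ε * Δ / 3) := ⟨_, rfl⟩
  have hpow : (2 : ℝ) ^ x = ε * Δ / 3 := by
    rw [hx', Real.rpow_logb (by norm_num) (by norm_num) hx]
  rw [depth, ← hx']
  constructor
  · rcases le_or_gt ⌊x⌋ 0 with h0 | h0
    · left
      rw [max_eq_right h0, Int.toNat_zero]
    · right
      rw [max_eq_left h0.le]
      have h1 : ((⌊x⌋.toNat : ℕ) : ℝ) ≤ x := by
        rw [show ((⌊x⌋.toNat : ℕ) : ℝ) = ((⌊x⌋.toNat : ℤ) : ℝ) from (Int.cast_natCast _).symm,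
          Int.toNat_of_nonneg h0.le]
        exact Int.floor_le x
      have h2 := Real.rpow_le_rpow_of_exponent_le (x := 2) (by norm_num) h1
      rw [Real.rpow_natCast, hpow] at h2
      linarith
  · have h1 : x ≤ (((max ⌊x⌋ 0).toNat + 1 : ℕ) : ℝ) := by
      have h2 := (Int.lt_floor_add_one x).le
      have h3 : ⌊x⌋ + 1 ≤ (((max ⌊x⌋ 0).toNat + 1 : ℕ) : ℤ) := by omega
      have h4 : ((⌊x⌋ + 1 : ℤ) : ℝ) ≤ (((max ⌊x⌋ 0).toNat + 1 : ℕ) : ℝ) := by exact_mod_cast h3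
      push_cast at h4 ⊢
      linarith
    have h2 := Real.rpow_le_rpow_of_exponent_le (x := 2) (by norm_num) h1
    rw [Real.rpow_natCast, hpow, pow_succ] at h2
    linarith

theorem ApproxEdgeColoring.proper_of_depth [Fintype V] {A : Program} {k : ℕ}
    {G : SimpleGraph V} {φ : Sym2 V → ℕ} {ε : ℝ}
    (H : ApproxEdgeColoring A (depth ε (maxDeg G)) G k φ)
    (hΔ : 0 < maxDeg G) (hε : 1 / (maxDeg G : ℝ) ≤ ε) :
    IsProperEdgeColoring G ⌊(1 + ε) * maxDeg G⌋₊ φ := by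
  obtain ⟨h1, h2⟩ := H.isProperEdgeColoring
  have hΔ' : (0 : ℝ) < maxDeg G := by exact_mod_cast hΔ
  have hε0 : 0 < ε := (by positivity : 0 < 1 / (maxDeg G : ℝ)).trans_le hε
  refine h1.mono (Nat.le_floor ?_)
  have h2' : (k : ℝ) + 2 ≤ maxDeg G + 3 * 2 ^ depth ε (maxDeg G) := by exact_mod_cast h2
  rcases (depth_spec hΔ hε0).1 with h3 | h3
  · rw [h3] at h2'
    have : 1 ≤ ε * maxDeg G := (div_le_iff₀ hΔ').1 hε
    linarith
  · linarith

end EdgeColoring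

/-! ### The sizes of the parts -/

namespace EdgeColoring

open Finset

theorem exists_adj {V : Type} {G : SimpleGraph V} (h : 0 < numEdges G) : ∃ u v, G.Adj u v := by
  obtain ⟨e, he⟩ := Set.nonempty_of_ncard_ne_zero h.ne'
  induction e with | _ u v
  exact ⟨u, v, he⟩

variable {V : Type} [Fintype V] {G H : SimpleGraph V}

theorem numVertices_mono (h : H ≤ G) : numVertices H ≤ numVertices G :=
  Set.ncard_le_ncard (SimpleGraph.support_mono h) (Set.toFinite _)

theorem maxDeg_mono (h : H ≤ G) : maxDeg H ≤ maxDeg G :=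
  Finset.sup_mono_fun fun _ _ => Set.ncard_le_ncard (fun _ hu => h hu) (Set.toFinite _)

theorem maxDeg_le_numVertices (G : SimpleGraph V) : maxDeg G ≤ numVertices G :=
  Finset.sup_le fun _ _ => Set.ncard_le_ncard (fun _ hu => G.mem_support.2 ⟨_, hu.symm⟩)
    (Set.toFinite _)

theorem maxDeg_le_numEdges (G : SimpleGraph V) : maxDeg G ≤ numEdges G :=
  Finset.sup_le fun v _ => Set.ncard_le_ncard_of_injOn (fun u => s(v, u)) (fun _ hu => hu)
    (fun _ _ _ _ h => Sym2.congr_right.1 h) (Set.toFinite _)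

theorem two_mul_numEdges_le (G : SimpleGraph V) :
    2 * numEdges G ≤ numVertices G * numVertices G := by
  classical
  rw [two_mul_numEdges, numVertices, ← Nat.card_coe_set_eq, ← Nat.card_prod]
  refine Nat.card_le_card_of_injective (fun d => (⟨d.fst, G.mem_support.2 ⟨_, d.adj⟩⟩,
    ⟨d.snd, G.mem_support.2 ⟨_, d.adj.symm⟩⟩)) fun d d' h => ?_
  simp only [Prod.mk.injEq, Subtype.mk.injEq] at h
  rw [SimpleGraph.Dart.ext_iff]
  exact Prod.ext h.1 h.2

theorem two_le_numVertices (h : 0 < numEdges G) : 2 ≤ numVertices G := by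
  obtain ⟨u, v, huv⟩ := exists_adj h
  exact (Set.one_lt_ncard (Set.toFinite _)).2
    ⟨u, G.mem_support.2 ⟨_, huv⟩, v, G.mem_support.2 ⟨_, huv.symm⟩, huv.ne⟩

theorem maxDeg_pos (h : 0 < numEdges G) : 0 < maxDeg G := by
  obtain ⟨u, v, huv⟩ := exists_adj h
  exact ((Set.ncard_pos (Set.toFinite _)).2 ⟨v, huv⟩).trans_le (deg_le_maxDeg G u)

namespace AdjacencyLists

variable {R : AdjacencyLists G} {leaf : ℕ → ℕ} {h : ℕ}

/-- Halving `j` times reduces the maximum degree, minus `2`, by the factor `2 ^ j`. -/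
theorem maxDeg_levelGraph (hL : IsLeafMap (2 * numEdges G) h R.tl R.tw leaf) {j k : ℕ}
    (hk : k + j = h) (σ : ℕ) :
    2 ^ j * maxDeg (R.levelGraph leaf k σ) + 2 ≤ maxDeg G + 2 * 2 ^ j := by
  induction j generalizing k σ with
  | zero =>
    have : R.levelGraph leaf k σ ≤ G := arcGraph_le fun a ha h => by rwa [hL.twin a ha]
    have := maxDeg_mono this
    omega
  | succ j ih =>
    have h1 := ih (k := k + 1) (by omega) (σ / 2)
    have h2 := (isDegreeSplitting_levelGraph hL (k := k) (by omega) (σ / 2)).maxDeg_le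
    have h3 : 2 * maxDeg (R.levelGraph leaf k σ) ≤
        maxDeg (R.levelGraph leaf (k + 1) (σ / 2)) + 2 := by
      rcases Nat.mod_two_eq_zero_or_one σ with h0 | h0
      · have : 2 * (σ / 2) = σ := by omega
        rw [this] at h2
        exact h2.1
      · have : 2 * (σ / 2) + 1 = σ := by omega
        rw [this] at h2
        exact h2.2
    have h4 := Nat.mul_le_mul_left (2 ^ j) h3
    rw [pow_succ]
    nlinarith

theorem maxDeg_partGraph_le (hL : IsLeafMap (2 * numEdges G) h R.tl R.tw leaf)
    (hh : 2 ^ h ≤ maxDeg G) (s : ℕ) :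
    (maxDeg (R.partGraph leaf s) : ℝ) ≤ 3 * (maxDeg G / 2 ^ h) := by
  have hG : R.levelGraph leaf 0 s = R.partGraph leaf s := by simp [levelGraph, partGraph]
  have h1 := maxDeg_levelGraph hL (j := h) (k := 0) (by omega) s
  rw [hG] at h1
  rw [← mul_div_assoc, le_div_iff₀ (by positivity)]
  have : maxDeg (R.partGraph leaf s) * 2 ^ h ≤ 3 * maxDeg G := by
    rw [mul_comm]; omega
  exact_mod_cast this

theorem numEdges_partGraph_pos (htw : ∀ a < 2 * numEdges G, leaf (R.tw a) = leaf a) {s : ℕ}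
    (hs : (part (2 * numEdges G) leaf s).Nonempty) : 0 < numEdges (R.partGraph leaf s) := by
  have := two_mul_numEdges_partGraph (s := s) htw
  have := card_pos.2 hs
  omega

/-- Since the base algorithm has to write colors, it takes at least one step. -/
theorem one_le_time (R : AdjacencyLists G) (hG : 0 < numEdges G) {A : Program} {w : ℕ}
    {ECT ECP : ℕ → ℝ → ℝ} (hA : SolvesVizing A w ECT ECP) (hT : IsCostFunction ECT) {x : ℝ}
    (hx : 1 ≤ x) : 1 ≤ ECT (numVertices G) x := by
  have htwm := R.isArcs.twin
  -- the graph that consists of the edge of the first arc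
  obtain ⟨leaf, hleaf⟩ : ∃ leaf : ℕ → ℕ, ∀ a, leaf a = if a = 0 ∨ a = R.tw 0 then 0 else 1 :=
    ⟨_, fun _ => rfl⟩
  have htw : ∀ a < 2 * numEdges G, leaf (R.tw a) = leaf a := fun a ha => by
    have h1 := htwm.invol a ha
    have h2 := htwm.invol 0 (by omega)
    have h3 : (R.tw a = 0 ∨ R.tw a = R.tw 0) ↔ (a = 0 ∨ a = R.tw 0) := by
      constructor
      · rintro (h | h)
        · right; rw [← h1, h]
        · left; rw [← h1, h, h2]
      · rintro (rfl | rfl)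
        · exact .inr rfl
        · exact .inl h2
    rw [hleaf, hleaf, if_congr h3 rfl rfl]
  have hpos : 0 < numEdges (R.partGraph leaf 0) :=
    numEdges_partGraph_pos htw ⟨0, mem_part.2 ⟨by omega, by simp [hleaf]⟩⟩
  have hdeg : maxDeg (R.partGraph leaf 0) ≤ 1 := by
    have h1 := maxDeg_le_numEdges (R.partGraph leaf 0)
    have h2 := two_mul_numEdges_partGraph (s := 0) htw
    have h3 : part (2 * numEdges G) leaf 0 ⊆ {0, R.tw 0} := fun a ha => by
      have := (mem_part.1 ha).2
      rw [hleaf] at this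
      split_ifs at this with h
      simpa using h
    have h4 := (card_le_card h3).trans card_le_two
    omega
  obtain ⟨P, hP⟩ := exists_nat_ge (numEdges (R.partGraph leaf 0) *
    ECP (numVertices (R.partGraph leaf 0)) (maxDeg (R.partGraph leaf 0)))
  have hrun := hA V _ (partLists (s := 0) htw) P hpos hP 0 _ (.refl _)
  have hn := two_le_numVertices hpos
  have h1 : 1 ≤ ECT (numVertices (R.partGraph leaf 0)) (maxDeg (R.partGraph leaf 0)) := by
    by_contra! hlt
    obtain ⟨-, φ, h1, h2⟩ := hrun.2 (by rw [Nat.floor_eq_zero.2 hlt])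
    have h3 := h1 ⟨0, by omega⟩
    have h4 := (h2.1 _ (((partLists (s := 0) htw).arc ⟨0, by omega⟩).edge_mem)).1
    rw [← h3] at h4
    exact absurd h4 (by simp [initial, ((partLists (s := 0) htw).isArcInput 0).zero 5 le_rfl 0])
  exact h1.trans (hT.mono _ _ _ _ hn (numVertices_mono (partGraph_le htw))
    (by exact_mod_cast maxDeg_pos hpos) ((by exact_mod_cast hdeg : (maxDeg _ : ℝ) ≤ 1).trans hx))

end AdjacencyLists

end EdgeColoring

/-! ### The implementation is correct -/

namespace PRAM

theorem Config.WordsBelow.mono {P W W' : ℕ} {c : Config P} (h : c.WordsBelow W) (hW : W ≤ W') :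
    c.WordsBelow W' :=
  ⟨fun a i => (h.1 a i).trans_le hW, fun p r => (h.2 p r).trans_le hW⟩

theorem RunsWithin.mono {A : Program} {P W : ℕ} {M : Memory} {T T' : ℝ} {post post' : Memory → Prop}
    (h : RunsWithin A P W M T post) (hT : T ≤ T') (hpost : ∀ M, post M → post' M) :
    RunsWithin A P W M T' post' := fun t c hc =>
  ⟨(h t c hc).1, fun ht => ((h t c hc).2 ((Nat.floor_le_floor hT).trans ht)).imp_right (hpost _)⟩

end PRAM

namespace EdgeColoring

open Finset

namespace AdjacencyLists

theorem input_lt {V : Type} {G : SimpleGraph V} (R : AdjacencyLists G) {h W : ℕ}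
    (hn : numVertices G < W) (hm : 2 * numEdges G < W) (hh : h < W) (a i : ℕ) :
    R.input h a i < W := by
  unfold input
  split <;> try split_ifs
  all_goals try omega
  exact (card_le_univ _).trans_lt (by simpa using hm)

variable {V : Type} [Fintype V] {G : SimpleGraph V}

theorem colorOffset_le {N h s : ℕ} {tl leaf : ℕ → ℕ} (hs : s < 2 ^ h) (hh : 2 ^ h ≤ N) :
    colorOffset N tl leaf s ≤ N * (N + 1) := by
  refine (sum_le_card_nsmul _ _ (N + 1) fun i _ => Nat.succ_le_succ (partDeg_le i)).trans ?_
  rw [card_range, smul_eq_mul]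
  exact Nat.mul_le_mul_right _ (by omega)

/-- The implementation, with enough processors and time for the base algorithm on all parts. -/
theorem leads_approxEdgeColoring (R : AdjacencyLists G) {A : Program} {w : ℕ} {ECT ECP : ℕ → ℝ → ℝ}
    (hA : SolvesVizing A w ECT ECP) {h P T : ℕ} (hh : 2 ^ h ≤ maxDeg G) (hP : 4 * numEdges G ≤ P)
    (hparts : ∀ leaf, IsLeafMap (2 * numEdges G) h R.tl R.tw leaf → ∀ s,
      0 < numEdges (R.partGraph leaf s) →
      numEdges (R.partGraph leaf s) *
          ECP (numVertices (R.partGraph leaf s)) (maxDeg (R.partGraph leaf s)) ≤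
        ((P / (2 * numEdges G) * (2 * numEdges (R.partGraph leaf s)) : ℕ) : ℝ) ∧
      ⌊ECT (numVertices (R.partGraph leaf s)) (maxDeg (R.partGraph leaf s))⌋₊ ≤ T) :
    Leads (approxProgram A) (wordBound G P (w + 3))
      (fun c => c.Halted (approxProgram A) ∧
        ∃ φ k, R.Stores c.mem φ ∧ ApproxEdgeColoring A h G k φ)
      (approxTime (2 * numEdges G) h T) (initial P (R.input h)) := by
  obtain ⟨N, hN⟩ : ∃ N, N = 2 * numEdges G := ⟨_, rfl⟩
  obtain ⟨n, hn⟩ : ∃ n, n = numVertices G := ⟨_, rfl⟩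
  have h1h : 1 ≤ 2 ^ h := Nat.one_le_two_pow
  have hG := maxDeg_le_numEdges G
  have hh' : 2 ^ h ≤ N := by omega
  have hhN : h < N := Nat.lt_two_pow_self.trans_le hh'
  -- the word bound
  obtain ⟨x, hx⟩ : ∃ x, x = n + P + 2 := ⟨_, rfl⟩
  have hW : wordBound G P (w + 3) = x ^ w * (x * x * x) := by
    rw [wordBound, ← hn, ← hx, pow_add]; ring
  have hxw : 1 ≤ x ^ w := Nat.one_le_pow _ _ (by omega)
  have hxn : n < x := by omega
  have hxP : P + 2 ≤ x := by omega
  have hxx : 4 * x ≤ x * x := Nat.mul_le_mul_right _ (by omega)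
  have hxx' : 4 * (x * x) ≤ x * x * x := by
    rw [mul_assoc]
    exact Nat.mul_le_mul_right _ (by omega)
  have hW2 : 4 * (x * x) ≤ x ^ w * (x * x * x) := hxx'.trans (Nat.le_mul_of_pos_left _ hxw)
  have hNn : N * n + n ≤ x * x := by
    rw [← Nat.succ_mul]
    exact Nat.mul_le_mul (by omega) (by omega)
  have hNN : N * (N + 1) ≤ x * x := Nat.mul_le_mul (by omega) (by omega)
  have hWs : x ^ w + N * (N + 1) ≤ x ^ w * (x * x * x) := by
    have h1 : x ^ w * (1 + x * x) ≤ x ^ w * (x * x * x) := Nat.mul_le_mul_left _ (by omega)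
    have h2 : x * x ≤ x ^ w * (x * x) := Nat.le_mul_of_pos_left _ hxw
    rw [mul_add, mul_one] at h1
    omega
  have hLm := R.isArcs
  have hM := R.isArcInput h
  have hlt := R.input_lt (h := h) (W := x ^ w * (x * x * x)) (by omega) (by omega) (by omega)
  rw [← hN, ← hn] at hLm hM
  rw [← hN] at hparts ⊢
  rw [hW]
  refine (approxProgram_leads (T := T) (Ws := x ^ w) (post := fun leaf s M => ∃ ψ,
    IsProperEdgeColoring (R.partGraph leaf s) (maxDeg (R.partGraph leaf s) + 1) ψ ∧
      CanOutput A (R.partGraph leaf s) ψ ∧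
      ∀ a : Fin (2 * numEdges G), leaf a = s → M 5 (posIn leaf a) = ψ (R.arc a).edge)
    hLm hM (by omega) (by omega) (by omega) (by omega) (by omega) hh' (fun leaf hL s hs => ?_)
    hlt).weaken le_rfl ?_
  · subst hN
    have hpos := numEdges_partGraph_pos hL.twin hs
    have hs' : s < 2 ^ h := by
      obtain ⟨a, ha⟩ := hs
      obtain ⟨ha', rfl⟩ := mem_part.1 ha
      exact hL.lt a ha'
    refine ⟨le_trans (Nat.add_le_add_left (colorOffset_le hs' hh') _) hWs,
      (partLists (s := s) hL.twin).input 0, isPartInput_partLists hL.twin, ?_⟩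
    rw [← two_mul_numEdges_partGraph hL.twin]
    intro t c hc
    obtain ⟨hPs, hTs⟩ := hparts leaf hL s hpos
    have hrun := hA V _ (partLists (s := s) hL.twin) _ hpos hPs
    have hPle : P / (2 * numEdges G) * (2 * numEdges (R.partGraph leaf s)) ≤ P := by
      refine le_trans (Nat.mul_le_mul_left _ ?_) (Nat.div_mul_le_self P (2 * numEdges G))
      rw [two_mul_numEdges_partGraph hL.twin]
      exact (card_filter_le _ _).trans (by simp)
    refine ⟨(hrun t c hc).1.mono (Nat.pow_le_pow_left ?_ _), fun ht => ?_⟩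
    · have := numVertices_mono (partGraph_le (s := s) hL.twin)
      omega
    · obtain ⟨h1, ψ, h2, h3⟩ := (hrun t c hc).2 (hTs.trans ht)
      exact ⟨h1, ψ, h3, ⟨_, _, _, _, hc, h1, h2⟩, (stores_partLists_iff hL.twin).1 h2⟩
  · rintro c - ⟨hhalt, leaf, hL, hc⟩
    refine ⟨hhalt, ?_⟩
    subst hN
    have key : ∀ s, (part (2 * numEdges G) leaf s).Nonempty → ∃ ψ,
        IsProperEdgeColoring (R.partGraph leaf s) (maxDeg (R.partGraph leaf s) + 1) ψ ∧
        CanOutput A (R.partGraph leaf s) ψ ∧ ∀ a : Fin (2 * numEdges G), leaf a = s →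
          c.mem 5 a = ψ (R.arc a).edge + colorOffset (2 * numEdges G) R.tl leaf s := fun s hs => by
      obtain ⟨M', ⟨ψ, h1, h2, h3⟩, h4⟩ := hc s hs
      refine ⟨ψ, h1, h2, fun a ha => ?_⟩
      have h5 := h4 a (mem_part.2 ⟨a.2, ha⟩)
      rw [h3 a ha] at h5
      have h6 := (h1.1 _ (mem_edgeSet_arcGraph.2 ⟨a, ha, rfl⟩)).1
      exact h5.resolve_left (by omega)
    obtain ⟨φ, hφ⟩ := exists_stores (R := R) (M := c.mem) fun a b hab => by
      obtain ⟨ψ, -, -, h3⟩ := key (leaf a) ⟨a, mem_part.2 ⟨a.2, rfl⟩⟩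
      rw [h3 a rfl, h3 b (leaf_eq_of_edge_eq hL.twin hab).symm, hab]
    refine ⟨φ, _, hφ, approxEdgeColoring_of_parts hL fun s hs => ?_⟩
    obtain ⟨ψ, h1, h2, h3⟩ := key s hs
    exact ⟨ψ, h1, h2, fun a ha => (hφ a).symm.trans (h3 a ha)⟩

end AdjacencyLists

end EdgeColoring

/-! ### The complexity of the implementation -/

namespace EdgeColoring

/-- Pointer doubling and prefix sums over the at most `n ^ 2` arcs take `O(log n)` rounds. -/
theorem clog_le {n N : ℕ} (hn : 2 ≤ n) (hN : N ≤ n * n) :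
    (Nat.clog 2 (2 * N) : ℝ) ≤ 5 * Real.logb 2 n := by
  have h1 : n ≤ 2 ^ Nat.clog 2 n := Nat.le_pow_clog (by norm_num) n
  have h2 : Nat.clog 2 (2 * N) ≤ 2 * Nat.clog 2 n + 1 := by
    refine Nat.clog_le_of_le_pow ?_
    calc 2 * N ≤ 2 * (n * n) := Nat.mul_le_mul_left _ hN
      _ ≤ 2 * (2 ^ Nat.clog 2 n * 2 ^ Nat.clog 2 n) :=
        Nat.mul_le_mul_left _ (Nat.mul_le_mul h1 h1)
      _ = 2 ^ (2 * Nat.clog 2 n + 1) := by ring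
  have h3 : 1 ≤ Real.logb 2 n := by
    rw [Real.le_logb_iff_rpow_le (by norm_num) (by positivity), Real.rpow_one]
    exact_mod_cast hn
  have h4 : (Nat.clog 2 n : ℝ) < Real.logb 2 n + 1 := by
    have h5 := Nat.ceil_lt_add_one (a := Real.logb 2 n) (by linarith)
    rwa [show (2 : ℝ) = (2 : ℕ) by norm_num, Real.natCeil_logb_natCast] at h5
  have h5 : (Nat.clog 2 (2 * N) : ℝ) ≤ 2 * Nat.clog 2 n + 1 := by exact_mod_cast h2
  linarith

theorem approxTime_le {n N h T : ℕ} {C E : ℝ} (hn : 2 ≤ n) (hN : N ≤ n * n) (hE : 1 ≤ E)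
    (hT : (T : ℝ) ≤ C * E) :
    (approxTime N h T : ℝ) ≤ (28 + 4 * C) * E + 401 * (h * Real.logb 2 n) := by
  have h1 := clog_le hn hN
  have h3 : 1 ≤ Real.logb 2 n := by
    rw [Real.le_logb_iff_rpow_le (by norm_num) (by positivity), Real.rpow_one]
    exact_mod_cast hn
  rw [approxTime]
  generalize Real.logb 2 n = l at *
  rcases Nat.eq_zero_or_pos h with rfl | hh
  · rw [if_pos rfl]
    push_cast
    linarith
  · rw [if_neg hh.ne']
    have hh' : (1 : ℝ) ≤ h := by exact_mod_cast hh
    have h4 : l ≤ h * l := le_mul_of_one_le_left (by linarith) hh'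
    have h5 : (h : ℝ) ≤ h * l := le_mul_of_one_le_right (by linarith) h3
    have h6 : (h : ℝ) * Nat.clog 2 (2 * N) ≤ h * (5 * l) :=
      mul_le_mul_of_nonneg_left h1 (by linarith)
    push_cast
    linarith

/-- The resources needed, in terms of a bound `x` on the maximum degree of the parts, up to a
constant factor. -/
theorem exists_runsWithin {A : Program} {w : ℕ} {ECT ECP : ℕ → ℝ → ℝ}
    (hA : SolvesVizing A w ECT ECP) (hT : IsCostFunction ECT) (hP : IsCostFunction ECP)
    (hPone : ∃ c : ℝ, 0 < c ∧ ∀ (n : ℕ) (x : ℝ), 2 ≤ n → 1 ≤ x → c ≤ ECP n x) :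
    ∃ C : ℝ, 0 < C ∧ ∀ (V : Type) [Fintype V] (G : SimpleGraph V) (R : AdjacencyLists G)
      (P h : ℕ) (x : ℝ), 2 ^ h ≤ maxDeg G → 1 ≤ x → maxDeg G / 2 ^ h ≤ 6 * x →
      C * (numEdges G * ECP (numVertices G) x) ≤ (P : ℝ) →
      RunsWithin (approxProgram A) P (wordBound G P (w + 3)) (R.input h)
        (C * (ECT (numVertices G) x + h * Real.logb 2 (numVertices G)))
        fun M => ∃ φ k, R.Stores M φ ∧ ApproxEdgeColoring A h G k φ := by
  obtain ⟨c, hc, hPone⟩ := hPone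
  obtain ⟨C₁, hC₁, hP'⟩ := hP.scale 1 18 le_rfl (by norm_num)
  obtain ⟨C₂, hC₂, hT'⟩ := hT.scale 1 18 le_rfl (by norm_num)
  have hc4 : 0 < 4 / c := by positivity
  refine ⟨429 + 4 * C₂ + 2 * C₁ + 4 / c, by positivity,
    fun V _ G R P h x hh hx hΔ hPle => ?_⟩
  have h2h : 1 ≤ 2 ^ h := Nat.one_le_two_pow
  have hm : 0 < numEdges G := by have := maxDeg_le_numEdges G; omega
  have hn := two_le_numVertices hm
  have hE := R.one_le_time hm hA hT hx
  have hℓ : 0 ≤ (h : ℝ) * Real.logb 2 (numVertices G) :=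
    mul_nonneg (by positivity) (Real.logb_nonneg (by norm_num) (by exact_mod_cast (by omega)))
  have hme : (0 : ℝ) < numEdges G := by exact_mod_cast hm
  have hle : ∀ leaf, IsLeafMap (2 * numEdges G) h R.tl R.tw leaf → ∀ s,
      (maxDeg (R.partGraph leaf s) : ℝ) ≤ 18 * x := fun leaf hL s =>
    (R.maxDeg_partGraph_le hL hh s).trans (by linarith)
  obtain ⟨e, he'⟩ : ∃ e, e = ECP (numVertices G) x := ⟨_, rfl⟩
  have he := hPone _ _ hn hx
  rw [← he'] at he hPle
  have hme' : 0 < numEdges G * e := mul_pos hme (hc.trans_le he)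
  -- there are two processors for every arc
  have hP4 : 4 * numEdges G ≤ P := by
    have h1 : 4 / c * (numEdges G * e) ≤ P := by
      refine le_trans (mul_le_mul_of_nonneg_right ?_ hme'.le) hPle
      linarith
    have h2 : 4 * (numEdges G : ℝ) ≤ 4 / c * (numEdges G * e) := by
      rw [div_mul_eq_mul_div, le_div_iff₀ hc]
      nlinarith
    exact_mod_cast h2.trans h1
  have hP2 : 2 * C₁ * (numEdges G * e) ≤ P := by
    refine le_trans (mul_le_mul_of_nonneg_right ?_ hme'.le) hPle
    linarith
  -- less than half of the processors are idle
  have hq : (P : ℝ) ≤ 4 * (P / (2 * numEdges G) : ℕ) * numEdges G := by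
    have h1 : 1 ≤ P / (2 * numEdges G) := (Nat.one_le_div_iff (by omega)).2 (by omega)
    have h2 := Nat.lt_div_mul_add (a := P) (b := 2 * numEdges G) (by omega)
    have h3 : P ≤ 4 * (P / (2 * numEdges G)) * numEdges G := by nlinarith
    exact_mod_cast h3
  have hlead := R.leads_approxEdgeColoring hA (T := ⌊C₂ * ECT (numVertices G) x⌋₊) hh hP4
    fun leaf hL s hs => ?_
  · refine fun t c' hR => (hlead.runs (post := fun M => ∃ φ k, R.Stores M φ ∧
      ApproxEdgeColoring A h G k φ) t c' hR).imp_right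
        fun h1 ht => h1 (le_trans (Nat.le_floor ?_) ht)
    have h1 := approxTime_le (h := h) hn (two_mul_numEdges_le G) hE
      (Nat.floor_le (mul_nonneg hC₂.le (by linarith) : 0 ≤ C₂ * ECT (numVertices G) x))
    refine h1.trans ?_
    have h2 : 0 ≤ (401 + 2 * C₁ + 4 / c) * ECT (numVertices G) x :=
      mul_nonneg (by positivity) (by linarith)
    have h3 : 0 ≤ (28 + 4 * C₂ + 2 * C₁ + 4 / c) * (h * Real.logb 2 (numVertices G)) :=
      mul_nonneg (by positivity) hℓ
    linarith
  · have h1 := numVertices_mono (R.partGraph_le (leaf := leaf) (s := s) hL.twin)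
    have h2 : (1 : ℝ) ≤ maxDeg (R.partGraph leaf s) := by exact_mod_cast maxDeg_pos hs
    have h3 := two_le_numVertices hs
    constructor
    · have h4 := (hP.mono _ _ _ _ h3 h1 h2 (hle leaf hL s)).trans
        (by simpa [← he'] using hP' (numVertices G) x hn hx)
      have h5 : C₁ * e ≤ 2 * (P / (2 * numEdges G) : ℕ) := by
        refine le_of_mul_le_mul_right ?_ hme
        linarith
      have h6 := mul_le_mul_of_nonneg_left (h4.trans h5)
        (Nat.cast_nonneg (numEdges (R.partGraph leaf s)))
      rw [Nat.cast_mul, Nat.cast_mul]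
      push_cast at h6 ⊢
      linarith
    · exact Nat.floor_le_floor ((hT.mono _ _ _ _ h3 h1 h2 (hle leaf hL s)).trans
        (by simpa using hT' (numVertices G) x hn hx))

theorem two_pow_depth_le {ε : ℝ} {Δ : ℕ} (hΔ : 0 < Δ) (hε : 0 < ε) (hε1 : ε < 1) :
    2 ^ depth ε Δ ≤ Δ := by
  have hΔ' : (0 : ℝ) < Δ := by exact_mod_cast hΔ
  rcases (depth_spec hΔ hε).1 with h | h
  · rw [h]
    omega
  · have h1 : ε * Δ ≤ Δ := mul_le_of_le_one_left hΔ'.le hε1.le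
    have h2 : (2 : ℝ) ^ depth ε Δ ≤ Δ := by
      have : (0 : ℝ) < 2 ^ depth ε Δ := by positivity
      linarith
    exact_mod_cast h2

/-- Halving to the chosen depth leaves a maximum degree of the order of `1 / ε`. -/
theorem div_two_pow_depth_le {ε : ℝ} {Δ : ℕ} (hΔ : 0 < Δ) (hε : 0 < ε) :
    (Δ : ℝ) / 2 ^ depth ε Δ ≤ 6 * ε⁻¹ := by
  rw [div_le_iff₀ (by positivity), mul_right_comm, ← div_eq_mul_inv, le_div_iff₀ hε, mul_comm]
  exact (depth_spec hΔ hε).2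

theorem processors_le {ECP : ℕ → ℝ → ℝ}
    (hPone : ∃ c : ℝ, 0 < c ∧ ∀ (n : ℕ) (x : ℝ), 2 ≤ n → 1 ≤ x → c ≤ ECP n x)
    {n m P : ℕ} {x C C' : ℝ} (hn : 2 ≤ n) (hx : 1 ≤ x) (hC' : 0 ≤ C')
    (h : (C + C') * (m * ECP n x) ≤ P) : C * (m * ECP n x) ≤ P := by
  obtain ⟨c, hc, hPone⟩ := hPone
  have h1 := mul_nonneg (Nat.cast_nonneg m) (hc.le.trans (hPone n x hn hx))
  have h2 := mul_nonneg hC' h1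
  linarith

/-- If `log ^ 2 n` is dominated by the time `E`, then so are the levels, as `h ≤ log n`. -/
theorem time_le {n h : ℕ} {C c E : ℝ} (hC : 0 < C) (hc : 0 < c) (hn : 0 < n) (hh : 2 ^ h ≤ n)
    (hE : c * Real.logb 2 n ^ 2 ≤ E) :
    C * (E + h * Real.logb 2 n) ≤ (C + C / c) * E := by
  have h1 : (h : ℝ) ≤ Real.logb 2 n := by
    rw [Real.le_logb_iff_rpow_le (by norm_num) (by exact_mod_cast hn), Real.rpow_natCast]
    exact_mod_cast hh
  have h2 : h * Real.logb 2 n ≤ Real.logb 2 n ^ 2 := by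
    rw [sq]
    exact mul_le_mul_of_nonneg_right h1 ((Nat.cast_nonneg h).trans h1)
  have h3 : C * (h * Real.logb 2 n) ≤ C / c * E := by
    rw [div_mul_eq_mul_div, le_div_iff₀ hc, mul_assoc]
    refine mul_le_mul_of_nonneg_left ?_ hC.le
    rw [mul_comm]
    exact (mul_le_mul_of_nonneg_left h2 hc.le).trans hE
  linarith

end EdgeColoring

theorem mainTheorem4
    -- a base algorithm, its time and its number of processors per edge
    (A : Program) (w : ℕ) (ECT ECP : ℕ → ℝ → ℝ)
    (hA : SolvesVizing A w ECT ECP)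
    (hT : IsCostFunction ECT) (hP : IsCostFunction ECP)
    (hTlog : ∃ c : ℝ, 0 < c ∧ ∀ (n : ℕ) (x : ℝ), 2 ≤ n → 1 ≤ x → x ≤ n →
      c * (Real.logb 2 x * Real.logb 2 n) ≤ ECT n x)
    (hPone : ∃ c : ℝ, 0 < c ∧ ∀ (n : ℕ) (x : ℝ), 2 ≤ n → 1 ≤ x → c ≤ ECP n x) :
    -- the coloring, whatever choices the procedure makes
    (∀ (V : Type) [Fintype V] (G : SimpleGraph V) (h k : ℕ) (φ : Sym2 V → ℕ),
      ApproxEdgeColoring A h G k φ →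
        (2 ^ h ≤ maxDeg G → IsProperEdgeColoring G (maxDeg G + 3 * 2 ^ h) φ) ∧
        (∀ ε : ℝ, 0 < maxDeg G → 1 / (maxDeg G : ℝ) ≤ ε → ε < 1 → h = depth ε (maxDeg G) →
          IsProperEdgeColoring G ⌊(1 + ε) * maxDeg G⌋₊ φ)) ∧
    -- the implementation
    ∃ (B : Program) (w' : ℕ),
      -- in general
      (∃ C : ℝ, 0 < C ∧
        ∀ (V : Type) [Fintype V] (G : SimpleGraph V) (R : AdjacencyLists G) (P : ℕ),
          (∀ h : ℕ, 2 ^ h ≤ maxDeg G →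
            C * (numEdges G * ECP (numVertices G) (maxDeg G / 2 ^ h)) ≤ (P : ℝ) →
            Achieves A B w' R h P
              (C * (ECT (numVertices G) (maxDeg G / 2 ^ h) + h * Real.logb 2 (numVertices G)))
              (maxDeg G + 3 * 2 ^ h)) ∧
          (∀ ε : ℝ, 0 < maxDeg G → 1 / (maxDeg G : ℝ) ≤ ε → ε < 1 →
            C * (numEdges G * ECP (numVertices G) ε⁻¹) ≤ (P : ℝ) →
            Achieves A B w' R (depth ε (maxDeg G)) P
              (C * (ECT (numVertices G) ε⁻¹ +
                depth ε (maxDeg G) * Real.logb 2 (numVertices G)))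
              ⌊(1 + ε) * maxDeg G⌋₊)) ∧
      -- if `ECT (n, x) = Ω(log² n)`
      ((∃ c : ℝ, 0 < c ∧ ∀ (n : ℕ) (x : ℝ), 2 ≤ n → 1 ≤ x →
          c * Real.logb 2 n ^ 2 ≤ ECT n x) →
        ∃ C : ℝ, 0 < C ∧
          ∀ (V : Type) [Fintype V] (G : SimpleGraph V) (R : AdjacencyLists G) (P : ℕ),
            (∀ h : ℕ, 2 ^ h ≤ maxDeg G →
              C * (numEdges G * ECP (numVertices G) (maxDeg G / 2 ^ h)) ≤ (P : ℝ) →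
              Achieves A B w' R h P (C * ECT (numVertices G) (maxDeg G / 2 ^ h))
                (maxDeg G + 3 * 2 ^ h)) ∧
            (∀ ε : ℝ, 0 < maxDeg G → 1 / (maxDeg G : ℝ) ≤ ε → ε < 1 →
              C * (numEdges G * ECP (numVertices G) ε⁻¹) ≤ (P : ℝ) →
              Achieves A B w' R (depth ε (maxDeg G)) P (C * ECT (numVertices G) ε⁻¹)
                ⌊(1 + ε) * maxDeg G⌋₊)) := by
  have hcol : ∀ (V : Type) [Fintype V] (G : SimpleGraph V) (h k : ℕ) (φ : Sym2 V → ℕ),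
      ApproxEdgeColoring A h G k φ →
        (2 ^ h ≤ maxDeg G → IsProperEdgeColoring G (maxDeg G + 3 * 2 ^ h) φ) ∧
        (∀ ε : ℝ, 0 < maxDeg G → 1 / (maxDeg G : ℝ) ≤ ε → ε < 1 → h = depth ε (maxDeg G) →
          IsProperEdgeColoring G ⌊(1 + ε) * maxDeg G⌋₊ φ) := by
    refine fun V _ G h k φ H => ⟨fun _ => ?_, fun ε hΔ hε _ hh => ?_⟩
    · obtain ⟨h1, h2⟩ := H.isProperEdgeColoring
      exact h1.mono (by omega)
    · subst hh
      exact H.proper_of_depth hΔ hε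
  have hnm : ∀ (V : Type) [Fintype V] (G : SimpleGraph V), 0 < maxDeg G → 2 ≤ numVertices G :=
    fun V _ G h => two_le_numVertices (h.trans_le (maxDeg_le_numEdges G))
  obtain ⟨C, hC, hrun⟩ := exists_runsWithin hA hT hP hPone
  have hx : ∀ h Δ : ℕ, 2 ^ h ≤ Δ → (1 : ℝ) ≤ Δ / 2 ^ h := fun h Δ hh => by
    rw [one_le_div (by positivity)]
    exact_mod_cast hh
  have hε0 : ∀ (ε : ℝ) (Δ : ℕ), 0 < Δ → 1 / (Δ : ℝ) ≤ ε → 0 < ε :=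
    fun ε Δ hΔ hε => lt_of_lt_of_le (by positivity) hε
  have hx' : ∀ h Δ : ℕ, (Δ : ℝ) / 2 ^ h ≤ 6 * (Δ / 2 ^ h) := fun h Δ => by
    have : (0 : ℝ) ≤ Δ / 2 ^ h := by positivity
    linarith
  refine ⟨hcol, approxProgram A, w + 3,
    ⟨C, hC, fun V _ G R P => ⟨fun h hh hPle => ?_, fun ε hΔ hε hε1 hPle => ?_⟩⟩, fun hsq => ?_⟩
  · exact (hrun V G R P h _ hh (hx h _ hh) (hx' h _) hPle).mono le_rfl
      fun M ⟨φ, k, h1, h2⟩ => ⟨φ, k, h1, h2, (hcol V G h k φ h2).1 hh⟩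
  · have hε0 := hε0 ε _ hΔ hε
    exact (hrun V G R P _ _ (two_pow_depth_le hΔ hε0 hε1) ((one_le_inv₀ hε0).2 hε1.le)
      (div_two_pow_depth_le hΔ hε0) hPle).mono le_rfl
      fun M ⟨φ, k, h1, h2⟩ => ⟨φ, k, h1, h2, (hcol V G _ k φ h2).2 ε hΔ hε hε1 rfl⟩
  · obtain ⟨c, hc, hsq⟩ := hsq
    have hCc : 0 < C / c := by positivity
    -- `C / c * ECT` pays for the `C * h * log n` of the levels, since `h ≤ log n`
    refine ⟨C + C / c, by positivity, fun V _ G R P =>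
      ⟨fun h hh hPle => ?_, fun ε hΔ hε hε1 hPle => ?_⟩⟩
    · have hn := hnm V G (Nat.one_le_two_pow.trans hh)
      exact (hrun V G R P h _ hh (hx h _ hh) (hx' h _)
        (processors_le hPone hn (hx h _ hh) hCc.le hPle)).mono
        (time_le hC hc (by omega) (hh.trans (maxDeg_le_numVertices G)) (hsq _ _ hn (hx h _ hh)))
        fun M ⟨φ, k, h1, h2⟩ => ⟨φ, k, h1, h2, (hcol V G h k φ h2).1 hh⟩
    · have hn := hnm V G hΔ
      have hε0 := hε0 ε _ hΔ hε
      have hx := (one_le_inv₀ hε0).2 hε1.le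
      have hh := two_pow_depth_le hΔ hε0 hε1
      exact (hrun V G R P _ _ hh hx (div_two_pow_depth_le hΔ hε0)
        (processors_le hPone hn hx hCc.le hPle)).mono
        (time_le hC hc (by omega) (hh.trans (maxDeg_le_numVertices G)) (hsq _ _ hn hx))
        fun M ⟨φ, k, h1, h2⟩ => ⟨φ, k, h1, h2, (hcol V G _ k φ h2).2 ε hΔ hε hε1 rfl⟩
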